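/- Let $1<p<\infty$, $p^*=p/(p-1)$, $0<D\le\infty$, where $[0,D]$ means $[0,\infty)$ if $D=\infty$. Let $u,v$ be measurable functions that are positive almost everywhere on $(0,D)$, put $\hat v=v^{1-p^*}$, and assume that $u$ and $\hat v$ are locally integrable on $[0,D]$. Let $d\mu=u\,dx$ and $d\nu=v\,dx$. For an open interval $S\subseteq(0,D)$, "$v^{p^*-1}f'\in\mathscr C(S)$" means that $f$ is locally absolutely continuous on $S$ and $v^{p^*-1}f'$ coincides almost everywhere on $S$ with a continuous function. Pointwise, $v^{p^*-1}f'$ denotes the derivative $w$ of $f$ with respect to the measure $\hat v\,dx$, that is $w(x)=\lim_{y\to x}\big(f(y)-f(x)\big)\big/\int_x^y\hat v(t)\,dt$ (taken to be $0$ where the limit does not exist), which on such an $S$ is the continuous version; "$f'<0$ on $S$" means $w<0$ at every point of $S$, and $v f'|f'|^{p-2}$ is understood as $w|w|^{p-2}$. Let $\lambda_p\in[0,\infty]$ be the infimum of $D_p(f)=\int_0^D|f'|^p\,d\nu$ over all $f$ that are continuous on $[0,D]$ with compact support in $[0,D]$ and satisfy $v^{p^*-1}f'\in\mathscr C(0,D)$,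 $\mu(|f|^p)=\int_0^D |f|^p\,d\mu=1$ and, if $D<\infty$, $f(D)=0$. With values in $[0,\infty]$ and $1/0=\infty$, $1/\infty=0$, and with $\operatorname{supp}(f)=\{x\in[0,D]:f(x)\ne0\}$, put $$I(f)(x)=-\frac{1}{(v f'|f'|^{p-2})(x)}\int_0^x f^{p-1}\,d\mu,$$ $$I\!I(f)(x)=\frac1{f^{p-1}(x)}\bigg[\int_{(x,D)\cap\operatorname{supp}(f)}\hat v(s)\Big(\int_0^s f^{p-1}\,d\mu\Big)^{p^*-1}ds\bigg]^{p-1}.$$ Define the following sets of functions on $[0,D]$. * $\mathscr F_I$: all $f$ continuous on $[0,D]$ with $v^{p^*-1}f'\in\mathscr C(0,D)$, $f>0$ and $f'<0$ on $(0,D)$. * $\widetilde{\mathscr F}_I$: all $f$ for which there are $x_0<x_1$ in $(0,D)$ such that $f$ is continuous on $[x_0,x_1]$, $v^{p^*-1}f'\in\mathscr C(x_0,x_1)$, $f'<0$ on $(x_0,x_1)$ and $f=f(\cdot\vee x_0)\mathbf 1_{[0,x_1)}$. * $\widetilde{\mathscr F}_I'$: all $f$ for which there is $x_0\in(0,D)$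 such that $f=f\mathbf 1_{[0,x_0)}$ is continuous on $[0,x_0]$, $f'<0$ on $(0,x_0)$ and $v^{p^*-1}f'\in\mathscr C(0,x_0)$. * $\widetilde{\mathscr F}_{I\!I}$: all $f\ge0$, $f\not\equiv0$, for which there is $x_0\in(0,D)$ such that $f=f\mathbf 1_{[0,x_0)}$ is continuous on $[0,x_0]$. * $\widetilde{\mathscr F}_{I\!I}'$: all $f\ge0$, $f\not\equiv0$, continuous on $[0,D]$ with $f\,I\!I(f)\in L^p(\mu)$ (where $f\,I\!I(f)$ is $0$ off $\operatorname{supp}(f)$). Then $$\lambda_p=\sup_{f\in\mathscr F_I}\inf_{x\in(0,D)}I\!I(f)(x)^{-1},$$ $$\lambda_p=\inf_{f\in\widetilde{\mathscr F}_{I\!I}\cup\widetilde{\mathscr F}_{I\!I}'}\ \sup_{x\in\operatorname{supp}(f)}I\!I(f)(x)^{-1}=\inf_{f\in\widetilde{\mathscr F}_I}\ \sup_{x\in\operatorname{supp}(f)}I\!I(f)(x)^{-1}=\inf_{f\in\widetilde{\mathscr F}_I'}\ \sup_{x\in(0,D)}I(f)(x)^{-1}.$$ -/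

import Mathlib

open MeasureTheory Set Filter Topology
open scoped ENNReal

namespace NDCase

noncomputable section

/-- The open interval `(0, D)`, where `0 < D ≤ ∞`. -/
def openI (D : EReal) : Set ℝ := {x | 0 < x ∧ (x : EReal) < D}

/-- The interval `[0, D]`; it is `[0, ∞)` when `D = ∞`. -/
def closedI (D : EReal) : Set ℝ := {x | 0 ≤ x ∧ (x : EReal) ≤ D}

/-- `v̂ = v ^ (1 - p*)`, with `p* = p / (p - 1)` the conjugate exponent of `p`. -/
def vhat (p : ℝ) (v : ℝ → ℝ) (x : ℝ) : ℝ := v x ^ (1 - p.conjExponent)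

open Classical in
/-- The function `v ^ (p* - 1) f'`, evaluated at every point. As `v` is only measurable, it is taken
as the derivative of `f` with respect to the measure `ν̂ = v̂ dx`, `v̂ = 1 / v ^ (p* - 1)`:
the limit of `(f y - f x) / ν̂(x, y)` as `y → x`. It is `0`, like `deriv`, where there is no limit.
For continuous positive `v` and differentiable `f` it is literally `v ^ (p* - 1) f'`. -/
def flux (p : ℝ) (v f : ℝ → ℝ) (x : ℝ) : ℝ :=
  if h : ∃ l, Tendsto (fun y => (f y - f x) / ∫ t in x..y, vhat p v t) (𝓝[≠] x) (𝓝 l)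
  then h.choose else 0

/-- `v ^ (p* - 1) f' ∈ C(S)` for an open interval `S`: `f` is locally absolutely continuous in `S`,
with `f' = v̂ w` almost everywhere for a continuous function `w` (necessarily `w = flux p v f`). -/
def FluxContinuousOn (p : ℝ) (v f : ℝ → ℝ) (S : Set ℝ) : Prop :=
  ContinuousOn (flux p v f) S ∧
    ∀ x ∈ S, ∀ y ∈ S, f y - f x = ∫ t in x..y, vhat p v t * flux p v f t

/-- `μ(|f|^p)`, where `dμ = u dx`. -/
def muPow (p : ℝ) (u : ℝ → ℝ) (D : EReal) (f : ℝ → ℝ) : ℝ≥0∞ :=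
  ∫⁻ x in openI D, ENNReal.ofReal (|f x| ^ p * u x)

/-- `D_p(f) = ∫_0^D |f'|^p dν`, where `dν = v dx`. -/
def energy (p : ℝ) (v : ℝ → ℝ) (D : EReal) (f : ℝ → ℝ) : ℝ≥0∞ :=
  ∫⁻ x in openI D, ENNReal.ofReal (|deriv f x| ^ p * v x)

/-- `C_K[0, D]`: `f` is continuous on `[0, D]` with `v ^ (p* - 1) f' ∈ C(0, D)`, and it has compact
support in `[0, D]` (a restriction only when `D = ∞`). -/
def CK (p : ℝ) (v : ℝ → ℝ) (D : EReal) : Set (ℝ → ℝ) :=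
  {f | ContinuousOn f (closedI D) ∧ FluxContinuousOn p v f (openI D) ∧
    ∃ k, IsCompact k ∧ k ⊆ closedI D ∧ ∀ x ∈ closedI D, x ∉ k → f x = 0}

/-- The principal eigenvalue `λ_p` with boundary conditions ND. -/
def lam (p : ℝ) (u v : ℝ → ℝ) (D : EReal) : ℝ≥0∞ :=
  ⨅ f ∈ {f | f ∈ CK p v D ∧ muPow p u D f = 1 ∧ ∀ d : ℝ, D = (d : EReal) → f d = 0},
    energy p v D f

/-- `∫_0^x f^{p-1} dμ` for non-negative `f`. -/
def massInt (p : ℝ) (u f : ℝ → ℝ) (x : ℝ) : ℝ≥0∞ :=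
  ∫⁻ t in Ioo 0 x, ENNReal.ofReal (f t ^ (p - 1) * u t)

/-- The single integral operator
`I(f)(x) = - (1 / (v f' |f'|^{p-2})(x)) ∫_0^x f^{p-1} dμ`, for `f ≥ 0` and `f' ≤ 0`, with values in
`[0, ∞]` and `1 / 0 = ∞`. If `w = v ^ (p* - 1) f'`, then `v f' |f'|^{p-2} = w |w|^{p-2}`. -/
def opI (p : ℝ) (u v f : ℝ → ℝ) (x : ℝ) : ℝ≥0∞ :=
  massInt p u f x / ENNReal.ofReal (-(flux p v f x * |flux p v f x| ^ (p - 2)))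

/-- The double integral operator, for `f ≥ 0`, with values in `[0, ∞]`:
`II(f)(x) = f(x)^{1-p} [∫_{(x, D) ∩ supp f} v̂(s) (∫_0^s f^{p-1} dμ)^{p*-1} ds]^{p-1}`. -/
def opII (p : ℝ) (u v : ℝ → ℝ) (D : EReal) (f : ℝ → ℝ) (x : ℝ) : ℝ≥0∞ :=
  (∫⁻ s in {s : ℝ | x < s ∧ (s : EReal) < D ∧ f s ≠ 0},
      ENNReal.ofReal (vhat p v s) * massInt p u f s ^ (p.conjExponent - 1)) ^ (p - 1)
    / ENNReal.ofReal (f x ^ (p - 1))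

/-- `supp f`, the set of points of `[0, D]` where `f` does not vanish. -/
def suppI (D : EReal) (f : ℝ → ℝ) : Set ℝ := {x | x ∈ closedI D ∧ f x ≠ 0}

/-- The set `F_I`. -/
def FI (p : ℝ) (v : ℝ → ℝ) (D : EReal) : Set (ℝ → ℝ) :=
  {f | ContinuousOn f (closedI D) ∧ FluxContinuousOn p v f (openI D) ∧
    (∀ x ∈ openI D, 0 < f x) ∧ ∀ x ∈ openI D, flux p v f x < 0}

/-- The set `F̃_I`: for some `x₀ < x₁` in `(0, D)`, `f` is continuous on `[x₀, x₁]` with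
`v ^ (p* - 1) f'` continuous and negative on `(x₀, x₁)`, and `f = f(· ∨ x₀) 1_{[0, x₁)}`. -/
def FItilde (p : ℝ) (v : ℝ → ℝ) (D : EReal) : Set (ℝ → ℝ) :=
  {f | ∃ x₀ ∈ openI D, ∃ x₁ ∈ openI D, x₀ < x₁ ∧
    ContinuousOn f (Icc x₀ x₁) ∧ FluxContinuousOn p v f (Ioo x₀ x₁) ∧
    (∀ x ∈ Ioo x₀ x₁, flux p v f x < 0) ∧
    (∀ x ∈ closedI D, x < x₁ → f x = f (max x x₀)) ∧ ∀ x ∈ closedI D, x₁ ≤ x → f x = 0}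

/-- The set `F̃_I'`: for some `x₀` in `(0, D)`, `f = f 1_{[0, x₀)}` is continuous on `[0, x₀]`,
with `v ^ (p* - 1) f'` continuous and negative on `(0, x₀)`. -/
def FItilde' (p : ℝ) (v : ℝ → ℝ) (D : EReal) : Set (ℝ → ℝ) :=
  {f | ∃ x₀ ∈ openI D, (∀ x ∈ closedI D, x₀ ≤ x → f x = 0) ∧ ContinuousOn f (Icc 0 x₀) ∧
    (∀ x ∈ Ioo 0 x₀, flux p v f x < 0) ∧ FluxContinuousOn p v f (Ioo 0 x₀)}

/-- `f ≥ 0` on `[0, D]` and `f` is not identically zero there. -/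
def NonnegNonzero (D : EReal) (f : ℝ → ℝ) : Prop :=
  (∀ x ∈ closedI D, 0 ≤ f x) ∧ ∃ x ∈ closedI D, f x ≠ 0

/-- The set `F̃_II`: for some `x₀` in `(0, D)`, `f = f 1_{[0, x₀)}` is continuous on `[0, x₀]`. -/
def FIItilde (D : EReal) : Set (ℝ → ℝ) :=
  {f | NonnegNonzero D f ∧ ∃ x₀ ∈ openI D,
    (∀ x ∈ closedI D, x₀ ≤ x → f x = 0) ∧ ContinuousOn f (Icc 0 x₀)}

/-- The set `F̃_II'`: `f` is continuous on `[0, D]` and `f II(f) ∈ L^p(μ)`. -/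
def FIItilde' (p : ℝ) (u v : ℝ → ℝ) (D : EReal) : Set (ℝ → ℝ) :=
  {f | NonnegNonzero D f ∧ ContinuousOn f (closedI D) ∧
    ∫⁻ x in openI D,
      (ENNReal.ofReal (f x) * opII p u v D f x) ^ p * ENNReal.ofReal (u x) < ∞}

end

end NDCase

/-! Write `r = p - 1`, let `ν` be the measure `v̂ dx` on `(0, D)`, and let `T f` be the tail
integral against `ν` of `(∫_0^s f ^ r dμ) ^ (1/r)`. Where `f > 0`, `II(f) = (T f / f) ^ r`. The
energy of `f` is the integral of `|w| ^ p` against `ν`, with `w` the flux. A function vanishing at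
the right end is bounded by the tail of `|w|`, so `λ_p` is the best constant in the Hardy inequality
`λ ∫ (tail w) ^ p dμ ≤ ∫ w ^ p dν` over `w ≥ 0`. By Tonelli, `mass` and `tail` are adjoint
(`lintegral_mul_tail`). No eigenfunction is constructed: each variational formula is obtained from
two inequalities.

Supremum formula. If `c (T f) ^ r ≤ f ^ r`, Hölder with weight `mass f` and Tonelli give the Hardy
inequality with constant `c` (`hardy_of_supersolution`), so `c ≤ λ_p`. Conversely, testing the
inequality with truncations of `(mass f) ^ (1/r)` gives `λ_p ‖T f‖ ^ r ≤ ‖f‖ ^ r` in `L^p(μ)`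
(`norm_tail_mass_le`). For `c < λ_p` the map `f ↦ T ψ + c ^ (1/r) T f` therefore has a fixed point
in `L^p(μ)` (`exists_supersolution`), and it lies in `F_I`.

Infimum formulas, lower bounds. If `f ≤ C ^ (1/r) T f` on the support, the same norm bound gives
`λ_p ‖T f‖ ^ r ≤ C ‖T f‖ ^ r`, with `T` taken over the support; cancelling needs a finite nonzero
norm (`lam_le_of_tail_bound`). For the single integral operator the Hardy inequality is tested with
the flux of `f` itself.

Infimum formulas, sharpness. If `c > λ_p`, the Hardy inequality with constant `c` fails on some
compact subinterval. There the iteration `φ ↦ c ^ (1/r) T (1 + φ)` must blow up, since a limit of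
finite mass would be a supersolution. Once the iterates are large the added `1` is negligible, and a
late iterate is a subsolution for any `C > c` (`exists_subsolution`). It is a test function for both
operators. -/

namespace NDCase

/-- `∫_{(-∞, s)} f ^ r dμ`. -/
noncomputable def mass (μ : Measure ℝ) (r : ℝ) (f : ℝ → ℝ≥0∞) (s : ℝ) : ℝ≥0∞ :=
  ∫⁻ t in Iio s, f t ^ r ∂μ

/-- `∫_{(x, ∞)} w dν`. -/
noncomputable def tail (ν : Measure ℝ) (w : ℝ → ℝ≥0∞) (x : ℝ) : ℝ≥0∞ :=
  ∫⁻ s in Ioi x, w s ∂ν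

/-! ### Hardy inequality and norm bound for abstract measures -/

section Core

variable {μ ν : Measure ℝ} {r : ℝ} {f g w : ℝ → ℝ≥0∞}

lemma mass_monotone : Monotone (mass μ r f) := fun _ _ h =>
  lintegral_mono_set (Iio_subset_Iio h)

lemma tail_antitone : Antitone (tail ν w) := fun _ _ h =>
  lintegral_mono_set (Ioi_subset_Ioi h)

lemma measurable_mass : Measurable (mass μ r f) := mass_monotone.measurable

lemma measurable_tail : Measurable (tail ν w) := tail_antitone.measurable

lemma mass_mono (hr : 0 ≤ r) (h : f ≤ g) : mass μ r f ≤ mass μ r g := fun _ =>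
  lintegral_mono fun t => ENNReal.rpow_le_rpow (h t) hr

lemma tail_mono (h : f ≤ g) : tail ν f ≤ tail ν g := fun _ => lintegral_mono h

lemma tail_const_mul (c : ℝ≥0∞) (hw : Measurable w) (x : ℝ) :
    tail ν (fun s => c * w s) x = c * tail ν w x := lintegral_const_mul c hw

lemma tail_iSup {W : ℕ → ℝ → ℝ≥0∞} (hW : ∀ n, Measurable (W n)) (hm : Monotone W) (x : ℝ) :
    tail ν (fun s => ⨆ n, W n s) x = ⨆ n, tail ν (W n) x := lintegral_iSup hW hm

lemma iSup_rpow (hr : 0 < r) (a : ℕ → ℝ≥0∞) : (⨆ n, a n) ^ r = ⨆ n, a n ^ r :=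
  (ENNReal.orderIsoRpow r hr).map_iSup a

lemma mass_iSup (hr : 0 < r) {F : ℕ → ℝ → ℝ≥0∞} (hF : ∀ n, Measurable (F n)) (hm : Monotone F)
    (x : ℝ) : mass μ r (fun s => ⨆ n, F n s) x = ⨆ n, mass μ r (F n) x := by
  simp only [mass, iSup_rpow hr]
  exact lintegral_iSup (fun n => (hF n).pow_const r)
    fun m n h t => ENNReal.rpow_le_rpow (hm h t) hr.le

/-- Tonelli on the half-plane `t < s`. This adjointness of `mass` and `tail` plays the role of
integration by parts throughout. -/
lemma lintegral_mul_tail [SFinite μ] [SFinite ν] (hg : Measurable g) (hw : Measurable w) :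
    ∫⁻ t, g t * tail ν w t ∂μ = ∫⁻ s, (∫⁻ t in Iio s, g t ∂μ) * w s ∂ν := by
  have hA : MeasurableSet {z : ℝ × ℝ | z.1 < z.2} := measurableSet_lt measurable_fst measurable_snd
  have hk : Measurable (fun z : ℝ × ℝ => {z : ℝ × ℝ | z.1 < z.2}.indicator
      (fun z => g z.1 * w z.2) z) :=
    ((hg.comp measurable_fst).mul (hw.comp measurable_snd)).indicator hA
  calc ∫⁻ t, g t * tail ν w t ∂μ
      = ∫⁻ t, ∫⁻ s, {z : ℝ × ℝ | z.1 < z.2}.indicator (fun z => g z.1 * w z.2) (t, s) ∂ν ∂μ := by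
        refine lintegral_congr fun t => ?_
        rw [tail, ← lintegral_const_mul _ hw, ← lintegral_indicator measurableSet_Ioi]
        rfl
    _ = ∫⁻ s, ∫⁻ t, {z : ℝ × ℝ | z.1 < z.2}.indicator (fun z => g z.1 * w z.2) (t, s) ∂μ ∂ν :=
        lintegral_lintegral_swap hk.aemeasurable
    _ = _ := by
        refine lintegral_congr fun s => ?_
        rw [← lintegral_mul_const _ hg, ← lintegral_indicator measurableSet_Iio]
        rfl

/-- Hölder with exponents `r + 1` and `(r + 1) / r` after splitting `w = (w m ^ (-1/(r+1))) · m ^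
(1/(r+1))`. With `m = mass μ r f` the second factor becomes `(T f) ^ r`, the quantity a
supersolution controls. -/
lemma tail_rpow_le (hr : 0 < r) (hw : Measurable w) {m : ℝ → ℝ≥0∞} (hm : Measurable m)
    (h0 : ∀ᵐ s ∂ν, m s ≠ 0) (ht : ∀ᵐ s ∂ν, m s ≠ ∞) (x : ℝ) :
    tail ν w x ^ (r + 1) ≤
      tail ν (fun s => w s ^ (r + 1) * (m s)⁻¹) x * tail ν (fun s => m s ^ r⁻¹) x ^ r := by
  have hp : (0:ℝ) < r + 1 := by linarith
  have hpq : (r + 1).HolderConjugate ((r + 1) / r) := by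
    rw [Real.holderConjugate_iff]
    refine ⟨by linarith, ?_⟩
    field_simp
    ring
  have key := ENNReal.lintegral_mul_le_Lp_mul_Lq (ν.restrict (Ioi x)) hpq
    (f := fun s => w s * (m s ^ (r + 1)⁻¹)⁻¹) (g := fun s => m s ^ (r + 1)⁻¹)
    (hw.mul (hm.pow_const _).inv).aemeasurable (hm.pow_const _).aemeasurable
  have e1 : tail ν w x = ∫⁻ s in Ioi x, ((fun s => w s * (m s ^ (r + 1)⁻¹)⁻¹) *
      fun s => m s ^ (r + 1)⁻¹) s ∂ν := by
    refine lintegral_congr_ae ?_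
    filter_upwards [ae_restrict_of_ae h0, ae_restrict_of_ae ht] with s hs0 hst
    simp only [Pi.mul_apply, mul_assoc]
    rw [ENNReal.inv_mul_cancel, mul_one]
    · exact (ENNReal.rpow_pos (pos_iff_ne_zero.2 hs0) hst).ne'
    · exact ENNReal.rpow_ne_top_of_nonneg (by positivity) hst
  rw [← e1] at key
  calc tail ν w x ^ (r + 1) ≤ _ := ENNReal.rpow_le_rpow key hp.le
    _ = _ := by
      rw [ENNReal.mul_rpow_of_nonneg _ _ hp.le, ← ENNReal.rpow_mul, ← ENNReal.rpow_mul]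
      have h1 : 1 / (r + 1) * (r + 1) = 1 := by field_simp
      have h2 : 1 / ((r + 1) / r) * (r + 1) = r := by field_simp
      rw [h1, h2, ENNReal.rpow_one]
      simp only [tail]
      congr 2
      · funext s
        rw [ENNReal.mul_rpow_of_nonneg _ _ hp.le, ENNReal.inv_rpow, ← ENNReal.rpow_mul,
          inv_mul_cancel₀ hp.ne', ENNReal.rpow_one]
      · refine lintegral_congr fun s => ?_
        rw [← ENNReal.rpow_mul]
        congr 1
        field_simp

/-- A weighted Hardy inequality whose constant is read off a supersolution `f`. -/
lemma hardy_of_supersolution [SFinite μ] [SFinite ν] (hr : 0 < r) (hf : Measurable f)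
    (hw : Measurable w) (h0 : ∀ᵐ s ∂ν, mass μ r f s ≠ 0) (ht : ∀ᵐ s ∂ν, mass μ r f s ≠ ∞)
    {c : ℝ≥0∞} (hc : ∀ᵐ x ∂μ, c * tail ν (fun s => mass μ r f s ^ r⁻¹) x ^ r ≤ f x ^ r) :
    c * ∫⁻ x, tail ν w x ^ (r + 1) ∂μ ≤ ∫⁻ s, w s ^ (r + 1) ∂ν := by
  have hm : Measurable (mass μ r f) := measurable_mass
  have hk : Measurable fun s => w s ^ (r + 1) * (mass μ r f s)⁻¹ := (hw.pow_const _).mul hm.inv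
  calc c * ∫⁻ x, tail ν w x ^ (r + 1) ∂μ
      = ∫⁻ x, c * tail ν w x ^ (r + 1) ∂μ :=
        (lintegral_const_mul _ (measurable_tail.pow_const _)).symm
    _ ≤ ∫⁻ x, f x ^ r * tail ν (fun s => w s ^ (r + 1) * (mass μ r f s)⁻¹) x ∂μ := by
        refine lintegral_mono_ae ?_
        filter_upwards [hc] with x hx
        -- After Hölder, `c (T f) ^ r` is replaced by `f ^ r`; Tonelli then turns `f ^ r` into `mass
        -- f`, which cancels the weight.
        refine (mul_le_mul_right (tail_rpow_le hr hw hm h0 ht x) c).trans ?_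
        rw [mul_left_comm, mul_comm]
        exact mul_le_mul_left hx _
    _ = ∫⁻ s, mass μ r f s * (w s ^ (r + 1) * (mass μ r f s)⁻¹) ∂ν :=
        lintegral_mul_tail (hf.pow_const r) hk
    _ = ∫⁻ s, w s ^ (r + 1) ∂ν := by
        refine lintegral_congr_ae ?_
        filter_upwards [h0, ht] with s hs0 hst
        rw [mul_comm, mul_assoc, ENNReal.inv_mul_cancel hs0 hst, mul_one]

/-- Hölder's inequality in the form `∫ f ^ r h ≤ ‖f‖ ^ r ‖h‖` for norms in `L ^ (r + 1)`. -/
lemma lintegral_rpow_mul_le (hr : 0 < r) (hf : Measurable f) (hg : Measurable g) :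
    ∫⁻ x, f x ^ r * g x ∂μ ≤
      (∫⁻ x, f x ^ (r + 1) ∂μ) ^ (r / (r + 1)) * (∫⁻ x, g x ^ (r + 1) ∂μ) ^ (1 / (r + 1)) := by
  have hpq : ((r + 1) / r).HolderConjugate (r + 1) := by
    rw [Real.holderConjugate_iff]
    refine ⟨by rw [lt_div_iff₀ hr]; linarith, ?_⟩
    field_simp
  have key := ENNReal.lintegral_mul_le_Lp_mul_Lq μ hpq (f := fun s => f s ^ r) (g := g)
    (hf.pow_const _).aemeasurable hg.aemeasurable
  have e : ∀ x, (f x ^ r) ^ ((r + 1) / r) = f x ^ (r + 1) := fun x => by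
    rw [← ENNReal.rpow_mul]; congr 1; field_simp
  simp only [e, one_div_div] at key
  exact key

/-- If a Poincaré inequality with constant `l` holds for truncations `w n` increasing to
`M = (mass f) ^ r⁻¹`, then `l ‖tail M‖ ^ r ≤ ‖f‖ ^ r` in `L ^ (r + 1)`. -/
lemma norm_tail_mass_le [SFinite μ] [SFinite ν] (hr : 0 < r) (hf : Measurable f)
    {W : ℕ → ℝ → ℝ≥0∞} (hW : ∀ n, Measurable (W n)) (hmono : Monotone W) {l : ℝ≥0∞}
    (hle : ∀ n, ∀ᵐ s ∂ν, W n s ≤ mass μ r f s ^ r⁻¹)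
    (hP : ∀ n, l * ∫⁻ x, tail ν (W n) x ^ (r + 1) ∂μ ≤ ∫⁻ s, W n s ^ (r + 1) ∂ν)
    (hfin : ∀ n, ∫⁻ x, tail ν (W n) x ^ (r + 1) ∂μ ≠ ∞) :
    l * (∫⁻ x, tail ν (fun s => ⨆ n, W n s) x ^ (r + 1) ∂μ) ^ (r / (r + 1)) ≤
      (∫⁻ x, f x ^ (r + 1) ∂μ) ^ (r / (r + 1)) := by
  have hp : (0:ℝ) < r + 1 := by linarith
  have hrp : 0 < r / (r + 1) := by positivity
  have e : ∫⁻ x, tail ν (fun s => ⨆ n, W n s) x ^ (r + 1) ∂μ =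
      ⨆ n, ∫⁻ x, tail ν (W n) x ^ (r + 1) ∂μ := by
    simp only [tail_iSup hW hmono, iSup_rpow hp]
    exact lintegral_iSup (fun n => measurable_tail.pow_const _)
      fun m n h x => ENNReal.rpow_le_rpow (tail_mono (hmono h) x) hp.le
  rw [e, iSup_rpow hrp, ENNReal.mul_iSup]
  refine iSup_le fun n => ?_
  set a := ∫⁻ x, tail ν (W n) x ^ (r + 1) ∂μ with ha
  have h1 : l * a ≤ (∫⁻ x, f x ^ (r + 1) ∂μ) ^ (r / (r + 1)) * a ^ (1 / (r + 1)) := by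
    -- Since `W ^ r ≤ mass f`, one has `∫ W ^ (r+1) dν ≤ ∫ mass f · W dν = ∫ f ^ r · tail W dμ`, and
    -- Hölder applies.
    refine (hP n).trans (le_trans ?_ (lintegral_rpow_mul_le hr hf measurable_tail))
    rw [lintegral_mul_tail (hf.pow_const r) (hW n)]
    refine lintegral_mono_ae ?_
    filter_upwards [hle n] with s hs
    rw [ENNReal.rpow_add_of_nonneg _ _ hr.le zero_le_one, ENNReal.rpow_one]
    gcongr
    calc W n s ^ r ≤ (mass μ r f s ^ r⁻¹) ^ r := ENNReal.rpow_le_rpow hs hr.le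
      _ = mass μ r f s := by rw [← ENNReal.rpow_mul, inv_mul_cancel₀ hr.ne', ENNReal.rpow_one]
  rcases eq_or_ne a 0 with h | h
  · rw [h, ENNReal.zero_rpow_of_pos hrp, mul_zero]; exact zero_le
  -- One factor `a ^ (1/(r+1))` is to be cancelled, which requires `a` finite; this is the reason
  -- for working with truncations.
  have e2 : a = a ^ (r / (r + 1)) * a ^ (1 / (r + 1)) := by
    rw [← ENNReal.rpow_add _ _ h (hfin n)]
    conv_lhs => rw [← ENNReal.rpow_one a]
    congr 1; field_simp
  rw [e2, ← mul_assoc, ← e2] at h1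
  refine (ENNReal.mul_le_mul_iff_left (ENNReal.rpow_pos (pos_iff_ne_zero.2 h) (hfin n)).ne'
    (ENNReal.rpow_ne_top_of_nonneg (by positivity) (hfin n))).1 h1

end Core
-- Monotone iteration: supersolutions and subsolutions
section Iteration

variable {μ ν : Measure ℝ} {r : ℝ}

/-- The operator is monotone and, by monotone convergence, commutes with increasing suprema, so
iterating from `0` gives a fixed point with values in `[0, ∞]`. Finiteness is a separate matter. -/
lemma exists_monotone_fixedPoint (hr : 0 < r) (c : ℝ≥0∞) {b : ℝ → ℝ≥0∞} (hb : Measurable b) :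
    ∃ F : ℕ → ℝ → ℝ≥0∞, F 0 = 0 ∧
      (∀ n, F (n + 1) = tail ν fun s => b s + c * mass μ r (F n) s ^ r⁻¹) ∧
      (∀ n, Measurable (F n)) ∧ Monotone F ∧
      ∀ x, ⨆ n, F n x = tail ν (fun s => b s + c * mass μ r (fun t => ⨆ n, F n t) s ^ r⁻¹) x := by
  have hri : 0 < r⁻¹ := inv_pos.2 hr
  let F : ℕ → ℝ → ℝ≥0∞ := fun n =>
    n.rec 0 fun _ f => tail ν fun s => b s + c * mass μ r f s ^ r⁻¹
  have hs : ∀ n, F (n + 1) = tail ν fun s => b s + c * mass μ r (F n) s ^ r⁻¹ := fun n => rfl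
  have hm : ∀ n, Measurable (F n) := by
    rintro (_ | n)
    · exact measurable_const
    · exact measurable_tail
  have hmono : Monotone F := by
    refine monotone_nat_of_le_succ fun n => ?_
    induction n with
    | zero => exact fun x => bot_le
    | succ n ih =>
      rw [hs n, hs (n + 1)]
      refine tail_mono fun s => ?_
      have := mass_mono (μ := μ) hr.le ih s
      dsimp only
      gcongr
  have hW : ∀ n, Measurable fun s => b s + c * mass μ r (F n) s ^ r⁻¹ := fun n =>
    hb.add ((measurable_mass.pow_const _).const_mul _)
  have hWm : Monotone fun n s => b s + c * mass μ r (F n) s ^ r⁻¹ := fun m n h s => by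
    have := mass_mono (μ := μ) hr.le (hmono h) s
    dsimp only
    gcongr
  refine ⟨F, rfl, hs, hm, hmono, fun x => ?_⟩
  have e : ∀ s, b s + c * mass μ r (fun t => ⨆ n, F n t) s ^ r⁻¹ =
      ⨆ n, (b s + c * mass μ r (F n) s ^ r⁻¹) := fun s => by
    rw [mass_iSup hr hm hmono, iSup_rpow hri, ENNReal.mul_iSup, ENNReal.add_iSup]
  simp only [e]
  rw [tail_iSup hW hWm, ← Monotone.iSup_nat_add (fun m n h => hmono h x) 1]

/-- If `T f = tail (mass f ^ r⁻¹)` satisfies `l ‖T f‖ ^ r ≤ ‖f‖ ^ r` and `c < l`, the equation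
`f = T ψ + c ^ r⁻¹ T f` has a solution in `L ^ (r + 1)`. -/
lemma exists_supersolution (hr : 0 < r) {l c : ℝ≥0∞} (hcl : c < l)
    (hB : ∀ f : ℝ → ℝ≥0∞, Measurable f → ∫⁻ x, f x ^ (r + 1) ∂μ ≠ ∞ →
      l * (∫⁻ x, tail ν (fun s => mass μ r f s ^ r⁻¹) x ^ (r + 1) ∂μ) ^ (r / (r + 1)) ≤
        (∫⁻ x, f x ^ (r + 1) ∂μ) ^ (r / (r + 1)))
    {ψ : ℝ → ℝ≥0∞} (hψ : Measurable ψ) (hψp : ∫⁻ x, ψ x ^ (r + 1) ∂μ ≠ ∞) :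
    ∃ f : ℝ → ℝ≥0∞, Measurable f ∧ ∫⁻ x, f x ^ (r + 1) ∂μ ≠ ∞ ∧
      ∀ x, f x = tail ν (fun s => mass μ r ψ s ^ r⁻¹ + c ^ r⁻¹ * mass μ r f s ^ r⁻¹) x := by
  have hri : 0 < r⁻¹ := inv_pos.2 hr
  have hp : 0 < r + 1 := by linarith
  have hpi : 0 < 1 / (r + 1) := by positivity
  -- `l` may be `∞`; the intermediate `l'` is finite and nonzero, so it can be divided by.
  obtain ⟨l', hcl', hl'⟩ := exists_between hcl
  have hl0 : l' ≠ 0 := (bot_le.trans_lt hcl').ne'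
  have hlt : l' ≠ ∞ := (hl'.trans_le le_top).ne
  set N : (ℝ → ℝ≥0∞) → ℝ≥0∞ := fun f => (∫⁻ x, f x ^ (r + 1) ∂μ) ^ (1 / (r + 1)) with hN
  have hNr : ∀ f, N f ^ r = (∫⁻ x, f x ^ (r + 1) ∂μ) ^ (r / (r + 1)) := fun f => by
    rw [hN, ← ENNReal.rpow_mul]; congr 1; field_simp
  have hNp : ∀ f, N f ^ (r + 1) = ∫⁻ x, f x ^ (r + 1) ∂μ := fun f => by
    rw [hN, ← ENNReal.rpow_mul, one_div_mul_cancel hp.ne', ENNReal.rpow_one]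
  have hNt : ∀ f, N f ≠ ∞ ↔ ∫⁻ x, f x ^ (r + 1) ∂μ ≠ ∞ := fun f => by
    rw [hN, ne_eq, ne_eq, ENNReal.rpow_eq_top_iff_of_pos hpi]
  set T : (ℝ → ℝ≥0∞) → ℝ → ℝ≥0∞ := fun f => tail ν fun s => mass μ r f s ^ r⁻¹ with hT
  have hB' : ∀ f, Measurable f → N f ≠ ∞ → l' * N (T f) ^ r ≤ N f ^ r := fun f hf hfN => by
    rw [hNr, hNr]
    exact (mul_le_mul_left hl'.le _).trans (hB f hf ((hNt f).1 hfN))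
  -- The contraction factor of `c ^ r⁻¹ T` in the norm `N`.
  set t := (c / l') ^ r⁻¹ with ht
  have ht1 : t < 1 := ENNReal.rpow_lt_one (by
    rw [ENNReal.div_lt_iff (Or.inl hl0) (Or.inl hlt), one_mul]; exact hcl') hri
  have hTt : ∀ f, Measurable f → N f ≠ ∞ → c ^ r⁻¹ * N (T f) ≤ t * N f := fun f hf hfN => by
    have h1 : c * N (T f) ^ r ≤ (c / l') * N f ^ r := by
      calc c * N (T f) ^ r = (c / l') * (l' * N (T f) ^ r) := by
            rw [← mul_assoc, ENNReal.div_mul_cancel hl0 hlt]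
        _ ≤ _ := by gcongr; exact hB' f hf hfN
    have h2 := ENNReal.rpow_le_rpow h1 hri.le
    rwa [ENNReal.mul_rpow_of_nonneg _ _ hri.le, ENNReal.mul_rpow_of_nonneg _ _ hri.le,
      ← ENNReal.rpow_mul (N (T f)), ← ENNReal.rpow_mul (N f), mul_inv_cancel₀ hr.ne',
      ENNReal.rpow_one, ENNReal.rpow_one] at h2
  have hA : N (T ψ) ≠ ∞ := fun h => by
    have := hB' ψ hψ ((hNt ψ).2 hψp)
    rw [h, ENNReal.top_rpow_of_pos hr, ENNReal.mul_top hl0, top_le_iff, hNr] at this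
    exact ENNReal.rpow_ne_top_of_nonneg (by positivity) hψp this
  set A := N (T ψ)
  -- The sum of the geometric series, that is the solution of `A + t K = K`; by Minkowski the bound
  -- `N ≤ K` passes from one iterate to the next.
  set K := A * (1 - t)⁻¹ with hK
  have h1t : 1 - t ≠ 0 := (tsub_pos_of_lt ht1).ne'
  have h1t' : 1 - t ≠ ∞ := ENNReal.sub_ne_top ENNReal.one_ne_top
  have hKt : K ≠ ∞ := ENNReal.mul_ne_top hA (ENNReal.inv_ne_top.2 h1t)
  have hKeq : A + t * K = K := by
    have h1 : (1 - t) * K = A := by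
      rw [hK, mul_left_comm, ENNReal.mul_inv_cancel h1t h1t', mul_one]
    calc A + t * K = (1 - t) * K + t * K := by rw [h1]
      _ = K := by rw [← add_mul, tsub_add_cancel_of_le ht1.le, one_mul]
  obtain ⟨F, h0, hs, hm, hmono, hfix⟩ := exists_monotone_fixedPoint (μ := μ) (ν := ν) hr (c ^ r⁻¹)
    (b := fun s => mass μ r ψ s ^ r⁻¹) (measurable_mass.pow_const _)
  have hbound : ∀ n, N (F n) ≤ K := by
    intro n
    induction n with
    | zero =>
      rw [h0, hN]
      simp [ENNReal.zero_rpow_of_pos hp, hp]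
    | succ n ih =>
      have e : F (n + 1) = T ψ + fun x => c ^ r⁻¹ * T (F n) x := by
        rw [hs]
        funext x
        rw [Pi.add_apply, hT]
        dsimp only
        rw [← tail_const_mul _ (measurable_mass.pow_const _)]
        exact lintegral_add_left (measurable_mass.pow_const _) _
      have e2 : N (fun x => c ^ r⁻¹ * T (F n) x) = c ^ r⁻¹ * N (T (F n)) := by
        simp only [hN, ENNReal.mul_rpow_of_nonneg _ _ hp.le]
        rw [lintegral_const_mul _ (measurable_tail.pow_const _),
          ENNReal.mul_rpow_of_nonneg _ _ hpi.le, ← ENNReal.rpow_mul _ (r + 1),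
          mul_one_div_cancel hp.ne', ENNReal.rpow_one]
      rw [e]
      calc N (T ψ + fun x => c ^ r⁻¹ * T (F n) x)
          ≤ N (T ψ) + N (fun x => c ^ r⁻¹ * T (F n) x) :=
            ENNReal.lintegral_Lp_add_le measurable_tail.aemeasurable
              (measurable_tail.const_mul _).aemeasurable (by linarith)
        _ ≤ A + t * K := by
            rw [e2]
            exact add_le_add_right
              ((hTt _ (hm n) (ne_top_of_le_ne_top hKt ih)).trans (mul_le_mul_right ih t)) A
        _ = K := hKeq
  refine ⟨fun x => ⨆ n, F n x, .iSup hm, ?_, hfix⟩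
  have e : ∫⁻ x, (⨆ n, F n x) ^ (r + 1) ∂μ = ⨆ n, ∫⁻ x, F n x ^ (r + 1) ∂μ := by
    simp only [iSup_rpow hp]
    exact lintegral_iSup (fun n => (hm n).pow_const _)
      fun m n h x => ENNReal.rpow_le_rpow (hmono h x) hp.le
  rw [e]
  refine ne_top_of_le_ne_top (ENNReal.rpow_ne_top_of_nonneg hp.le hKt) (iSup_le fun n => ?_)
  rw [← hNp]
  exact ENNReal.rpow_le_rpow (hbound n) hp.le

/-- Where `y ≥ K`, the summand `1` is at most `K⁻¹ y`, so adding it costs only a factor close to `1`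
for large `K`. -/
lemma one_add_rpow_le (hr : 0 < r) {K y : ℝ≥0∞} (hK0 : K ≠ 0) (hKt : K ≠ ∞) (h : K ≤ y) :
    (1 + y) ^ r ≤ (1 + K⁻¹) ^ r * y ^ r := by
  rw [← ENNReal.mul_rpow_of_nonneg _ _ hr.le]
  refine ENNReal.rpow_le_rpow ?_ hr.le
  rw [add_mul, one_mul, add_comm]
  gcongr
  rw [← ENNReal.inv_mul_cancel hK0 hKt]
  gcongr

/-- If the constant `c` is too large for the Poincaré inequality, the iteration
`φ ↦ c ^ r⁻¹ T (1 + φ)` blows up and yields, for every `C > c`, a subsolution. -/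
lemma exists_subsolution [SFinite μ] [SFinite ν] (hr : 0 < r) {a x₁ : ℝ} (hax : a < x₁)
    (hν : ∀ᵐ s ∂ν, s < x₁) (hνf : ν univ ≠ ∞) (hμf : μ (Iio x₁) ≠ ∞)
    (hμ0 : ∀ᵐ s ∂ν, μ (Iio s) ≠ 0) (hνx : ∀ x < x₁, ν (Ioi x) ≠ 0) (hμa : μ (Iio a) ≠ 0)
    {c C : ℝ≥0∞} (hcC : c < C) {w : ℝ → ℝ≥0∞} (hw : Measurable w)
    (hwc : ∫⁻ s, w s ^ (r + 1) ∂ν < c * ∫⁻ x, tail ν w x ^ (r + 1) ∂μ) :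
    ∃ g : ℝ → ℝ≥0∞, Measurable g ∧ (∃ B ≠ ∞, ∀ x, g x ≤ B) ∧ (∀ x, 1 ≤ g x) ∧
      ∀ s ≤ x₁, c * mass μ r g s ≤
        C * mass μ r (fun x => c ^ r⁻¹ * tail ν (fun s => mass μ r g s ^ r⁻¹) x) s := by
  have hri : 0 < r⁻¹ := inv_pos.2 hr
  have hp : 0 < r + 1 := by linarith
  have hc0 : c ≠ 0 := by rintro rfl; simp at hwc
  have hct : c ≠ ∞ := (hcC.trans_le le_top).ne
  have hcr0 : c ^ r⁻¹ ≠ 0 := (ENNReal.rpow_pos (pos_iff_ne_zero.2 hc0) hct).ne'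
  have hcrt : c ^ r⁻¹ ≠ ∞ := ENNReal.rpow_ne_top_of_nonneg hri.le hct
  let T : (ℝ → ℝ≥0∞) → ℝ → ℝ≥0∞ := fun g x => c ^ r⁻¹ * tail ν (fun s => mass μ r g s ^ r⁻¹) x
  have hTm : ∀ g, Measurable (T g) := fun g => measurable_tail.const_mul _
  have hTmono : ∀ f g, f ≤ g → T f ≤ T g := fun f g h x => by
    refine mul_le_mul_right (tail_mono (fun s => ?_) x) _
    exact ENNReal.rpow_le_rpow (mass_mono hr.le h s) hri.le
  let φ : ℕ → ℝ → ℝ≥0∞ := fun n => n.rec 0 fun _ f => T (1 + f)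
  have hs : ∀ n, φ (n + 1) = T (1 + φ n) := fun n => rfl
  have hm : ∀ n, Measurable (φ n) := by
    rintro (_ | n)
    · exact measurable_const
    · exact hTm _
  have hmono : Monotone φ := by
    refine monotone_nat_of_le_succ fun n => ?_
    induction n with
    | zero => exact fun x => bot_le
    | succ n ih =>
      rw [hs n, hs (n + 1)]
      exact hTmono _ _ (add_le_add_right ih 1)
  have hanti : ∀ n, Antitone (φ n) := by
    rintro (_ | n)
    · exact antitone_const
    · exact fun x y h => mul_le_mul_right (tail_antitone h) _
  -- Each single iterate is bounded, although the supremum will be infinite; the subsolution is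
  -- taken from a finite stage.
  have hbd : ∀ n, ∃ B ≠ ∞, ∀ x, φ n x ≤ B := by
    intro n
    induction n with
    | zero => exact ⟨0, ENNReal.zero_ne_top, fun x => le_rfl⟩
    | succ n ih =>
      obtain ⟨B, hB, hle⟩ := ih
      have h1B : (1 + B) ^ r ≠ ∞ :=
        ENNReal.rpow_ne_top_of_nonneg hr.le (ENNReal.add_ne_top.2 ⟨ENNReal.one_ne_top, hB⟩)
      refine ⟨c ^ r⁻¹ * (((1 + B) ^ r * μ (Iio x₁)) ^ r⁻¹ * ν univ), ?_, fun x => ?_⟩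
      · exact ENNReal.mul_ne_top hcrt (ENNReal.mul_ne_top
          (ENNReal.rpow_ne_top_of_nonneg hri.le (ENNReal.mul_ne_top h1B hμf)) hνf)
      · rw [hs]
        refine mul_le_mul_right ?_ _
        calc tail ν (fun s => mass μ r (1 + φ n) s ^ r⁻¹) x
            ≤ ∫⁻ s, mass μ r (1 + φ n) s ^ r⁻¹ ∂ν := setLIntegral_le_lintegral _ _
          _ ≤ ∫⁻ s, ((1 + B) ^ r * μ (Iio x₁)) ^ r⁻¹ ∂ν := by
              refine lintegral_mono_ae ?_
              filter_upwards [hν] with s hsx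
              refine ENNReal.rpow_le_rpow ?_ hri.le
              calc mass μ r (1 + φ n) s ≤ mass μ r (1 + φ n) x₁ := mass_monotone hsx.le
                _ ≤ ∫⁻ t in Iio x₁, (1 + B) ^ r ∂μ :=
                  lintegral_mono fun t => ENNReal.rpow_le_rpow (add_le_add_right (hle t) 1) hr.le
                _ = _ := by simp
          _ = _ := by simp
  set Φ : ℝ → ℝ≥0∞ := fun x => ⨆ n, φ n x with hΦ
  have hΦm : Measurable Φ := .iSup hm
  have hΦfix : ∀ x, Φ x = T (1 + Φ) x := by
    intro x
    have e : (1 + Φ) = fun x => ⨆ n, (1 + φ n) x := by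
      funext x
      simp only [Pi.add_apply, hΦ, ENNReal.add_iSup]
    have hm1 : ∀ n, Measurable (1 + φ n) := fun n => measurable_const.add (hm n)
    have hmono1 : Monotone fun n => 1 + φ n := fun m n h => add_le_add_right (hmono h) 1
    have h1 : T (1 + Φ) x = ⨆ n, T (1 + φ n) x := by
      simp only [T, e, mass_iSup hr hm1 hmono1, iSup_rpow hri]
      rw [tail_iSup (fun n => measurable_mass.pow_const _), ENNReal.mul_iSup]
      exact fun m n h s => ENNReal.rpow_le_rpow (mass_mono hr.le (hmono1 h) s) hri.le
    rw [h1, hΦ]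
    dsimp only
    rw [← Monotone.iSup_nat_add (fun m n h => hmono h x) 1]
  -- Otherwise `1 + Φ` has finite nonzero mass `ν`-almost everywhere and is a supersolution for `c`,
  -- so the Hardy inequality would hold with constant `c`, against `hwc`.
  obtain ⟨s₀, hs₀, htop⟩ : ∃ s₀ < x₁, mass μ r (1 + Φ) s₀ = ∞ := by
    by_contra! hcon
    refine absurd (hardy_of_supersolution (μ := μ) hr (measurable_const.add hΦm) hw (c := c)
      (f := 1 + Φ) ?_ ?_ ?_) (not_le.2 hwc)
    · filter_upwards [hμ0] with s hs0 h
      refine hs0 (le_antisymm (h ▸ ?_) bot_le)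
      calc μ (Iio s) = ∫⁻ t in Iio s, 1 ∂μ := by simp
        _ ≤ _ := lintegral_mono fun t => ENNReal.one_le_rpow (by simp) hr
    · filter_upwards [hν] with s hsx using hcon s hsx
    · refine .of_forall fun x => ?_
      have h1 : c * tail ν (fun s => mass μ r (1 + Φ) s ^ r⁻¹) x ^ r = Φ x ^ r := by
        rw [hΦfix x]
        simp only [T]
        rw [ENNReal.mul_rpow_of_nonneg _ _ hr.le, ← ENNReal.rpow_mul, inv_mul_cancel₀ hr.ne',
          ENNReal.rpow_one]
      rw [h1]
      exact ENNReal.rpow_le_rpow (by simp) hr.le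
  -- Infinite mass at `s₀` makes the integrand of the tail infinite on `(max x s₀, ∞)`, which `ν`
  -- charges.
  have hΦtop : ∀ x < x₁, Φ x = ∞ := by
    intro x hx
    rw [hΦfix x]
    have h1 : tail ν (fun s => mass μ r (1 + Φ) s ^ r⁻¹) x = ∞ := by
      rw [← top_le_iff]
      calc ∞ = ∫⁻ s in Ioi (max x s₀), ∞ ∂ν := by
            rw [lintegral_const, Measure.restrict_apply_univ,
              ENNReal.top_mul (hνx _ (max_lt hx hs₀))]
        _ ≤ ∫⁻ s in Ioi (max x s₀), mass μ r (1 + Φ) s ^ r⁻¹ ∂ν := by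
            refine setLIntegral_mono' measurableSet_Ioi fun s hsm => ?_
            have : mass μ r (1 + Φ) s = ∞ :=
              top_le_iff.1 (htop ▸ mass_monotone ((le_max_right _ _).trans (le_of_lt hsm)))
            rw [this, ENNReal.top_rpow_of_pos hri]
        _ ≤ _ := lintegral_mono_set (Ioi_subset_Ioi (le_max_left _ _))
    simp only [T, h1, ENNReal.mul_top hcr0]
  -- With `c < c₂ < c₃ < C`: the step from `c` to `c₂` pays for the factor `(1 + 1/K) ^ r`, and the
  -- gap `c₃ - c₂` for the points where the iterate is below `K`.
  obtain ⟨c₂, hc₂, hc₂C⟩ := exists_between hcC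
  obtain ⟨c₃, hc₃, hc₃C⟩ := exists_between hc₂C
  obtain ⟨K, hK1, hK⟩ : ∃ K : ℕ, 1 ≤ K ∧ c * (1 + (K : ℝ≥0∞)⁻¹) ^ r ≤ c₂ := by
    have h1 : Tendsto (fun n : ℕ => c * (1 + (n : ℝ≥0∞)⁻¹) ^ r) atTop (𝓝 (c * (1 + 0) ^ r)) :=
      ENNReal.Tendsto.const_mul ((ENNReal.continuous_rpow_const.tendsto _).comp
        (tendsto_const_nhds.add ENNReal.tendsto_inv_nat_nhds_zero)) (Or.inr hct)
    rw [add_zero, ENNReal.one_rpow, mul_one] at h1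
    obtain ⟨K, h2, h3⟩ := ((h1.eventually (gt_mem_nhds hc₂)).and (eventually_ge_atTop 1)).exists
    exact ⟨K, h3, h2.le⟩
  have hK0 : (K : ℝ≥0∞) ≠ 0 := by exact_mod_cast (by omega : K ≠ 0)
  have hKt : (K : ℝ≥0∞) ≠ ∞ := ENNReal.natCast_ne_top K
  -- `L` bounds `c` times the contribution to `mass (1 + φ n)` of the points where `φ n ≤ K`,
  -- uniformly in `n`.
  set L := c * ((1 + (K : ℝ≥0∞)) ^ r * μ (Iio x₁)) with hL
  have hLt : L ≠ ∞ := ENNReal.mul_ne_top hct (ENNReal.mul_ne_top (ENNReal.rpow_ne_top_of_nonneg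
    hr.le (ENNReal.add_ne_top.2 ⟨ENNReal.one_ne_top, hKt⟩)) hμf)
  have hd0 : c₃ - c₂ ≠ 0 := (tsub_pos_of_lt hc₃).ne'
  have hdt : c₃ - c₂ ≠ ∞ := ENNReal.sub_ne_top (hc₃C.trans_le le_top).ne
  obtain ⟨n₁, hn₁⟩ : ∃ n, (K : ℝ≥0∞) < φ n a := by
    rw [← lt_iSup_iff]
    have h1 : ⨆ n, φ n a = ∞ := hΦtop a hax
    rw [h1]
    exact hKt.lt_top
  obtain ⟨n₂, hn₂⟩ : ∃ n, L / (c₃ - c₂) < mass μ r (φ n) a := by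
    rw [← lt_iSup_iff, ← mass_iSup hr hm hmono]
    have : mass μ r (fun t => ⨆ n, φ n t) a = ∞ := by
      rw [← top_le_iff]
      calc ∞ = ∫⁻ t in Iio a, ∞ ∂μ := by
            rw [lintegral_const, Measure.restrict_apply_univ, ENNReal.top_mul hμa]
        _ ≤ _ := setLIntegral_mono' measurableSet_Iio fun t ht => by
            have h1 : ⨆ n, φ n t = ∞ := hΦtop t (lt_trans ht hax)
            simp only [h1, ENNReal.top_rpow_of_pos hr, le_refl]
    rw [this]
    exact (ENNReal.div_ne_top hLt hd0).lt_top
  -- At this stage `φ n ≥ K` on all of `(-∞, a]`, as `φ n` is antitone, and the mass of `φ n` up to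
  -- `a` already outweighs `L / (c₃ - c₂)`.
  set n := max n₁ n₂
  have hKn : (K : ℝ≥0∞) ≤ φ n a := hn₁.le.trans (hmono (le_max_left _ _) a)
  have hLn : L ≤ (c₃ - c₂) * mass μ r (φ n) a := by
    have h1 : L / (c₃ - c₂) ≤ mass μ r (φ n) a :=
      hn₂.le.trans (mass_mono hr.le (hmono (le_max_right _ _)) a)
    rwa [ENNReal.div_le_iff hd0 hdt, mul_comm] at h1
  obtain ⟨B, hB, hBle⟩ := hbd n
  refine ⟨1 + φ n, measurable_const.add (hm n),
    ⟨1 + B, ENNReal.add_ne_top.2 ⟨ENNReal.one_ne_top, hB⟩, fun x => add_le_add_right (hBle x) 1⟩,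
    fun x => by simp, fun s hsx => ?_⟩
  -- For `g = 1 + φ n` the right-hand function is `T g = φ (n + 1)`, which is at least `φ n`; it
  -- suffices to compare with `φ n`.
  change _ ≤ C * mass μ r (φ (n + 1)) s
  refine le_trans ?_ (mul_le_mul_right (mass_mono hr.le (hmono n.le_succ) s) C)
  have hmul : ∀ s, (1 + (K : ℝ≥0∞)⁻¹) ^ r * mass μ r (φ n) s =
      ∫⁻ t in Iio s, (1 + (K : ℝ≥0∞)⁻¹) ^ r * φ n t ^ r ∂μ := fun s =>
    (lintegral_const_mul _ ((hm n).pow_const _)).symm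
  -- Left of `a` only points with `φ n ≥ K` contribute; right of `a` the remaining points are
  -- absorbed by the mass gathered up to `a`.
  rcases le_total s a with hsa | hsa
  · calc c * mass μ r (1 + φ n) s ≤ c * ((1 + (K : ℝ≥0∞)⁻¹) ^ r * mass μ r (φ n) s) := by
          rw [hmul]
          gcongr
          refine setLIntegral_mono' measurableSet_Iio fun t ht => ?_
          exact one_add_rpow_le hr hK0 hKt (hKn.trans (hanti n (le_of_lt (lt_of_lt_of_le ht hsa))))
      _ ≤ c₂ * mass μ r (φ n) s := by rw [← mul_assoc]; gcongr
      _ ≤ _ := by gcongr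
  · have h1 : mass μ r (1 + φ n) s ≤
        (1 + (K : ℝ≥0∞)⁻¹) ^ r * mass μ r (φ n) s + (1 + (K : ℝ≥0∞)) ^ r * μ (Iio x₁) := by
      calc mass μ r (1 + φ n) s
          ≤ ∫⁻ t in Iio s, ((1 + (K : ℝ≥0∞)⁻¹) ^ r * φ n t ^ r + (1 + (K : ℝ≥0∞)) ^ r) ∂μ := by
            refine lintegral_mono fun t => ?_
            rcases le_total (K : ℝ≥0∞) (φ n t) with h | h
            · exact (one_add_rpow_le hr hK0 hKt h).trans le_self_add
            · exact (ENNReal.rpow_le_rpow (add_le_add_right h 1) hr.le).trans le_add_self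
        _ = (1 + (K : ℝ≥0∞)⁻¹) ^ r * mass μ r (φ n) s + (1 + (K : ℝ≥0∞)) ^ r * μ (Iio s) := by
            rw [lintegral_add_right _ measurable_const, hmul]
            simp
        _ ≤ _ := by gcongr
    calc c * mass μ r (1 + φ n) s
        ≤ c * ((1 + (K : ℝ≥0∞)⁻¹) ^ r * mass μ r (φ n) s +
            (1 + (K : ℝ≥0∞)) ^ r * μ (Iio x₁)) := by gcongr
      _ = c * (1 + (K : ℝ≥0∞)⁻¹) ^ r * mass μ r (φ n) s + L := by rw [mul_add, ← mul_assoc]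
      _ ≤ c₂ * mass μ r (φ n) s + (c₃ - c₂) * mass μ r (φ n) s := by
          gcongr
          exact hLn.trans (mul_le_mul_right (mass_monotone hsa) _)
      _ = c₃ * mass μ r (φ n) s := by rw [← add_mul, add_tsub_cancel_of_le hc₃.le]
      _ ≤ _ := by gcongr

end Iteration
-- The intervals and their exhaustion
section Intervals

variable {D : EReal}

lemma isOpen_openI : IsOpen (openI D) :=
  isOpen_Ioi.inter (isOpen_Iio.preimage continuous_coe_real_ereal)

lemma measurableSet_openI : MeasurableSet (openI D) := isOpen_openI.measurableSet

lemma openI_subset_closedI : openI D ⊆ closedI D := fun _ h => ⟨h.1.le, h.2.le⟩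

lemma Icc_subset_closedI {x y : ℝ} (hx : x ∈ closedI D) (hy : y ∈ closedI D) :
    Icc x y ⊆ closedI D := fun _ h =>
  ⟨hx.1.trans h.1, (EReal.coe_le_coe_iff.2 h.2).trans hy.2⟩

lemma Icc_subset_openI {x y : ℝ} (hx : x ∈ openI D) (hy : y ∈ openI D) :
    Icc x y ⊆ openI D := fun _ h =>
  ⟨hx.1.trans_le h.1, (EReal.coe_le_coe_iff.2 h.2).trans_lt hy.2⟩

lemma Ioo_subset_openI {x y : ℝ} (hx : x ∈ closedI D) (hy : y ∈ closedI D) :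
    Ioo x y ⊆ openI D := fun _ h =>
  ⟨hx.1.trans_lt h.1, (EReal.coe_lt_coe_iff.2 h.2).trans_le hy.2⟩

lemma uIcc_subset_closedI {x y : ℝ} (hx : x ∈ closedI D) (hy : y ∈ closedI D) :
    uIcc x y ⊆ closedI D := by
  rcases le_total x y with h | h
  · rw [uIcc_of_le h]; exact Icc_subset_closedI hx hy
  · rw [uIcc_of_ge h]; exact Icc_subset_closedI hy hx

lemma uIoc_subset_openI {x y : ℝ} (hx : x ∈ openI D) (hy : y ∈ openI D) :
    uIoc x y ⊆ openI D := by
  intro t ht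
  have := uIoc_subset_uIcc ht
  rcases le_total x y with h | h
  · rw [uIcc_of_le h] at this; exact Icc_subset_openI hx hy this
  · rw [uIcc_of_ge h] at this; exact Icc_subset_openI hy hx this

lemma zero_mem_closedI (hD : 0 < D) : (0 : ℝ) ∈ closedI D := ⟨le_rfl, by simpa using hD.le⟩

lemma exists_exhaustion (hD : 0 < D) : ∃ a b : ℕ → ℝ, Antitone a ∧ Monotone b ∧
    (∀ n, a n ∈ openI D ∧ b n ∈ openI D ∧ a n < b n) ∧
      ∀ x ∈ openI D, ∃ n, a n < x ∧ x < b n := by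
  have hex : ∃ x : ℝ, 0 < x ∧ (x : EReal) < D := by
    obtain ⟨x, h1, h2⟩ := EReal.lt_iff_exists_real_btwn.1 hD
    exact ⟨x, by exact_mod_cast h1, h2⟩
  obtain ⟨m, hm0, hmD⟩ := hex
  obtain ⟨b, hb, hbD, hbt⟩ : ∃ b : ℕ → ℝ, Monotone b ∧ (∀ n, m ≤ b n ∧ (b n : EReal) < D) ∧
      ∀ x : ℝ, (x : EReal) < D → ∃ n, x < b n := by
    induction D with
    | bot => simp at hD
    | top =>
      refine ⟨fun n => m + n, fun i j h => ?_, fun n => ⟨?_, EReal.coe_lt_top _⟩, fun x _ => ?_⟩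
      · have : (i : ℝ) ≤ j := by exact_mod_cast h
        dsimp only; linarith
      · simp
      · obtain ⟨n, hn⟩ := exists_nat_gt (x - m)
        exact ⟨n, by linarith⟩
    | coe d =>
      have hmd : m < d := by exact_mod_cast hmD
      have hpos : ∀ n : ℕ, (0:ℝ) < (n:ℝ) + 1 := fun n => by positivity
      refine ⟨fun n => d - (d - m) / (n + 1), fun i j h => ?_, fun n => ⟨?_, ?_⟩, fun x hx => ?_⟩
      · have h' : (i : ℝ) ≤ j := by exact_mod_cast h
        dsimp only
        have : (d - m) / ((j:ℝ) + 1) ≤ (d - m) / (i + 1) := by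
          apply div_le_div_of_nonneg_left <;> linarith [hpos i]
        linarith
      · have : (d - m) / ((n:ℝ) + 1) ≤ d - m :=
          div_le_self (by linarith) (by linarith [(Nat.cast_nonneg n : (0:ℝ) ≤ n)])
        linarith
      · have : 0 < (d - m) / ((n:ℝ) + 1) := div_pos (by linarith) (hpos n)
        exact_mod_cast (by linarith : d - (d - m) / ((n:ℝ) + 1) < d)
      · have hx' : x < d := by exact_mod_cast hx
        obtain ⟨n, hn⟩ := exists_nat_gt ((d - m) / (d - x))
        refine ⟨n, ?_⟩
        rw [div_lt_iff₀ (by linarith)] at hn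
        have : (d - m) / ((n:ℝ) + 1) < d - x := by
          rw [div_lt_iff₀ (hpos n)]; nlinarith
        linarith
  have hpos : ∀ n : ℕ, (0:ℝ) < (n:ℝ) + 2 := fun n => by positivity
  have ham : ∀ n : ℕ, m / ((n:ℝ) + 2) < m := fun n => by
    rw [div_lt_iff₀ (hpos n)]; nlinarith [(Nat.cast_nonneg n : (0:ℝ) ≤ n)]
  have haa : Antitone fun n : ℕ => m / ((n:ℝ) + 2) := fun i j h => by
    have h' : (i : ℝ) ≤ j := by exact_mod_cast h
    dsimp only
    apply div_le_div_of_nonneg_left <;> linarith [hpos i]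
  -- The shift by `2` keeps the left endpoints strictly below `m`, while `b 0` may equal `m`.
  refine ⟨fun n => m / (n + 2), b, haa, hb, fun n => ⟨⟨div_pos hm0 (hpos n), ?_⟩,
    ⟨hm0.trans_le (hbD n).1, (hbD n).2⟩, (ham n).trans_le (hbD n).1⟩, fun x hx => ?_⟩
  · exact (EReal.coe_lt_coe_iff.2 (ham n)).trans hmD
  · obtain ⟨n, hn⟩ := hbt x hx.2
    obtain ⟨k, hk⟩ := exists_nat_gt (m / x)
    rw [div_lt_iff₀ hx.1] at hk
    refine ⟨max n k, lt_of_le_of_lt (haa (le_max_right n k)) ?_, hn.trans_le (hb (le_max_left n k))⟩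
    rw [div_lt_iff₀ (hpos k)]
    nlinarith [hx.1]

lemma nonempty_openI (hD : 0 < D) : (openI D).Nonempty := by
  obtain ⟨a, b, -, -, h, -⟩ := exists_exhaustion hD
  exact ⟨a 0, (h 0).1⟩

end Intervals

/-! ### Measures with a density on the interval -/

/-- The measure `d(x) dx` on `(0, D)`. -/
noncomputable def densityMeasure (D : EReal) (d : ℝ → ℝ) : Measure ℝ :=
  (volume.restrict (openI D)).withDensity fun x => ENNReal.ofReal (d x)

section Density

variable {D : EReal} {d : ℝ → ℝ}

instance : SFinite (densityMeasure D d) := by unfold densityMeasure; infer_instance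

instance : NullSingletonClass (densityMeasure D d) := by
  unfold densityMeasure; infer_instance

lemma densityMeasure_ac : densityMeasure D d ≪ volume.restrict (openI D) :=
  withDensity_absolutelyContinuous _ _

lemma ae_densityMeasure_mem : ∀ᵐ x ∂densityMeasure D d, x ∈ openI D :=
  densityMeasure_ac.ae_le (ae_restrict_mem measurableSet_openI)

lemma setLIntegral_densityMeasure (hd : Measurable d) {A : Set ℝ} (hA : MeasurableSet A)
    (f : ℝ → ℝ≥0∞) :
    ∫⁻ x in A, f x ∂densityMeasure D d = ∫⁻ x in A ∩ openI D, ENNReal.ofReal (d x) * f x := by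
  rw [densityMeasure, restrict_withDensity hA, Measure.restrict_restrict hA,
    lintegral_withDensity_eq_lintegral_mul_non_measurable _ hd.ennreal_ofReal
      (.of_forall fun x => ENNReal.ofReal_lt_top)]
  rfl

lemma lintegral_densityMeasure (hd : Measurable d) (f : ℝ → ℝ≥0∞) :
    ∫⁻ x, f x ∂densityMeasure D d = ∫⁻ x in openI D, ENNReal.ofReal (d x) * f x := by
  rw [← setLIntegral_univ, setLIntegral_densityMeasure hd MeasurableSet.univ, univ_inter]

lemma densityMeasure_apply {A : Set ℝ} (hA : MeasurableSet A) :
    densityMeasure D d A = ∫⁻ x in A ∩ openI D, ENNReal.ofReal (d x) := by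
  rw [densityMeasure, withDensity_apply _ hA, Measure.restrict_restrict hA]

/-- Local integrability on `[0, D]` includes the endpoint `0`, and `D` when finite, so the part of a
half-line inside `(0, D)` sits in a compact set on which the density is integrable. -/
lemma densityMeasure_Iio_ne_top (hdi : LocallyIntegrableOn d (closedI D)) (hD : 0 < D) (x : ℝ) :
    densityMeasure D d (Iio x) ≠ ∞ := by
  obtain ⟨y, hy, hsub⟩ : ∃ y ∈ closedI D, Iio x ∩ openI D ⊆ Icc 0 y := by
    rcases le_total x 0 with hx | hx
    · exact ⟨0, zero_mem_closedI hD, fun t ht => absurd (ht.1.trans_le hx) (not_lt.2 ht.2.1.le)⟩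
    rcases le_total (x : EReal) D with hxD | hxD
    · exact ⟨x, ⟨hx, hxD⟩, fun t ht => ⟨ht.2.1.le, ht.1.le⟩⟩
    · induction D with
      | bot => simp at hD
      | top => simp at hxD
      | coe e =>
        exact ⟨e, ⟨by exact_mod_cast hD.le, le_rfl⟩,
          fun t ht => ⟨ht.2.1.le, by exact_mod_cast ht.2.2.le⟩⟩
  rw [densityMeasure_apply measurableSet_Iio]
  refine ne_top_of_le_ne_top ?_ (lintegral_mono_set hsub)
  have h1 : IntegrableOn d (Icc 0 y) := hdi.integrableOn_compact_subset
    (Icc_subset_closedI (zero_mem_closedI hD) hy) isCompact_Icc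
  exact h1.lintegral_lt_top.ne

lemma densityMeasure_ne_zero (hdm : Measurable d) (hd : ∀ᵐ x ∂volume.restrict (openI D), 0 < d x) {U : Set ℝ}
    (hU : IsOpen U) (h : (U ∩ openI D).Nonempty) : densityMeasure D d U ≠ 0 := by
  rw [densityMeasure_apply hU.measurableSet]
  intro h0
  have hm : MeasurableSet (U ∩ openI D) := hU.measurableSet.inter measurableSet_openI
  have hae : ∀ᵐ x ∂volume.restrict (U ∩ openI D), 0 < d x :=
    ae_mono (Measure.restrict_mono inter_subset_right le_rfl) hd
  have hv0 : volume (U ∩ openI D) = 0 := by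
    rw [lintegral_eq_zero_iff hdm.ennreal_ofReal] at h0
    rw [← Measure.restrict_eq_zero, ← ae_eq_bot, ← eventually_false_iff_eq_bot]
    filter_upwards [h0, hae] with x h1 h2
    simp only [Pi.zero_apply, ENNReal.ofReal_eq_zero] at h1
    linarith
  exact ((hU.inter isOpen_openI).measure_pos volume h).ne' hv0

lemma intervalIntegrable_density (hdi : LocallyIntegrableOn d (closedI D)) {x y : ℝ}
    (hx : x ∈ closedI D) (hy : y ∈ closedI D) : IntervalIntegrable d volume x y :=
  (hdi.integrableOn_compact_subset (uIcc_subset_closedI hx hy) isCompact_uIcc).intervalIntegrable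

lemma intervalIntegral_densityMeasure (hd : Measurable d)
    (hd0 : ∀ᵐ x ∂volume.restrict (openI D), 0 < d x) {x y : ℝ} (hx : x ∈ openI D)
    (hy : y ∈ openI D) (W : ℝ → ℝ) :
    ∫ t in x..y, W t ∂densityMeasure D d = ∫ t in x..y, d t * W t := by
  have hsub := uIoc_subset_openI hx hy
  rw [intervalIntegral.intervalIntegral_eq_integral_uIoc,
    intervalIntegral.intervalIntegral_eq_integral_uIoc, densityMeasure,
    setIntegral_withDensity_eq_setIntegral_toReal_smul hd.ennreal_ofReal
      (.of_forall fun x => ENNReal.ofReal_lt_top) _ measurableSet_uIoc,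
    Measure.restrict_restrict measurableSet_uIoc, inter_eq_left.2 hsub]
  congr 1
  refine integral_congr_ae ?_
  filter_upwards [ae_mono (Measure.restrict_mono hsub le_rfl) hd0] with t ht
  rw [ENNReal.toReal_ofReal ht.le, smul_eq_mul]

end Density

/-! ### Continuity of masses and tails -/

section Continuity

variable {μ ν : Measure ℝ} [NullSingletonClass μ] [NullSingletonClass ν] {r : ℝ} {f w : ℝ → ℝ≥0∞}

lemma continuousOn_mass (hf : Measurable f) {b : ℝ} (hb : mass μ r f b ≠ ∞) :
    ContinuousOn (fun s => (mass μ r f s).toReal) (Iic b) := by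
  have hm : Measurable fun t => f t ^ r := hf.pow_const r
  have hi : IntegrableOn (fun t => (f t ^ r).toReal) (Iio b) μ :=
    integrable_toReal_of_lintegral_ne_top hm.aemeasurable hb
  refine hi.continuousOn_Iic_primitive_Iio.congr fun s hs => ?_
  have hsb : mass μ r f s ≠ ∞ := ne_top_of_le_ne_top hb (mass_monotone hs)
  exact (integral_toReal hm.aemeasurable (ae_lt_top hm hsb)).symm

lemma continuousOn_tail (hw : Measurable w) {a : ℝ} (ha : tail ν w a ≠ ∞) :
    ContinuousOn (fun s => (tail ν w s).toReal) (Ici a) := by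
  have hi : IntegrableOn (fun t => (w t).toReal) (Ioi a) ν :=
    integrable_toReal_of_lintegral_ne_top hw.aemeasurable ha
  refine hi.continuousOn_Ici_primitive_Ioi.congr fun s hs => ?_
  have hsb : tail ν w s ≠ ∞ := ne_top_of_le_ne_top ha (tail_antitone hs)
  exact (integral_toReal hw.aemeasurable (ae_lt_top hw hsb)).symm

end Continuity

/-! ### The flux, its integral representation and the energy -/

section Flux

variable {p : ℝ} {D : EReal} {v : ℝ → ℝ}

lemma measurable_vhat (hvm : Measurable v) : Measurable (vhat p v) := hvm.pow_const _

lemma vhat_pos (hv : ∀ᵐ x ∂volume.restrict (openI D), 0 < v x) :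
    ∀ᵐ x ∂volume.restrict (openI D), 0 < vhat p v x := by
  filter_upwards [hv] with x hx using Real.rpow_pos_of_pos hx _

lemma flux_eq_of_tendsto {f : ℝ → ℝ} {x l : ℝ}
    (h : Tendsto (fun y => (f y - f x) / ∫ t in x..y, vhat p v t) (𝓝[≠] x) (𝓝 l)) :
    flux p v f x = l := by
  have hex : ∃ l, Tendsto (fun y => (f y - f x) / ∫ t in x..y, vhat p v t) (𝓝[≠] x) (𝓝 l) :=
    ⟨l, h⟩
  rw [flux, dif_pos hex]
  exact tendsto_nhds_unique hex.choose_spec h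

lemma integral_vhat_ne_zero (hvi : LocallyIntegrableOn (vhat p v) (closedI D))
    (hv : ∀ᵐ x ∂volume.restrict (openI D), 0 < v x) {x y : ℝ} (hx : x ∈ openI D)
    (hy : y ∈ openI D) (hxy : y ≠ x) : ∫ t in x..y, vhat p v t ≠ 0 := by
  wlog hlt : x < y generalizing x y
  · rw [intervalIntegral.integral_symm, neg_ne_zero]
    exact this hy hx hxy.symm (lt_of_le_of_ne (not_lt.1 hlt) hxy)
  have hi := intervalIntegrable_density hvi (openI_subset_closedI hx) (openI_subset_closedI hy)
  have hpos : ∀ᵐ t ∂volume.restrict (uIoc x y), 0 < vhat p v t :=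
    ae_mono (Measure.restrict_mono (uIoc_subset_openI hx hy) le_rfl) (vhat_pos hv)
  refine ((intervalIntegral.integral_pos_iff_support_of_nonneg_ae'
    (hpos.mono fun t ht => ht.le) hi).2 ⟨hlt, ?_⟩).ne'
  have hIoc : 0 < volume (Ioc x y) := by simp [hlt]
  refine hIoc.trans_le (measure_mono_ae ?_)
  rw [uIoc_of_le hlt.le, ae_restrict_iff' measurableSet_Ioc] at hpos
  filter_upwards [hpos] with t ht htm using ⟨(ht htm).ne', htm⟩

/-- A function of the form `∫ v̂ W` has flux `W` wherever `W` is continuous. -/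
lemma flux_eq_of_integral (hvi : LocallyIntegrableOn (vhat p v) (closedI D))
    (hvm : Measurable v) (hv : ∀ᵐ x ∂volume.restrict (openI D), 0 < v x) {f W : ℝ → ℝ}
    (hWm : Measurable W) {x : ℝ} (hx : x ∈ openI D) (hW : ContinuousAt W x)
    (hf : ∀ y ∈ openI D, f y - f x = ∫ t in x..y, vhat p v t * W t) : flux p v f x = W x := by
  apply flux_eq_of_tendsto
  rw [Metric.tendsto_nhdsWithin_nhds]
  intro ε hε
  obtain ⟨δ, hδ, hball⟩ := Metric.continuousAt_iff.1 hW (ε / 2) (half_pos hε)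
  obtain ⟨δ', hδ', hball'⟩ := Metric.isOpen_iff.1 isOpen_openI x hx
  refine ⟨min δ δ', lt_min hδ hδ', fun y hy hyx => ?_⟩
  have hyD : y ∈ openI D := hball' (lt_of_lt_of_le hyx (min_le_right _ _))
  have h0 := integral_vhat_ne_zero hvi hv hx hyD hy
  have hi := intervalIntegrable_density hvi (openI_subset_closedI hx) (openI_subset_closedI hyD)
  have hnear : ∀ t ∈ uIoc x y, |W t - W x| ≤ ε / 2 := fun t ht => by
    have h1 : |t - x| ≤ |y - x| := abs_sub_left_of_mem_uIcc (uIoc_subset_uIcc ht)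
    exact (hball (lt_of_le_of_lt h1 (lt_of_lt_of_le hyx (min_le_left _ _)))).le
  have hpos : ∀ᵐ t ∂volume.restrict (uIoc x y), 0 < vhat p v t :=
    ae_mono (Measure.restrict_mono (uIoc_subset_openI hx hyD) le_rfl) (vhat_pos hv)
  have hle : ∀ᵐ t ∂volume.restrict (uIoc x y),
      ‖vhat p v t * (W t - W x)‖ ≤ ε / 2 * vhat p v t := by
    filter_upwards [hpos, ae_restrict_mem measurableSet_uIoc] with t h1 h2
    rw [norm_mul, Real.norm_of_nonneg h1.le, mul_comm]
    exact mul_le_mul_of_nonneg_right (hnear t h2) h1.le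
  have hi2 : IntervalIntegrable (fun t => vhat p v t * (W t - W x)) volume x y := by
    refine (hi.const_mul (ε / 2)).mono_fun
      ((measurable_vhat hvm).mul (hWm.sub_const _)).aestronglyMeasurable ?_
    filter_upwards [hle] with t ht using ht.trans (le_abs_self _)
  -- The difference quotient is `W x` plus the `v̂ dx`-average of `W - W x` between `x` and `y`, and
  -- this average is at most `ε / 2`.
  have e : (f y - f x) / ∫ t in x..y, vhat p v t = W x +
      (∫ t in x..y, vhat p v t * (W t - W x)) / ∫ t in x..y, vhat p v t := by
    rw [hf y hyD]
    have : ∫ t in x..y, vhat p v t * W t =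
        (∫ t in x..y, vhat p v t * (W t - W x)) + (∫ t in x..y, vhat p v t) * W x := by
      rw [← intervalIntegral.integral_mul_const, ← intervalIntegral.integral_add hi2
        (hi.mul_const _)]
      congr 1; funext t; ring
    rw [this]
    field_simp
    ring
  rw [e, Real.dist_eq, add_sub_cancel_left, abs_div, div_lt_iff₀ (abs_pos.2 h0)]
  calc |∫ t in x..y, vhat p v t * (W t - W x)|
      ≤ |∫ t in x..y, ε / 2 * vhat p v t| :=
        intervalIntegral.norm_integral_le_abs_of_norm_le hle (hi.const_mul _)
    _ = ε / 2 * |∫ t in x..y, vhat p v t| := by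
        rw [intervalIntegral.integral_const_mul, abs_mul, abs_of_pos (half_pos hε)]
    _ < _ := by
        have := abs_pos.2 h0
        nlinarith

/-- Lebesgue differentiation on each interval of an exhaustion. It links the energy, written with
the ordinary derivative, to the flux. -/
lemma deriv_eq_of_fluxContinuousOn (hvi : LocallyIntegrableOn (vhat p v) (closedI D))
    (hD : 0 < D) {g : ℝ → ℝ} (hg : FluxContinuousOn p v g (openI D)) :
    ∀ᵐ x ∂volume.restrict (openI D), deriv g x = vhat p v x * flux p v g x := by
  obtain ⟨a, b, -, -, hab, hcov⟩ := exists_exhaustion hD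
  have key : ∀ n, ∀ᵐ x, x ∈ Ioo (a n) (b n) → deriv g x = vhat p v x * flux p v g x := by
    intro n
    obtain ⟨ha, hb, hlt⟩ := hab n
    have hi : IntervalIntegrable (fun t => vhat p v t * flux p v g t) volume (a n) (b n) := by
      refine (intervalIntegrable_density hvi (openI_subset_closedI ha)
        (openI_subset_closedI hb)).mul_continuousOn (hg.1.mono ?_)
      rw [uIcc_of_le hlt.le]
      exact Icc_subset_openI ha hb
    filter_upwards [hi.ae_hasDerivAt_integral] with x hx hxm
    rw [uIcc_of_le hlt.le] at hx
    have h1 := hx (Ioo_subset_Icc_self hxm) (a n) (left_mem_Icc.2 hlt.le)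
    refine HasDerivAt.deriv ((h1.const_add (g (a n))).congr_of_eventuallyEq ?_)
    filter_upwards [isOpen_Ioo.mem_nhds hxm] with y hy
    rw [← hg.2 (a n) ha y (Icc_subset_openI ha hb (Ioo_subset_Icc_self hy))]
    ring
  rw [ae_restrict_iff' measurableSet_openI]
  filter_upwards [ae_all_iff.2 key] with x hx hxD
  obtain ⟨n, hn⟩ := hcov x hxD
  exact hx n hn

/-- The exponent identity `(1 - p*) p + 1 = 1 - p*`. -/
lemma vhat_rpow_mul (hp : 1 < p) {x : ℝ} (hx : 0 < v x) : vhat p v x ^ p * v x = vhat p v x := by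
  rw [vhat, ← Real.rpow_mul hx.le]
  nth_rewrite 2 [← Real.rpow_one (v x)]
  rw [← Real.rpow_add hx]
  congr 1
  rw [Real.conjExponent]
  have : p - 1 ≠ 0 := by linarith
  field_simp
  ring

/-- Substituting `f' = v̂ w` gives `|f'| ^ p v = v̂ ^ p v |w| ^ p = v̂ |w| ^ p`. -/
lemma energy_eq (hp : 1 < p) (hvi : LocallyIntegrableOn (vhat p v) (closedI D))
    (hvm : Measurable v) (hv : ∀ᵐ x ∂volume.restrict (openI D), 0 < v x)
    (hD : 0 < D) {g : ℝ → ℝ} (hg : FluxContinuousOn p v g (openI D)) :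
    energy p v D g = ∫⁻ x, ENNReal.ofReal |flux p v g x| ^ p ∂densityMeasure D (vhat p v) := by
  rw [lintegral_densityMeasure (measurable_vhat hvm), energy]
  refine lintegral_congr_ae ?_
  filter_upwards [deriv_eq_of_fluxContinuousOn hvi hD hg, hv, vhat_pos (p := p) hv] with x h1 h2 h3
  rw [ENNReal.ofReal_rpow_of_nonneg (abs_nonneg _) (by linarith), ← ENNReal.ofReal_mul h3.le, h1,
    abs_mul, abs_of_pos h3, Real.mul_rpow h3.le (abs_nonneg _)]
  congr 1
  rw [mul_right_comm, vhat_rpow_mul hp h2]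

/-- Increments of the function `x ↦ ∫_x^D v̂ W` for a non-negative `W`. -/
lemma tail_sub_tail (hvm : Measurable v) (hv : ∀ᵐ x ∂volume.restrict (openI D), 0 < v x)
    {W : ℝ → ℝ} (hWm : Measurable W) (hW0 : ∀ x, 0 ≤ W x)
    (ht : ∀ x, tail (densityMeasure D (vhat p v)) (fun s => ENNReal.ofReal (W s)) x ≠ ∞)
    {x y : ℝ} (hx : x ∈ openI D) (hy : y ∈ openI D) :
    (tail (densityMeasure D (vhat p v)) (fun s => ENNReal.ofReal (W s)) y).toReal -
      (tail (densityMeasure D (vhat p v)) (fun s => ENNReal.ofReal (W s)) x).toReal =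
      ∫ t in x..y, vhat p v t * -W t := by
  set ν := densityMeasure D (vhat p v)
  have e : ∀ x, (tail ν (fun s => ENNReal.ofReal (W s)) x).toReal = ∫ t in Ioi x, W t ∂ν :=
    fun x => (integral_eq_lintegral_of_nonneg_ae (.of_forall hW0) hWm.aestronglyMeasurable).symm
  have hi : ∀ x, IntegrableOn W (Ioi x) ν := fun x =>
    (lintegral_ofReal_ne_top_iff_integrable hWm.aestronglyMeasurable (.of_forall hW0)).1 (ht x)
  rw [e, e, intervalIntegral.integral_Ioi_sub_Ioi' (hi y) (hi x),
    intervalIntegral_densityMeasure (measurable_vhat hvm) (vhat_pos hv) hy hx,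
    intervalIntegral.integral_symm, ← intervalIntegral.integral_neg]
  simp only [mul_neg]

lemma flux_tail (hvi : LocallyIntegrableOn (vhat p v) (closedI D)) (hvm : Measurable v)
    (hv : ∀ᵐ x ∂volume.restrict (openI D), 0 < v x)
    {W : ℝ → ℝ} (hWm : Measurable W) (hW0 : ∀ x, 0 ≤ W x)
    (ht : ∀ x, tail (densityMeasure D (vhat p v)) (fun s => ENNReal.ofReal (W s)) x ≠ ∞)
    {x : ℝ} (hx : x ∈ openI D) (hWx : ContinuousAt W x) :
    flux p v (fun x => (tail (densityMeasure D (vhat p v))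
      (fun s => ENNReal.ofReal (W s)) x).toReal) x = -W x :=
  flux_eq_of_integral hvi hvm hv hWm.neg hx hWx.neg fun _ hy =>
    tail_sub_tail hvm hv hWm hW0 ht hx hy

lemma fluxContinuousOn_tail (hvi : LocallyIntegrableOn (vhat p v) (closedI D)) (hvm : Measurable v)
    (hv : ∀ᵐ x ∂volume.restrict (openI D), 0 < v x)
    {W : ℝ → ℝ} (hWm : Measurable W) (hW0 : ∀ x, 0 ≤ W x)
    (ht : ∀ x, tail (densityMeasure D (vhat p v)) (fun s => ENNReal.ofReal (W s)) x ≠ ∞)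
    {S : Set ℝ} (hS : IsOpen S) (hSD : S ⊆ openI D) (hSc : S.OrdConnected)
    (hWS : ContinuousOn W S) :
    FluxContinuousOn p v (fun x => (tail (densityMeasure D (vhat p v))
      (fun s => ENNReal.ofReal (W s)) x).toReal) S := by
  have hfl : ∀ x ∈ S, flux p v (fun x => (tail (densityMeasure D (vhat p v))
      (fun s => ENNReal.ofReal (W s)) x).toReal) x = -W x := fun x hx =>
    flux_tail hvi hvm hv hWm hW0 ht (hSD hx) (hWS.continuousAt (hS.mem_nhds hx))
  refine ⟨hWS.neg.congr hfl, fun x hx y hy => ?_⟩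
  rw [tail_sub_tail hvm hv hWm hW0 ht (hSD hx) (hSD hy)]
  refine intervalIntegral.integral_congr fun t htm => ?_
  simp only [hfl t (hSc.uIcc_subset hx hy htm)]

lemma continuous_tail_ofReal {ν : Measure ℝ} [NullSingletonClass ν] {w : ℝ → ℝ≥0∞}
    (hw : Measurable w) (ht : ∀ x, tail ν w x ≠ ∞) :
    Continuous fun x => (tail ν w x).toReal :=
  continuous_iff_continuousAt.2 fun x =>
    (continuousOn_tail hw (ht (x - 1))).continuousAt (Ici_mem_nhds (by linarith))

end Flux

/-! ### Standing assumptions; the operators in terms of masses and tails -/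

/-- The standing assumptions on the exponent, the interval and the weights. -/
structure Weights (p : ℝ) (D : EReal) (u v : ℝ → ℝ) : Prop where
  hp : 1 < p
  hD : 0 < D
  hum : Measurable u
  hvm : Measurable v
  hu : ∀ᵐ x ∂volume.restrict (openI D), 0 < u x
  hv : ∀ᵐ x ∂volume.restrict (openI D), 0 < v x
  hui : LocallyIntegrableOn u (closedI D)
  hvi : LocallyIntegrableOn (vhat p v) (closedI D)

section Bridge

variable {p : ℝ} {D : EReal} {u v : ℝ → ℝ}

lemma muPow_eq (hum : Measurable u) (f : ℝ → ℝ) (hp : 0 ≤ p) :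
    muPow p u D f = ∫⁻ x, ENNReal.ofReal |f x| ^ p ∂densityMeasure D u := by
  rw [lintegral_densityMeasure hum, muPow]
  refine lintegral_congr fun x => ?_
  rw [ENNReal.ofReal_mul (by positivity), mul_comm,
    ENNReal.ofReal_rpow_of_nonneg (abs_nonneg _) hp]

lemma massInt_eq (hum : Measurable u) (hp : 1 ≤ p) {f : ℝ → ℝ} {F : ℝ → ℝ≥0∞} {s : ℝ}
    (hs : s ∈ closedI D) (hF : ∀ x ∈ Ioo 0 s, 0 ≤ f x ∧ F x = ENNReal.ofReal (f x)) :
    massInt p u f s = mass (densityMeasure D u) (p - 1) F s := by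
  have e : Iio s ∩ openI D = Ioo 0 s := by
    ext x
    exact ⟨fun h => ⟨h.2.1, h.1⟩, fun h => ⟨h.2, h.1, (EReal.coe_lt_coe_iff.2 h.2).trans_le hs.2⟩⟩
  rw [mass, setLIntegral_densityMeasure hum measurableSet_Iio, e, massInt]
  refine setLIntegral_congr_fun measurableSet_Ioo fun x hx => ?_
  rw [ENNReal.ofReal_mul (Real.rpow_nonneg (hF x hx).1 _), mul_comm,
    ← ENNReal.ofReal_rpow_of_nonneg (hF x hx).1 (by linarith), (hF x hx).2]

lemma conjExponent_sub_one (hp : 1 < p) : p.conjExponent - 1 = (p - 1)⁻¹ := by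
  have : p - 1 ≠ 0 := by linarith
  rw [Real.conjExponent]
  field_simp
  ring

/-- The restriction to the support of `f` is moved into the measure, so that the abstract results
apply to `ν.restrict S`. -/
lemma opII_eq (hp : 1 < p) (hum : Measurable u) (hvm : Measurable v) {f : ℝ → ℝ} {F : ℝ → ℝ≥0∞}
    (hF : ∀ x ∈ openI D, 0 ≤ f x ∧ F x = ENNReal.ofReal (f x)) {S : Set ℝ}
    (hS : MeasurableSet S) (hSf : ∀ x, x ∈ S ↔ x ∈ openI D ∧ f x ≠ 0) {x : ℝ} (hx : 0 ≤ x)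
    (hfx : 0 ≤ f x) :
    opII p u v D f x =
      tail ((densityMeasure D (vhat p v)).restrict S)
        (fun s => mass (densityMeasure D u) (p - 1) F s ^ (p - 1)⁻¹) x ^ (p - 1) /
          ENNReal.ofReal (f x) ^ (p - 1) := by
  rw [opII, ENNReal.ofReal_rpow_of_nonneg hfx (by linarith), tail,
    Measure.restrict_restrict measurableSet_Ioi,
    setLIntegral_densityMeasure (measurable_vhat hvm) (measurableSet_Ioi.inter hS)]
  have e : {s : ℝ | x < s ∧ (s : EReal) < D ∧ f s ≠ 0} = Ioi x ∩ S ∩ openI D := by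
    ext s
    simp only [mem_ofPred_eq, mem_inter_iff, mem_Ioi, hSf, openI]
    constructor
    · rintro ⟨h1, h2, h3⟩
      exact ⟨⟨h1, ⟨hx.trans_lt h1, h2⟩, h3⟩, hx.trans_lt h1, h2⟩
    · rintro ⟨⟨h1, h2, h3⟩, h4⟩
      exact ⟨h1, h2.2, h3⟩
  rw [e, conjExponent_sub_one hp]
  congr 2
  refine setLIntegral_congr_fun ((measurableSet_Ioi.inter hS).inter measurableSet_openI)
    fun s hs => ?_
  rw [massInt_eq hum hp.le (openI_subset_closedI hs.2)]
  intro t ht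
  exact hF t ⟨ht.1, (EReal.coe_lt_coe_iff.2 ht.2).trans hs.2.2⟩

lemma tail_restrict {ν : Measure ℝ} {S : Set ℝ} (hS : MeasurableSet S) (w : ℝ → ℝ≥0∞) :
    tail (ν.restrict S) w = tail ν (S.indicator w) := by
  funext x
  rw [tail, tail, Measure.restrict_restrict measurableSet_Ioi, lintegral_indicator hS,
    Measure.restrict_restrict hS, inter_comm]

end Bridge

/-! ### Approximation by compactly supported continuous functions -/

section Cutoff

/-- The approximants are `min (w, n · dist(·, Sᶜ))` times a plateau function. The distance bound
makes the extension by zero continuous even if `w` blows up at the boundary of `S`, and at each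
point of `S` the value of `w` is reached exactly for large `n`. -/
lemma exists_cutoff {S : Set ℝ} (hS : IsOpen S) (hne : S ≠ univ) {w : ℝ → ℝ}
    (hw : ContinuousOn w S) (hw0 : ∀ x ∈ S, 0 ≤ w x) :
    ∃ W : ℕ → ℝ → ℝ, (∀ n, Continuous (W n)) ∧ (∀ n, HasCompactSupport (W n)) ∧
      (∀ n x, 0 ≤ W n x) ∧ Monotone W ∧ (∀ n x, x ∉ S → W n x = 0) ∧
      (∀ n, ∀ x ∈ S, W n x ≤ w x) ∧ ∀ x ∈ S, ∃ n, W n x = w x := by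
  have hSc : Sᶜ.Nonempty := nonempty_compl.2 hne
  -- Equal to `1` for `|x| ≤ n - 1` and to `0` for `|x| ≥ n`.
  let k : ℕ → ℝ → ℝ := fun n x => max 0 (min 1 (n - |x|))
  have hk0 : ∀ n x, 0 ≤ k n x := fun n x => le_max_left _ _
  have hk1 : ∀ n x, k n x ≤ 1 := fun n x => max_le zero_le_one (min_le_left _ _)
  have hkc : ∀ n, Continuous (k n) := fun n => by fun_prop
  have hkm : ∀ {m n : ℕ}, m ≤ n → ∀ x, k m x ≤ k n x := fun h x => by
    have : (_ : ℝ) ≤ _ := Nat.cast_le (α := ℝ).2 h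
    dsimp only [k]
    gcongr
  let g : ℕ → ℝ → ℝ := fun n x => min (w x) (n * Metric.infDist x Sᶜ) * k n x
  have hd0 : ∀ (n : ℕ) x, 0 ≤ n * Metric.infDist x Sᶜ := fun n x =>
    mul_nonneg (Nat.cast_nonneg n) Metric.infDist_nonneg
  have hmin0 : ∀ (n : ℕ), ∀ x ∈ S, 0 ≤ min (w x) (n * Metric.infDist x Sᶜ) := fun n x hx =>
    le_min (hw0 x hx) (hd0 n x)
  have hg0 : ∀ n, ∀ x ∈ S, 0 ≤ g n x := fun n x hx => mul_nonneg (hmin0 n x hx) (hk0 n x)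
  have hind0 : ∀ n x, 0 ≤ S.indicator (g n) x := fun n x => indicator_nonneg (hg0 n) x
  have hgc : ∀ n, ContinuousOn (g n) S := fun n =>
    (hw.inf (continuous_const.mul (Metric.continuous_infDist_pt _)).continuousOn).mul
      (hkc n).continuousOn
  have hindle : ∀ (n : ℕ) x, S.indicator (g n) x ≤ n * Metric.infDist x Sᶜ := fun n x => by
    by_cases hx : x ∈ S
    · rw [indicator_of_mem hx]
      calc g n x ≤ min (w x) (n * Metric.infDist x Sᶜ) * 1 :=
            mul_le_mul_of_nonneg_left (hk1 n x) (hmin0 n x hx)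
        _ ≤ _ := by rw [mul_one]; exact min_le_right _ _
    · rw [indicator_of_notMem hx]; exact hd0 n x
  refine ⟨fun n => S.indicator (g n), fun n => continuous_iff_continuousAt.2 fun x => ?_,
    fun n => ?_, hind0, fun m n h x => ?_, fun n x hx => indicator_of_notMem hx _,
    fun n x hx => ?_, fun x hx => ?_⟩
  · by_cases hx : x ∈ S
    · refine ((hgc n).continuousAt (hS.mem_nhds hx)).congr ?_
      filter_upwards [hS.mem_nhds hx] with y hy using (indicator_of_mem hy _).symm
    · have h0 : (n : ℝ) * Metric.infDist x Sᶜ = 0 := by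
        rw [Metric.infDist_zero_of_mem hx, mul_zero]
      change Tendsto (S.indicator (g n)) (𝓝 x) (𝓝 (S.indicator (g n) x))
      rw [indicator_of_notMem hx]
      refine squeeze_zero (hind0 n) (hindle n) ?_
      rw [← h0]
      exact (continuous_const.mul (Metric.continuous_infDist_pt _)).tendsto x
  · refine HasCompactSupport.intro (isCompact_Icc (a := -(n:ℝ)) (b := n)) fun x hx => ?_
    have hxn : (n : ℝ) ≤ |x| := by
      by_contra! h
      exact hx (abs_le.1 h.le)
    have : k n x = 0 := max_eq_left ((min_le_right _ _).trans (by linarith))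
    change S.indicator (g n) x = 0
    by_cases hxS : x ∈ S
    · rw [indicator_of_mem hxS]; simp only [g, this, mul_zero]
    · exact indicator_of_notMem hxS _
  · by_cases hx : x ∈ S
    · simp only [indicator_of_mem hx, g]
      refine mul_le_mul (min_le_min_left _ ?_) (hkm h x) (hk0 m x) (hmin0 n x hx)
      exact mul_le_mul_of_nonneg_right (Nat.cast_le.2 h) Metric.infDist_nonneg
    · simp only [indicator_of_notMem hx, le_refl]
  · simp only [indicator_of_mem hx, g]
    calc _ ≤ min (w x) (n * Metric.infDist x Sᶜ) * 1 :=
          mul_le_mul_of_nonneg_left (hk1 n x) (hmin0 n x hx)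
      _ ≤ _ := by rw [mul_one]; exact min_le_left _ _
  · have hpos : 0 < Metric.infDist x Sᶜ :=
      (hS.isClosed_compl.notMem_iff_infDist_pos hSc).1 (by simpa using hx)
    obtain ⟨n, hn⟩ := exists_nat_gt (w x / Metric.infDist x Sᶜ)
    obtain ⟨m, hm⟩ := exists_nat_gt (|x| + 1)
    refine ⟨max n m, ?_⟩
    rw [div_lt_iff₀ hpos] at hn
    have h1 : (n : ℝ) ≤ (max n m : ℕ) := Nat.cast_le.2 (le_max_left _ _)
    have h2 : (m : ℝ) ≤ (max n m : ℕ) := Nat.cast_le.2 (le_max_right _ _)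
    have e1 : k (max n m) x = 1 := by
      simp only [k]
      rw [min_eq_left (by linarith), max_eq_right zero_le_one]
    simp only [indicator_of_mem hx, g]
    rw [e1, mul_one, min_eq_left]
    exact hn.le.trans (mul_le_mul_of_nonneg_right h1 hpos.le)

end Cutoff

/-! ### The Poincaré inequality for continuous fluxes -/

section Poincare

variable {p : ℝ} {D : EReal} {u v : ℝ → ℝ}

namespace Weights

variable (H : Weights p D u v)
include H

lemma tail_ofReal_le {w : ℝ → ℝ} (hw : Continuous w) (hc : HasCompactSupport w) :
    ∃ K ≠ ∞, ∃ R : ℝ, (∀ x, R ≤ x → w x = 0) ∧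
      (∀ x, tail (densityMeasure D (vhat p v)) (fun s => ENNReal.ofReal (w s)) x ≤ K) ∧
      ∀ x, R ≤ x → tail (densityMeasure D (vhat p v)) (fun s => ENNReal.ofReal (w s)) x = 0 := by
  set ν := densityMeasure D (vhat p v)
  obtain ⟨B, hB⟩ := hc.exists_bound_of_continuous hw
  obtain ⟨R, hR⟩ : ∃ R : ℝ, ∀ x, R ≤ x → w x = 0 := by
    obtain ⟨R, hR⟩ := hc.isCompact.isBounded.bddAbove
    refine ⟨R + 1, fun x hx => ?_⟩
    by_contra h
    have := hR (subset_tsupport w h)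
    linarith
  refine ⟨ENNReal.ofReal B * ν (Iio R), ENNReal.mul_ne_top ENNReal.ofReal_ne_top
    (densityMeasure_Iio_ne_top H.hvi H.hD R), R, hR, fun x => ?_, fun x hx => ?_⟩
  · calc tail ν (fun s => ENNReal.ofReal (w s)) x ≤ ∫⁻ s, ENNReal.ofReal (w s) ∂ν :=
          setLIntegral_le_lintegral _ _
      _ ≤ ∫⁻ s, (Iio R).indicator (fun _ => ENNReal.ofReal B) s ∂ν := by
          refine lintegral_mono fun s => ?_
          by_cases hs : s < R
          · rw [indicator_of_mem (show s ∈ Iio R from hs)]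
            exact ENNReal.ofReal_le_ofReal ((le_abs_self _).trans (hB s))
          · rw [hR s (not_lt.1 hs)]; simp
      _ = _ := by rw [lintegral_indicator measurableSet_Iio]; simp
  · refine (setLIntegral_congr_fun measurableSet_Ioi fun s hs => ?_).trans (lintegral_zero)
    rw [hR s (hx.trans (le_of_lt hs)), ENNReal.ofReal_zero]

lemma tail_eq_zero_of_le {d : ℝ} (hd : D = d) (w : ℝ → ℝ≥0∞) :
    tail (densityMeasure D (vhat p v)) w d = 0 := by
  rw [tail, setLIntegral_densityMeasure (measurable_vhat H.hvm) measurableSet_Ioi]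
  have : Ioi d ∩ openI D = ∅ := by
    rw [eq_empty_iff_forall_notMem]
    rintro x ⟨h1, h2⟩
    have h3 := h2.2
    rw [hd, EReal.coe_lt_coe_iff] at h3
    exact lt_asymm h1 h3
  rw [this]; simp

lemma lintegral_tail_rpow_ne_top {w : ℝ → ℝ} (hw : Continuous w) (hc : HasCompactSupport w) :
    ∫⁻ x, tail (densityMeasure D (vhat p v)) (fun s => ENNReal.ofReal (w s)) x ^ p
      ∂densityMeasure D u ≠ ∞ := by
  obtain ⟨K, hK, R, -, hle, h0⟩ := H.tail_ofReal_le hw hc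
  have hp0 : 0 < p := by linarith [H.hp]
  have : ∫⁻ x, (Iio R).indicator (fun _ => K ^ p) x ∂densityMeasure D u ≠ ∞ := by
    rw [lintegral_indicator measurableSet_Iio, setLIntegral_const]
    exact ENNReal.mul_ne_top (ENNReal.rpow_ne_top_of_nonneg hp0.le hK)
      (densityMeasure_Iio_ne_top H.hui H.hD R)
  refine ne_top_of_le_ne_top this (lintegral_mono fun x => ?_)
  by_cases hx : x < R
  · rw [indicator_of_mem (show x ∈ Iio R from hx)]
    exact ENNReal.rpow_le_rpow (hle x) hp0.le
  · rw [h0 x (not_lt.1 hx), ENNReal.zero_rpow_of_pos hp0]; exact zero_le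

/-- The tail of `w` is itself an admissible function: its flux is `-w`, it vanishes beyond the
support of `w`, and it vanishes at a finite `D` because nothing of the measure lies beyond. -/
lemma lam_le_of_normalized {w : ℝ → ℝ} (hw : Continuous w) (hc : HasCompactSupport w)
    (hw0 : ∀ x, 0 ≤ w x)
    (h1 : ∫⁻ x, tail (densityMeasure D (vhat p v)) (fun s => ENNReal.ofReal (w s)) x ^ p
      ∂densityMeasure D u = 1) :
    lam p u v D ≤ ∫⁻ s, ENNReal.ofReal (w s) ^ p ∂densityMeasure D (vhat p v) := by
  obtain ⟨K, hK, R, hR, hle, h0⟩ := H.tail_ofReal_le hw hc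
  set ν := densityMeasure D (vhat p v) with hν
  have ht : ∀ x, tail ν (fun s => ENNReal.ofReal (w s)) x ≠ ∞ := fun x =>
    ne_top_of_le_ne_top hK (hle x)
  set h : ℝ → ℝ := fun x => (tail ν (fun s => ENNReal.ofReal (w s)) x).toReal with hh
  have hfc : FluxContinuousOn p v h (openI D) :=
    fluxContinuousOn_tail H.hvi H.hvm H.hv hw.measurable hw0 ht isOpen_openI subset_rfl
      ⟨fun x hx y hy => Icc_subset_openI hx hy⟩ hw.continuousOn
  have hfl : ∀ x ∈ openI D, flux p v h x = -w x := fun x hx =>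
    flux_tail H.hvi H.hvm H.hv hw.measurable hw0 ht hx hw.continuousAt
  have hclosed : IsClosed (closedI D) :=
    isClosed_Ici.inter (isClosed_Iic.preimage continuous_coe_real_ereal)
  have hmem : h ∈ CK p v D := by
    refine ⟨(continuous_tail_ofReal hw.measurable.ennreal_ofReal ht).continuousOn, hfc,
      closedI D ∩ Icc 0 R, isCompact_Icc.inter_left hclosed, inter_subset_left, fun x hx hxk => ?_⟩
    have : R ≤ x := by
      by_contra! hxR
      exact hxk ⟨hx, hx.1, hxR.le⟩
    simp [hh, h0 x this]
  have hmu : muPow p u D h = 1 := by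
    rw [muPow_eq H.hum h (by linarith [H.hp]), ← h1]
    refine lintegral_congr fun x => ?_
    rw [hh, abs_of_nonneg ENNReal.toReal_nonneg, ENNReal.ofReal_toReal (ht x)]
  have hend : ∀ d : ℝ, D = (d : EReal) → h d = 0 := fun d hd => by
    simp only [hh, hν, H.tail_eq_zero_of_le hd, ENNReal.toReal_zero]
  refine (iInf₂_le h ⟨hmem, hmu, hend⟩).trans ?_
  rw [energy_eq H.hp H.hvi H.hvm H.hv H.hD hfc]
  refine lintegral_mono_ae ?_
  filter_upwards [ae_densityMeasure_mem] with x hx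
  rw [hfl x hx, abs_neg, abs_of_nonneg (hw0 x)]

/-- Both sides are homogeneous of degree `p`, so `w` is rescaled by `κ = m ^ (-1/p)` to reach the
normalized case. A zero `m` is trivial. -/
lemma poincare_of_continuous {w : ℝ → ℝ} (hw : Continuous w) (hc : HasCompactSupport w)
    (hw0 : ∀ x, 0 ≤ w x) :
    lam p u v D * ∫⁻ x, tail (densityMeasure D (vhat p v)) (fun s => ENNReal.ofReal (w s)) x ^ p
      ∂densityMeasure D u ≤ ∫⁻ s, ENNReal.ofReal (w s) ^ p ∂densityMeasure D (vhat p v) := by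
  have hp0 : 0 < p := by linarith [H.hp]
  have hmt := H.lintegral_tail_rpow_ne_top hw hc
  set ν := densityMeasure D (vhat p v)
  set m := ∫⁻ x, tail ν (fun s => ENNReal.ofReal (w s)) x ^ p ∂densityMeasure D u with hm
  rcases eq_or_ne m 0 with h0 | h0
  · rw [h0, mul_zero]; exact zero_le
  have hmpos : 0 < m.toReal := ENNReal.toReal_pos h0 hmt
  set κ := m.toReal ^ (-p⁻¹) with hκ
  have hκ0 : 0 ≤ κ := by positivity
  have hκp : ENNReal.ofReal κ ^ p = m⁻¹ := by
    rw [ENNReal.ofReal_rpow_of_nonneg hκ0 hp0.le, hκ, ← Real.rpow_mul hmpos.le, neg_mul,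
      inv_mul_cancel₀ hp0.ne', Real.rpow_neg_one, ENNReal.ofReal_inv_of_pos hmpos,
      ENNReal.ofReal_toReal hmt]
  have hscale : (fun s => ENNReal.ofReal (κ * w s)) =
      fun s => ENNReal.ofReal κ * ENNReal.ofReal (w s) := by
    funext s; exact ENNReal.ofReal_mul hκ0
  have key := H.lam_le_of_normalized (w := fun s => κ * w s) (continuous_const.mul hw)
    hc.mul_left (fun x => mul_nonneg hκ0 (hw0 x)) (by
      rw [hscale]
      simp only [tail_const_mul _ hw.measurable.ennreal_ofReal,
        ENNReal.mul_rpow_of_nonneg _ _ hp0.le]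
      rw [lintegral_const_mul _ (measurable_tail.pow_const p), hκp]
      exact ENNReal.inv_mul_cancel h0 hmt)
  simp only [ENNReal.ofReal_mul hκ0, ENNReal.mul_rpow_of_nonneg _ _ hp0.le] at key
  rw [lintegral_const_mul _ (hw.measurable.ennreal_ofReal.pow_const p), hκp] at key
  calc lam p u v D * m ≤ (m⁻¹ * ∫⁻ s, ENNReal.ofReal (w s) ^ p ∂ν) * m := by gcongr
    _ = _ := by rw [mul_right_comm, ENNReal.inv_mul_cancel h0 hmt, one_mul]

end Weights

end Poincare

/-! ### Measurability, positivity and arithmetic in `[0, ∞]` -/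

section Auxiliary

variable {D : EReal} {d : ℝ → ℝ}

lemma measurable_indicator_ofReal {S : Set ℝ} (hS : MeasurableSet S) {f : ℝ → ℝ}
    (hf : ContinuousOn f S) : Measurable (S.indicator fun x => ENNReal.ofReal (f x)) := by
  classical
  have h : Measurable (S.piecewise f 0) := hf.measurable_piecewise continuousOn_const hS
  have e : (S.indicator fun x => ENNReal.ofReal (f x)) =
      fun x => ENNReal.ofReal (S.piecewise f 0 x) := by
    funext x
    by_cases hx : x ∈ S <;> simp [hx]
  rw [e]
  exact h.ennreal_ofReal

lemma setLIntegral_ne_zero (hdm : Measurable d) (hd : ∀ᵐ x ∂volume.restrict (openI D), 0 < d x)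
    {A U : Set ℝ} (hA : MeasurableSet A) (hU : IsOpen U) (hUA : U ⊆ A)
    (hne : (U ∩ openI D).Nonempty) {G : ℝ → ℝ≥0∞} (hG : Measurable G)
    (hpos : ∀ x ∈ U ∩ openI D, G x ≠ 0) : ∫⁻ x in A, G x ∂densityMeasure D d ≠ 0 := by
  intro h
  refine densityMeasure_ne_zero hdm hd hU hne ?_
  rw [lintegral_eq_zero_iff hG] at h
  have h' := (ae_restrict_iff' hA).1 h
  rw [measure_eq_zero_iff_ae_notMem]
  filter_upwards [h', ae_densityMeasure_mem] with x h1 h2 hx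
  exact hpos x ⟨hx, h2⟩ (h1 (hUA hx))

lemma densityMeasure_restrict_openI :
    (densityMeasure D d).restrict (openI D) = densityMeasure D d :=
  Measure.restrict_eq_self_of_ae_mem ae_densityMeasure_mem

lemma openI_ne_univ {S : Set ℝ} (hS : S ⊆ openI D) : S ≠ univ := fun h =>
  lt_irrefl _ (hS (h ▸ mem_univ (0 : ℝ))).1

lemma inv_div_le_iff {a b C : ℝ≥0∞} (hb0 : b ≠ 0) (hbt : b ≠ ∞) (hC0 : C ≠ 0) (hCt : C ≠ ∞) :
    (a / b)⁻¹ ≤ C ↔ b ≤ C * a := by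
  rw [ENNReal.inv_div (Or.inl hbt) (Or.inl hb0),
    ENNReal.div_le_iff_le_mul (Or.inr hCt) (Or.inr hC0)]

lemma le_inv_div_iff {a b C : ℝ≥0∞} (hb0 : b ≠ 0) (hbt : b ≠ ∞) :
    C ≤ (a / b)⁻¹ ↔ C * a ≤ b := by
  rw [ENNReal.inv_div (Or.inl hbt) (Or.inl hb0),
    ENNReal.le_div_iff_mul_le (Or.inr hb0) (Or.inr hbt)]

lemma rpow_le_mul_rpow {a b C : ℝ≥0∞} {r : ℝ} (hr : 0 < r) (h : a ≤ C ^ r⁻¹ * b) :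
    a ^ r ≤ C * b ^ r := by
  refine (ENNReal.rpow_le_rpow h hr.le).trans ?_
  rw [ENNReal.mul_rpow_of_nonneg _ _ hr.le, ← ENNReal.rpow_mul, inv_mul_cancel₀ hr.ne',
    ENNReal.rpow_one]

lemma le_rpow_inv_mul {a b C : ℝ≥0∞} {r : ℝ} (hr : 0 < r) (h : a ^ r ≤ C * b ^ r) :
    a ≤ C ^ r⁻¹ * b := by
  have := ENNReal.rpow_le_rpow h (inv_pos.2 hr).le
  rwa [ENNReal.mul_rpow_of_nonneg _ _ (inv_pos.2 hr).le, ENNReal.rpow_rpow_inv hr.ne',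
    ENNReal.rpow_rpow_inv hr.ne'] at this

lemma mul_rpow_le_of_le {a b C : ℝ≥0∞} {r : ℝ} (hr : 0 < r) (h : C ^ r⁻¹ * a ≤ b) :
    C * a ^ r ≤ b ^ r := by
  refine le_trans ?_ (ENNReal.rpow_le_rpow h hr.le)
  rw [ENNReal.mul_rpow_of_nonneg _ _ hr.le, ← ENNReal.rpow_mul, inv_mul_cancel₀ hr.ne',
    ENNReal.rpow_one]

lemma continuous_mass {μ : Measure ℝ} [NullSingletonClass μ] {r : ℝ} {f : ℝ → ℝ≥0∞}
    (hfm : Measurable f) (hf : ∀ s, mass μ r f s ≠ ∞) :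
    Continuous fun s => (mass μ r f s).toReal :=
  continuous_iff_continuousAt.2 fun s =>
    (continuousOn_mass hfm (hf (s + 1))).continuousAt (Iic_mem_nhds (by linarith))

end Auxiliary

/-! ### Extended Poincaré inequality, norm bound and test functions -/

namespace Weights

variable {p : ℝ} {D : EReal} {u v : ℝ → ℝ} (H : Weights p D u v)
include H

lemma r_pos : 0 < p - 1 := by linarith [H.hp]

lemma p_pos : 0 < p := by linarith [H.hp]

lemma truncations {S : Set ℝ} (hS : IsOpen S) (hSD : S ⊆ openI D) {w : ℝ → ℝ}
    (hw : ContinuousOn w S) (hw0 : ∀ x ∈ S, 0 ≤ w x) :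
    ∃ W : ℕ → ℝ → ℝ≥0∞, (∀ n, Measurable (W n)) ∧ Monotone W ∧
      (∀ n, W n ≤ S.indicator fun x => ENNReal.ofReal (w x)) ∧
      (∀ s, ⨆ n, W n s = S.indicator (fun x => ENNReal.ofReal (w x)) s) ∧
      (∀ n, lam p u v D * ∫⁻ x, tail (densityMeasure D (vhat p v)) (W n) x ^ p
        ∂densityMeasure D u ≤ ∫⁻ s, W n s ^ p ∂densityMeasure D (vhat p v)) ∧
      ∀ n, ∫⁻ x, tail (densityMeasure D (vhat p v)) (W n) x ^ p ∂densityMeasure D u ≠ ∞ := by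
  obtain ⟨W, hc, hcs, h0, hm, hoff, hle, hex⟩ := exists_cutoff hS (openI_ne_univ hSD) hw hw0
  have hle' : ∀ n, (fun x => ENNReal.ofReal (W n x)) ≤
      S.indicator fun x => ENNReal.ofReal (w x) := fun n x => by
    by_cases hx : x ∈ S
    · rw [indicator_of_mem hx]; exact ENNReal.ofReal_le_ofReal (hle n x hx)
    · dsimp only
      rw [indicator_of_notMem hx, hoff n x hx, ENNReal.ofReal_zero]
  refine ⟨fun n x => ENNReal.ofReal (W n x), fun n => (hc n).measurable.ennreal_ofReal,
    fun m n h x => ENNReal.ofReal_le_ofReal (hm h x), hle', fun s => ?_,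
    fun n => H.poincare_of_continuous (hc n) (hcs n) (h0 n),
    fun n => H.lintegral_tail_rpow_ne_top (hc n) (hcs n)⟩
  refine le_antisymm (iSup_le fun n => hle' n s) ?_
  by_cases hs : s ∈ S
  · obtain ⟨n, hn⟩ := hex s hs
    rw [indicator_of_mem hs, ← hn]
    exact le_iSup (fun n => ENNReal.ofReal (W n s)) n
  · rw [indicator_of_notMem hs]; exact zero_le

/-- The Poincaré inequality for fluxes that are continuous on an open set and vanish off it. -/
lemma poincare_of_continuousOn {S : Set ℝ} (hS : IsOpen S) (hSD : S ⊆ openI D) {w : ℝ → ℝ}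
    (hw : ContinuousOn w S) (hw0 : ∀ x ∈ S, 0 ≤ w x) :
    lam p u v D * ∫⁻ x, tail (densityMeasure D (vhat p v))
        (S.indicator fun s => ENNReal.ofReal (w s)) x ^ p ∂densityMeasure D u ≤
      ∫⁻ s, S.indicator (fun s => ENNReal.ofReal (w s)) s ^ p ∂densityMeasure D (vhat p v) := by
  obtain ⟨W, hWm, hmono, hle, hsup, hP, -⟩ := H.truncations hS hSD hw hw0
  have e : (S.indicator fun s => ENNReal.ofReal (w s)) = fun s => ⨆ n, W n s :=
    funext fun s => (hsup s).symm
  have e2 : ∫⁻ x, tail (densityMeasure D (vhat p v)) (fun s => ⨆ n, W n s) x ^ p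
      ∂densityMeasure D u = ⨆ n, ∫⁻ x, tail (densityMeasure D (vhat p v)) (W n) x ^ p
      ∂densityMeasure D u := by
    simp only [tail_iSup hWm hmono, iSup_rpow H.p_pos]
    exact lintegral_iSup (fun n => measurable_tail.pow_const _)
      fun m n h x => ENNReal.rpow_le_rpow (tail_mono (hmono h) x) H.p_pos.le
  nth_rewrite 1 [e]
  rw [e2, ENNReal.mul_iSup]
  exact iSup_le fun n => (hP n).trans
    (lintegral_mono fun s => ENNReal.rpow_le_rpow (hle n s) H.p_pos.le)

/-- `f ^ (p - 1) ≤ 1 + f ^ p`, and `μ` is finite on half-lines. -/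
lemma mass_ne_top {f : ℝ → ℝ≥0∞} (hf : ∫⁻ x, f x ^ p ∂densityMeasure D u ≠ ∞) (s : ℝ) :
    mass (densityMeasure D u) (p - 1) f s ≠ ∞ := by
  have h1 : ∀ t, f t ^ (p - 1) ≤ 1 + f t ^ p := fun t => by
    rcases le_total (f t) 1 with h | h
    · exact (ENNReal.rpow_le_one h H.r_pos.le).trans le_self_add
    · exact (ENNReal.rpow_le_rpow_of_exponent_le h (by linarith)).trans le_add_self
  refine ne_top_of_le_ne_top ?_ (lintegral_mono h1)
  rw [lintegral_add_left measurable_const, setLIntegral_const, one_mul]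
  exact ENNReal.add_ne_top.2 ⟨densityMeasure_Iio_ne_top H.hui H.hD s,
    ne_top_of_le_ne_top hf (setLIntegral_le_lintegral _ _)⟩

/-- `norm_tail_mass_le` for cutoffs of `(mass f) ^ (1/(p-1))`, which is continuous. The set `S` is
all of `(0, D)` for supersolutions and the support of the function for the dual bounds. -/
lemma norm_tail_le {f : ℝ → ℝ≥0∞} (hfm : Measurable f)
    (hf : ∫⁻ x, f x ^ p ∂densityMeasure D u ≠ ∞) {S : Set ℝ} (hS : IsOpen S)
    (hSD : S ⊆ openI D) :
    lam p u v D * (∫⁻ x, tail ((densityMeasure D (vhat p v)).restrict S)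
        (fun s => mass (densityMeasure D u) (p - 1) f s ^ (p - 1)⁻¹) x ^ p
          ∂densityMeasure D u) ^ ((p - 1) / p) ≤
      (∫⁻ x, f x ^ p ∂densityMeasure D u) ^ ((p - 1) / p) := by
  have hri : 0 < (p - 1)⁻¹ := inv_pos.2 H.r_pos
  have hmt := H.mass_ne_top hf
  have hcont : Continuous fun s =>
      (mass (densityMeasure D u) (p - 1) f s).toReal ^ (p - 1)⁻¹ :=
    (continuous_mass hfm hmt).rpow_const fun _ => Or.inr hri.le
  have he : ∀ s, ENNReal.ofReal ((mass (densityMeasure D u) (p - 1) f s).toReal ^ (p - 1)⁻¹) =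
      mass (densityMeasure D u) (p - 1) f s ^ (p - 1)⁻¹ := fun s => by
    rw [← ENNReal.ofReal_rpow_of_nonneg ENNReal.toReal_nonneg hri.le, ENNReal.ofReal_toReal (hmt s)]
  obtain ⟨W, hWm, hmono, hle, hsup, hP, hfin⟩ := H.truncations hS hSD hcont.continuousOn
    fun x _ => by positivity
  simp only [he] at hle hsup
  have hp1 : p = p - 1 + 1 := by ring
  have key := norm_tail_mass_le (μ := densityMeasure D u) (ν := densityMeasure D (vhat p v))
    H.r_pos hfm hWm hmono (l := lam p u v D)
    (fun n => .of_forall fun s => (hle n s).trans (indicator_le_self' (fun _ _ => zero_le) s))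
  simp only [← hp1, hsup] at key
  rw [tail_restrict hS.measurableSet]
  exact key hP hfin

lemma ofReal_abs_le_tail {g : ℝ → ℝ} (hg : g ∈ CK p v D)
    (hgD : ∀ d : ℝ, D = (d : EReal) → g d = 0) {x : ℝ} (hx : x ∈ openI D) :
    ENNReal.ofReal |g x| ≤ tail (densityMeasure D (vhat p v))
      ((openI D).indicator fun s => ENNReal.ofReal |flux p v g s|) x := by
  obtain ⟨hgc, hgf, k, hk, -, hk0⟩ := hg
  set ν := densityMeasure D (vhat p v) with hν
  set w := (openI D).indicator fun s => ENNReal.ofReal |flux p v g s|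
  have hstep : ∀ y ∈ openI D, x < y → ENNReal.ofReal |g y - g x| ≤ tail ν w x := by
    intro y hy hxy
    have hsub : Ioc x y ⊆ openI D := Ioc_subset_Icc_self.trans (Icc_subset_openI hx hy)
    rw [hgf.2 x hx y hy, intervalIntegral.integral_of_le hxy.le, ← Real.enorm_eq_ofReal_abs]
    refine (enorm_integral_le_lintegral_enorm _).trans ?_
    have hpos : ∀ᵐ t ∂volume.restrict (Ioc x y), 0 < vhat p v t :=
      ae_mono (Measure.restrict_mono hsub le_rfl) (vhat_pos H.hv)
    calc ∫⁻ t in Ioc x y, ‖vhat p v t * flux p v g t‖ₑ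
        = ∫⁻ t in Ioc x y, ENNReal.ofReal (vhat p v t) * w t := by
          refine lintegral_congr_ae ?_
          filter_upwards [hpos, ae_restrict_mem measurableSet_Ioc] with t h1 h2
          rw [Real.enorm_eq_ofReal_abs, abs_mul, abs_of_pos h1, ENNReal.ofReal_mul h1.le]
          simp only [w, indicator_of_mem (hsub h2)]
      _ = ∫⁻ t in Ioc x y, w t ∂ν := by
          rw [setLIntegral_densityMeasure (measurable_vhat H.hvm) measurableSet_Ioc,
            inter_eq_left.2 hsub]
      _ ≤ _ := lintegral_mono_set Ioc_subset_Ioi_self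
  -- The right boundary condition enters here: `g` vanishes past its compact support if `D = ∞`, and
  -- tends to `g D = 0` otherwise.
  have hsmall : ∀ ε > 0, ∃ y ∈ openI D, x < y ∧ |g y| ≤ ε := by
    intro ε hε
    induction D with
    | bot => exact absurd H.hD (by simp)
    | top =>
      obtain ⟨R, hR⟩ := hk.isBounded.bddAbove
      have hy : max x R + 1 ∈ openI ⊤ :=
        ⟨by linarith [hx.1, le_max_left x R], EReal.coe_lt_top _⟩
      refine ⟨_, hy, by linarith [le_max_left x R], ?_⟩
      rw [hk0 _ (openI_subset_closedI hy) fun h => ?_, abs_zero]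
      · exact hε.le
      · linarith [hR h, le_max_right x R]
    | coe d =>
      have hxd : x < d := by exact_mod_cast hx.2
      have hd : d ∈ closedI (d : EReal) := ⟨(hx.1.trans hxd).le, le_rfl⟩
      have ht : Tendsto g (𝓝[<] d) (𝓝 0) := by
        rw [← hgD d rfl]
        refine (hgc d hd).mono_left ?_
        rw [← nhdsWithin_Ioo_eq_nhdsLT hxd]
        exact nhdsWithin_mono _ fun t ht =>
          openI_subset_closedI (Ioo_subset_openI (openI_subset_closedI hx) hd ht)
      have h1 := (ht.eventually (Metric.ball_mem_nhds (0:ℝ) hε)).and (Ioo_mem_nhdsLT hxd)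
      obtain ⟨y, hy1, hy2⟩ := h1.exists
      refine ⟨y, Ioo_subset_openI (openI_subset_closedI hx) hd hy2, hy2.1, ?_⟩
      have : dist (g y) 0 < ε := hy1
      rw [Real.dist_eq, sub_zero] at this
      exact this.le
  refine ENNReal.le_of_forall_pos_le_add fun ε hε _ => ?_
  obtain ⟨y, hy, hxy, hgy⟩ := hsmall ε (by exact_mod_cast hε)
  have h1 : |g x| ≤ |g y - g x| + |g y| := by
    have := abs_sub_abs_le_abs_sub (g x) (g y)
    rw [abs_sub_comm] at this
    linarith
  calc ENNReal.ofReal |g x| ≤ ENNReal.ofReal (|g y - g x| + |g y|) := ENNReal.ofReal_le_ofReal h1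
    _ ≤ ENNReal.ofReal |g y - g x| + ENNReal.ofReal |g y| := ENNReal.ofReal_add_le
    _ ≤ _ := by
      refine add_le_add (hstep y hy hxy) ?_
      calc ENNReal.ofReal |g y| ≤ ENNReal.ofReal ε := ENNReal.ofReal_le_ofReal hgy
        _ = ε := ENNReal.ofReal_coe_nnreal

/-- Replacing `g` by the tail of the modulus of its flux keeps the energy and can only increase the
`L^p(μ)` norm; this reduces signed test functions to non-negative fluxes. -/
lemma test_estimates {g : ℝ → ℝ} (hg : g ∈ CK p v D) (hg1 : muPow p u D g = 1)
    (hgD : ∀ d : ℝ, D = (d : EReal) → g d = 0) :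
    ∃ w : ℝ → ℝ≥0∞, Measurable w ∧ (∀ x ∉ openI D, w x = 0) ∧
      energy p v D g = ∫⁻ s, w s ^ p ∂densityMeasure D (vhat p v) ∧
      1 ≤ ∫⁻ x, tail (densityMeasure D (vhat p v)) w x ^ p ∂densityMeasure D u := by
  refine ⟨(openI D).indicator fun s => ENNReal.ofReal |flux p v g s|,
    measurable_indicator_ofReal measurableSet_openI hg.2.1.1.abs,
    fun x hx => indicator_of_notMem hx _, ?_, ?_⟩
  · rw [energy_eq H.hp H.hvi H.hvm H.hv H.hD hg.2.1]
    refine lintegral_congr_ae ?_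
    filter_upwards [ae_densityMeasure_mem] with x hx
    rw [indicator_of_mem hx]
  · rw [← hg1, muPow_eq H.hum g H.p_pos.le]
    refine lintegral_mono_ae ?_
    filter_upwards [ae_densityMeasure_mem] with x hx
    exact ENNReal.rpow_le_rpow (H.ofReal_abs_le_tail hg hgD hx) H.p_pos.le

/-- A constant larger than `λ_p` violates the Poincaré inequality on a compact subinterval. -/
lemma exists_interval_of_lam_lt {c : ℝ≥0∞} (hc : lam p u v D < c) :
    ∃ a ∈ openI D, ∃ b ∈ openI D, a < b ∧ ∃ w : ℝ → ℝ≥0∞, Measurable w ∧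
      ∀ a' ≤ a, ∫⁻ s, w s ^ p ∂(densityMeasure D (vhat p v)).restrict (Ioo a' b) <
        c * ∫⁻ x, tail ((densityMeasure D (vhat p v)).restrict (Ioo a' b)) w x ^ p
          ∂densityMeasure D u := by
  obtain ⟨g, ⟨hg, hg1, hgD⟩, hgc⟩ := by simpa only [lam, iInf_lt_iff, exists_prop] using hc
  obtain ⟨w, hwm, hw0, hwe, hw1⟩ := H.test_estimates hg hg1 hgD
  obtain ⟨a, b, ha, hb, hab, hcov⟩ := exists_exhaustion H.hD
  set ν := densityMeasure D (vhat p v)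
  have hJm : Monotone fun n => (Ioo (a n) (b n)).indicator w := fun m n h =>
    indicator_le_indicator_of_subset (Ioo_subset_Ioo (ha h) (hb h)) fun _ => zero_le
  have hJ : ∀ n, Measurable ((Ioo (a n) (b n)).indicator w) := fun n =>
    hwm.indicator measurableSet_Ioo
  have hsup : w = fun s => ⨆ n, (Ioo (a n) (b n)).indicator w s := by
    funext s
    refine le_antisymm ?_ (iSup_le fun n => indicator_le_self' (fun _ _ => zero_le) s)
    by_cases hs : s ∈ openI D
    · obtain ⟨n, hn⟩ := hcov s hs
      refine le_trans ?_ (le_iSup _ n)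
      rw [indicator_of_mem (show s ∈ Ioo (a n) (b n) from hn)]
    · rw [hw0 s hs]; exact zero_le
  have e2 : ∫⁻ x, tail ν w x ^ p ∂densityMeasure D u =
      ⨆ n, ∫⁻ x, tail ν ((Ioo (a n) (b n)).indicator w) x ^ p ∂densityMeasure D u := by
    nth_rewrite 1 [hsup]
    simp only [tail_iSup hJ hJm, iSup_rpow H.p_pos]
    exact lintegral_iSup (fun n => measurable_tail.pow_const _)
      fun m n h x => ENNReal.rpow_le_rpow (tail_mono (hJm h) x) H.p_pos.le
  have hlt : energy p v D g < c * ∫⁻ x, tail ν w x ^ p ∂densityMeasure D u :=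
    hgc.trans_le (by simpa using mul_le_mul_right hw1 c)
  -- The strict inequality on the whole interval survives on some member of the exhaustion, by
  -- monotone convergence.
  rw [e2, ENNReal.mul_iSup, lt_iSup_iff] at hlt
  obtain ⟨n, hn⟩ := hlt
  refine ⟨a n, (hab n).1, b n, (hab n).2.1, (hab n).2.2, w, hwm, fun a' ha' => ?_⟩
  -- Extending the interval to the left only increases the right-hand side, while the left-hand side
  -- stays below the energy of `g`. The choice `a' = 0` serves the single integral operator.
  calc ∫⁻ s, w s ^ p ∂ν.restrict (Ioo a' (b n)) ≤ ∫⁻ s, w s ^ p ∂ν :=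
        setLIntegral_le_lintegral _ _
    _ = energy p v D g := hwe.symm
    _ < _ := hn
    _ ≤ _ := by
      rw [tail_restrict measurableSet_Ioo]
      refine mul_le_mul_right (lintegral_mono fun x => ENNReal.rpow_le_rpow
        (tail_mono ?_ x) H.p_pos.le) c
      exact indicator_le_indicator_of_subset (Ioo_subset_Ioo_left ha') fun _ => zero_le

lemma mass_ne_top_of_continuousOn {f : ℝ → ℝ} {F : ℝ → ℝ≥0∞} {s : ℝ}
    (hf : ContinuousOn f (Icc 0 s)) (hF : ∀ x ∈ Ioo 0 s, F x = ENNReal.ofReal (f x)) :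
    mass (densityMeasure D u) (p - 1) F s ≠ ∞ := by
  obtain ⟨B, hB⟩ := isCompact_Icc.exists_bound_of_continuousOn hf
  have h1 : mass (densityMeasure D u) (p - 1) F s ≤
      ∫⁻ t in Iio s, ENNReal.ofReal B ^ (p - 1) ∂densityMeasure D u := by
    refine lintegral_mono_ae ?_
    filter_upwards [ae_restrict_mem measurableSet_Iio, ae_restrict_of_ae ae_densityMeasure_mem]
      with t h1 h2
    have htm : t ∈ Ioo 0 s := ⟨h2.1, h1⟩
    rw [hF t htm]
    exact ENNReal.rpow_le_rpow (ENNReal.ofReal_le_ofReal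
      ((le_abs_self _).trans (hB t (Ioo_subset_Icc_self htm)))) H.r_pos.le
  refine ne_top_of_le_ne_top ?_ h1
  rw [setLIntegral_const]
  exact ENNReal.mul_ne_top (ENNReal.rpow_ne_top_of_nonneg H.r_pos.le ENNReal.ofReal_ne_top)
    (densityMeasure_Iio_ne_top H.hui H.hD s)

lemma lintegral_rpow_ne_top_of_continuousOn {f : ℝ → ℝ} {F : ℝ → ℝ≥0∞} {b : ℝ}
    (hf : ContinuousOn f (Icc 0 b)) (hF : ∀ x ∈ Ioo 0 b, F x = ENNReal.ofReal (f x))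
    (hF0 : ∀ x ∈ openI D, b ≤ x → F x = 0) : ∫⁻ x, F x ^ p ∂densityMeasure D u ≠ ∞ := by
  obtain ⟨B, hB⟩ := isCompact_Icc.exists_bound_of_continuousOn hf
  have h1 : ∫⁻ x, F x ^ p ∂densityMeasure D u ≤
      ∫⁻ t in Iio b, ENNReal.ofReal B ^ p ∂densityMeasure D u := by
    rw [← lintegral_indicator measurableSet_Iio]
    refine lintegral_mono_ae ?_
    filter_upwards [ae_densityMeasure_mem] with t h2
    by_cases htb : t < b
    · have htm : t ∈ Ioo 0 b := ⟨h2.1, htb⟩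
      rw [hF t htm, indicator_of_mem (show t ∈ Iio b from htb)]
      exact ENNReal.rpow_le_rpow (ENNReal.ofReal_le_ofReal
        ((le_abs_self _).trans (hB t (Ioo_subset_Icc_self htm)))) H.p_pos.le
    · rw [hF0 t h2 (not_lt.1 htb), ENNReal.zero_rpow_of_pos H.p_pos]; exact zero_le
  refine ne_top_of_le_ne_top ?_ h1
  rw [setLIntegral_const]
  exact ENNReal.mul_ne_top (ENNReal.rpow_ne_top_of_nonneg H.p_pos.le ENNReal.ofReal_ne_top)
    (densityMeasure_Iio_ne_top H.hui H.hD b)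

lemma mass_ne_zero {F : ℝ → ℝ≥0∞} (hFm : Measurable F) {a b s : ℝ} (hab : a < b) (ha : 0 ≤ a)
    (hb : b ≤ s) (hbD : (b : EReal) ≤ D) (hF : ∀ x ∈ Ioo a b, F x ≠ 0) :
    mass (densityMeasure D u) (p - 1) F s ≠ 0 := by
  have hmid : (a + b) / 2 ∈ Ioo a b := ⟨by linarith, by linarith⟩
  refine setLIntegral_ne_zero H.hum H.hu measurableSet_Iio (isOpen_Ioo (a := a) (b := b))
    (fun x hx => hx.2.trans_le hb) ⟨_, hmid, ha.trans_lt hmid.1, ?_⟩ (hFm.pow_const _) fun x hx => ?_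
  · exact (EReal.coe_lt_coe_iff.2 hmid.2).trans_le hbD
  · rw [ne_eq, ENNReal.rpow_eq_zero_iff_of_pos H.r_pos]
    exact hF x hx.1

/-! ### The supremum formula -/

/-- With `c` the infimum of `II(f)⁻¹`, `f` is a supersolution for `c`; the resulting Hardy
inequality is applied to the flux of each admissible `g`. -/
lemma iSup_FI_le_lam :
    ⨆ f ∈ FI p v D, ⨅ x ∈ openI D, (opII p u v D f x)⁻¹ ≤ lam p u v D := by
  refine iSup₂_le fun f hf => ?_
  obtain ⟨hfc, -, hfpos, -⟩ := hf
  set c := ⨅ x ∈ openI D, (opII p u v D f x)⁻¹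
  set F := (openI D).indicator fun x => ENNReal.ofReal (f x) with hFdef
  have hF : ∀ x ∈ openI D, F x = ENNReal.ofReal (f x) := fun x hx => indicator_of_mem hx _
  have hFm : Measurable F :=
    measurable_indicator_ofReal measurableSet_openI (hfc.mono openI_subset_closedI)
  have hF0 : ∀ x ∈ openI D, F x ≠ 0 := fun x hx => by
    rw [hF x hx]; exact (ENNReal.ofReal_pos.2 (hfpos x hx)).ne'
  have hFt : ∀ x ∈ openI D, F x ≠ ∞ := fun x hx => by
    rw [hF x hx]; exact ENNReal.ofReal_ne_top
  have hc : ∀ x ∈ openI D, c * tail (densityMeasure D (vhat p v))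
      (fun s => mass (densityMeasure D u) (p - 1) F s ^ (p - 1)⁻¹) x ^ (p - 1) ≤
        F x ^ (p - 1) := by
    intro x hx
    have h1 : c ≤ (opII p u v D f x)⁻¹ := iInf₂_le x hx
    rw [opII_eq H.hp H.hum H.hvm (fun x hx => ⟨(hfpos x hx).le, hF x hx⟩) measurableSet_openI
      (fun x => ⟨fun h => ⟨h, (hfpos x h).ne'⟩, fun h => h.1⟩) hx.1.le (hfpos x hx).le,
      densityMeasure_restrict_openI, ← hF x hx] at h1
    exact (le_inv_div_iff (ENNReal.rpow_pos (pos_iff_ne_zero.2 (hF0 x hx)) (hFt x hx)).ne'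
      (ENNReal.rpow_ne_top_of_nonneg H.r_pos.le (hFt x hx))).1 h1
  refine le_iInf₂ fun g hg => ?_
  obtain ⟨w, hwm, -, hwe, hw1⟩ := H.test_estimates hg.1 hg.2.1 hg.2.2
  have key := hardy_of_supersolution (μ := densityMeasure D u)
    (ν := densityMeasure D (vhat p v)) H.r_pos hFm hwm (c := c) ?_ ?_ ?_
  · rw [sub_add_cancel] at key
    rw [hwe]
    exact (by simpa using mul_le_mul_right hw1 c : c ≤ _).trans key
  · filter_upwards [ae_densityMeasure_mem] with s hs
    exact H.mass_ne_zero hFm hs.1 le_rfl le_rfl hs.2.le fun x hx =>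
      hF0 x (Ioo_subset_openI (zero_mem_closedI H.hD) (openI_subset_closedI hs) hx)
  · filter_upwards [ae_densityMeasure_mem] with s hs
    exact H.mass_ne_top_of_continuousOn
      (hfc.mono (Icc_subset_closedI (zero_mem_closedI H.hD) (openI_subset_closedI hs)))
      fun x hx => hF x (Ioo_subset_openI (zero_mem_closedI H.hD) (openI_subset_closedI hs) hx)
  · filter_upwards [ae_densityMeasure_mem] with x hx using hc x hx

/-- For `c' < λ_p` the solution of `f = T ψ + c' ^ (1/(p-1)) T f` is the required element of `F_I`,
since dropping `T ψ` gives `II(f)⁻¹ ≥ c'`. -/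
lemma lam_le_iSup_FI :
    lam p u v D ≤ ⨆ f ∈ FI p v D, ⨅ x ∈ openI D, (opII p u v D f x)⁻¹ := by
  refine le_of_forall_lt fun c hc => ?_
  obtain ⟨c', hcc', hc'⟩ := exists_between hc
  refine hcc'.trans_le ?_
  have hri : 0 < (p - 1)⁻¹ := inv_pos.2 H.r_pos
  have hp1 : p - 1 + 1 = p := by ring
  set μ := densityMeasure D u with hμ
  set ν := densityMeasure D (vhat p v) with hν
  -- This source is in `L^p(μ)`, as `μ` is finite below `1`, and positive near `0`, so the flux is
  -- nonzero on all of `(0, D)`.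
  set ψ : ℝ → ℝ≥0∞ := (Iio (1:ℝ)).indicator 1 with hψdef
  have hψm : Measurable ψ := measurable_one.indicator measurableSet_Iio
  have hψp : ∫⁻ x, ψ x ^ p ∂μ ≠ ∞ := by
    have e : ∀ x, ψ x ^ p = ψ x := fun x => by
      by_cases hx : x ∈ Iio (1:ℝ) <;> simp [ψ, hx, H.p_pos]
    simp only [e]
    rw [hψdef, lintegral_indicator_one measurableSet_Iio]
    exact densityMeasure_Iio_ne_top H.hui H.hD 1
  obtain ⟨f, hfm, hfp, hfix⟩ := exists_supersolution (μ := μ) (ν := ν) H.r_pos hc'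
    (fun f hfm hf => by
      rw [hp1] at hf ⊢
      have := H.norm_tail_le hfm hf isOpen_openI subset_rfl
      rwa [densityMeasure_restrict_openI] at this)
    hψm (by rwa [hp1])
  rw [hp1] at hfp
  have hct : c' ^ (p - 1)⁻¹ ≠ ∞ :=
    ENNReal.rpow_ne_top_of_nonneg hri.le (hc'.trans_le le_top).ne
  have hmf := H.mass_ne_top hfp
  have hmψ := H.mass_ne_top hψp
  set w : ℝ → ℝ≥0∞ := fun s => mass μ (p - 1) ψ s ^ (p - 1)⁻¹ +
    c' ^ (p - 1)⁻¹ * mass μ (p - 1) f s ^ (p - 1)⁻¹ with hw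
  have hwm : Measurable w := (measurable_mass.pow_const _).add
    ((measurable_mass.pow_const _).const_mul _)
  have hwt : ∀ s, w s ≠ ∞ := fun s => ENNReal.add_ne_top.2
    ⟨ENNReal.rpow_ne_top_of_nonneg hri.le (hmψ s),
      ENNReal.mul_ne_top hct (ENNReal.rpow_ne_top_of_nonneg hri.le (hmf s))⟩
  have hwmono : Monotone w := fun s t h => by
    have h1 := mass_monotone (μ := μ) (r := p - 1) (f := ψ) h
    have h2 := mass_monotone (μ := μ) (r := p - 1) (f := f) h
    simp only [hw]
    gcongr
  have hwpos : ∀ s ∈ openI D, w s ≠ 0 := fun s hs h0 => by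
    have h1 := (add_eq_zero.1 h0).1
    rw [ENNReal.rpow_eq_zero_iff_of_pos hri] at h1
    refine H.mass_ne_zero (a := 0) (b := min s 1) (s := s) hψm (lt_min hs.1 one_pos) le_rfl
      (min_le_left _ _) ((EReal.coe_le_coe_iff.2 (min_le_left s 1)).trans hs.2.le)
      (fun x hx => ?_) h1
    rw [hψdef, indicator_of_mem (show x ∈ Iio (1:ℝ) from hx.2.trans_le (min_le_right _ _))]
    exact one_ne_zero
  set W : ℝ → ℝ := fun s => (w s).toReal with hW
  have hWw : (fun s => ENNReal.ofReal (W s)) = w := funext fun s => ENNReal.ofReal_toReal (hwt s)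
  have hWm : Measurable W := hwm.ennreal_toReal
  have hW0 : ∀ x, 0 ≤ W x := fun x => ENNReal.toReal_nonneg
  have hWc : Continuous W := by
    have e : W = fun s => (mass μ (p - 1) ψ s).toReal ^ (p - 1)⁻¹ +
        (c' ^ (p - 1)⁻¹).toReal * (mass μ (p - 1) f s).toReal ^ (p - 1)⁻¹ := by
      funext s
      simp only [hW, hw]
      rw [ENNReal.toReal_add (ENNReal.rpow_ne_top_of_nonneg hri.le (hmψ s))
        (ENNReal.mul_ne_top hct (ENNReal.rpow_ne_top_of_nonneg hri.le (hmf s))),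
        ENNReal.toReal_mul, ENNReal.toReal_rpow, ENNReal.toReal_rpow]
    rw [e]
    exact ((continuous_mass hψm hmψ).rpow_const fun _ => Or.inr hri.le).add
      (continuous_const.mul ((continuous_mass hfm hmf).rpow_const fun _ => Or.inr hri.le))
  have hfix' : f = tail ν w := funext hfix
  -- Membership in `L^p(μ)` gives one point `y` of `(0, D)` where `f` is finite; since `w` is
  -- monotone and finite, the tail from any other `x` exceeds `f y` by a finite amount at most.
  have hft : ∀ x, f x ≠ ∞ := by
    obtain ⟨y, hyD, hy⟩ : ∃ y ∈ openI D, f y ≠ ∞ := by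
      by_contra! hcon
      refine hfp (top_le_iff.1 ?_)
      have hμ0 : μ univ ≠ 0 := densityMeasure_ne_zero H.hum H.hu isOpen_univ
        (by simpa using nonempty_openI H.hD)
      calc ∞ = ∫⁻ x, ∞ ∂μ := by rw [lintegral_const, ENNReal.top_mul hμ0]
        _ ≤ ∫⁻ x, f x ^ p ∂μ := by
          refine lintegral_mono_ae ?_
          filter_upwards [ae_densityMeasure_mem] with x hx
          rw [hcon x hx, ENNReal.top_rpow_of_pos H.p_pos]
    intro x
    have h1 : f x ≤ w (y + 1) * ν (Iio (y + 1)) + f y := by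
      rw [hfix']
      calc tail ν w x ≤ ∫⁻ s in Iio (y + 1) ∪ Ioi y, w s ∂ν :=
            lintegral_mono_set fun t _ => (lt_or_ge t (y + 1)).imp id fun h => by
              simp only [mem_Ioi]; linarith
        _ ≤ ∫⁻ s in Iio (y + 1), w s ∂ν + tail ν w y := lintegral_union_le _ _ _
        _ ≤ _ := by
          gcongr
          rw [← setLIntegral_const]
          exact setLIntegral_mono' measurableSet_Iio fun s hs => hwmono (le_of_lt hs)
    exact ne_top_of_le_ne_top (ENNReal.add_ne_top.2 ⟨ENNReal.mul_ne_top (hwt _)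
      (densityMeasure_Iio_ne_top H.hvi H.hD _), hy⟩) h1
  have ht : ∀ x, tail ν (fun s => ENNReal.ofReal (W s)) x ≠ ∞ := by
    rw [hWw, ← hfix']; exact hft
  set h : ℝ → ℝ := fun x => (tail ν (fun s => ENNReal.ofReal (W s)) x).toReal with hh
  have hhf : ∀ x, ENNReal.ofReal (h x) = f x := fun x => by
    simp only [hh]
    rw [ENNReal.ofReal_toReal (ht x), hWw, ← hfix']
  have hf0 : ∀ x ∈ openI D, f x ≠ 0 := by
    intro x hx
    rw [hfix']
    obtain ⟨a, b, -, -, hab, hcov⟩ := exists_exhaustion H.hD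
    obtain ⟨n, hn⟩ := hcov x hx
    exact setLIntegral_ne_zero (measurable_vhat H.hvm) (vhat_pos H.hv) measurableSet_Ioi isOpen_Ioi
      subset_rfl ⟨b n, hn.2, (hab n).2.1⟩ hwm fun s hs => hwpos s hs.2
  have hhpos : ∀ x ∈ openI D, 0 < h x := fun x hx => by
    rw [← ENNReal.ofReal_pos, hhf]; exact pos_iff_ne_zero.2 (hf0 x hx)
  have hmem : h ∈ FI p v D := by
    refine ⟨(continuous_tail_ofReal hWm.ennreal_ofReal ht).continuousOn,
      fluxContinuousOn_tail H.hvi H.hvm H.hv hWm hW0 ht isOpen_openI subset_rfl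
        ⟨fun x hx y hy => Icc_subset_openI hx hy⟩ hWc.continuousOn, hhpos, fun x hx => ?_⟩
    have e := flux_tail H.hvi H.hvm H.hv hWm hW0 ht hx hWc.continuousAt
    rw [e]
    exact neg_neg_of_pos (ENNReal.toReal_pos (hwpos x hx) (hwt x))
  refine le_trans ?_ (le_iSup₂ h hmem)
  refine le_iInf₂ fun x hx => ?_
  rw [opII_eq H.hp H.hum H.hvm (fun x hx => ⟨(hhpos x hx).le, (hhf x).symm⟩) measurableSet_openI
    (fun x => ⟨fun h => ⟨h, (hhpos x h).ne'⟩, fun h => h.1⟩) hx.1.le (hhpos x hx).le,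
    densityMeasure_restrict_openI, hhf, le_inv_div_iff
      (ENNReal.rpow_pos (pos_iff_ne_zero.2 (hf0 x hx)) (hft x)).ne'
      (ENNReal.rpow_ne_top_of_nonneg H.r_pos.le (hft x))]
  refine mul_rpow_le_of_le H.r_pos ?_
  conv_rhs => rw [hfix']
  rw [← tail_const_mul _ (measurable_mass.pow_const _)]
  exact tail_mono (fun s => le_add_self) x

/-! ### Lower bounds for the infima over the double operator -/

lemma lam_le_of_tail_bound {F : ℝ → ℝ≥0∞} (hFm : Measurable F)
    (hFp : ∫⁻ x, F x ^ p ∂densityMeasure D u ≠ ∞) (hF0 : ∫⁻ x, F x ^ p ∂densityMeasure D u ≠ 0)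
    {S : Set ℝ} (hS : IsOpen S) (hSD : S ⊆ openI D) {C : ℝ≥0∞}
    (hC : ∀ x ∈ openI D, F x ≤ C ^ (p - 1)⁻¹ * tail ((densityMeasure D (vhat p v)).restrict S)
      (fun s => mass (densityMeasure D u) (p - 1) F s ^ (p - 1)⁻¹) x) :
    lam p u v D ≤ C := by
  have hrp : 0 < (p - 1) / p := div_pos H.r_pos H.p_pos
  have key := H.norm_tail_le hFm hFp hS hSD
  set h := tail ((densityMeasure D (vhat p v)).restrict S)
      (fun s => mass (densityMeasure D u) (p - 1) F s ^ (p - 1)⁻¹)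
  set μ := densityMeasure D u
  -- Nonvanishing of `λ_p` makes the norm of `h` finite through `key`; then it can be cancelled.
  rcases eq_or_ne (lam p u v D) 0 with hl | hl
  · rw [hl]; exact zero_le
  have hFh : ∫⁻ x, F x ^ p ∂μ ≤ (C ^ (p - 1)⁻¹) ^ p * ∫⁻ x, h x ^ p ∂μ := by
    rw [← lintegral_const_mul _ (measurable_tail.pow_const p)]
    refine lintegral_mono_ae ?_
    filter_upwards [ae_densityMeasure_mem] with x hx
    rw [← ENNReal.mul_rpow_of_nonneg _ _ H.p_pos.le]
    exact ENNReal.rpow_le_rpow (hC x hx) H.p_pos.le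
  have hh0 : (∫⁻ x, h x ^ p ∂μ) ^ ((p - 1) / p) ≠ 0 := fun h0 => by
    rw [ENNReal.rpow_eq_zero_iff_of_pos hrp] at h0
    rw [h0, mul_zero] at hFh
    exact hF0 (le_antisymm hFh bot_le)
  have hht : (∫⁻ x, h x ^ p ∂μ) ^ ((p - 1) / p) ≠ ∞ := fun ht => by
    rw [ht, ENNReal.mul_top hl, top_le_iff] at key
    exact ENNReal.rpow_ne_top_of_nonneg hrp.le hFp key
  have h2 := ENNReal.rpow_le_rpow hFh hrp.le
  rw [ENNReal.mul_rpow_of_nonneg _ _ hrp.le, ← ENNReal.rpow_mul, ← ENNReal.rpow_mul] at h2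
  have e : (p - 1)⁻¹ * (p * ((p - 1) / p)) = 1 := by
    have h1 := H.p_pos.ne'
    have h2 := H.r_pos.ne'
    field_simp
  rw [e, ENNReal.rpow_one] at h2
  exact (ENNReal.mul_le_mul_iff_left hh0 hht).1 (key.trans h2)

lemma lam_le_iInf_FII :
    lam p u v D ≤ ⨅ f ∈ FIItilde D ∪ FIItilde' p u v D,
      ⨆ x ∈ suppI D f, (opII p u v D f x)⁻¹ := by
  refine le_iInf₂ fun f hf => ?_
  refine le_of_forall_gt fun C' hC' => ?_
  -- A constant strictly between is neither `0` nor `∞`, so `II(f)⁻¹ ≤ C` can be rewritten as a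
  -- product inequality.
  obtain ⟨C, hC, hCC'⟩ := exists_between hC'
  refine lt_of_le_of_lt ?_ hCC'
  have hC0 : C ≠ 0 := (bot_le.trans_lt hC).ne'
  have hCt : C ≠ ∞ := (hCC'.trans_le le_top).ne
  have hle : ∀ x ∈ suppI D f, (opII p u v D f x)⁻¹ ≤ C := fun x hx =>
    (le_iSup₂ (f := fun x _ => (opII p u v D f x)⁻¹) x hx).trans hC.le
  have hnn : NonnegNonzero D f := hf.elim (fun h => h.1) fun h => h.1
  -- In the truncated family `f` vanishes at its endpoint `b`, so the extension by zero is
  -- continuous; both families are treated alike from here.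
  have hcont : ContinuousOn f (closedI D) := by
    rcases hf with ⟨-, b, hb, hb0, hbc⟩ | ⟨-, h, -⟩
    · intro x hx
      rcases lt_or_ge x b with hxb | hxb
      · refine (hbc x ⟨hx.1, hxb.le⟩).mono_of_mem_nhdsWithin ?_
        rw [mem_nhdsWithin]
        exact ⟨Iio b, isOpen_Iio, hxb, fun y hy => ⟨hy.2.1, le_of_lt hy.1⟩⟩
      · have h1 : ContinuousWithinAt f (Icc 0 b) x := by
          rcases hxb.eq_or_lt with rfl | hlt
          · exact hbc b ⟨hx.1, le_rfl⟩
          · exact continuousWithinAt_of_notMem_closure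
              (by rw [closure_Icc]; exact fun h => absurd h.2 (not_le.2 hlt))
        have h2 : ContinuousWithinAt f (closedI D ∩ Ici b) x :=
          (continuousWithinAt_const (b := (0:ℝ))).congr (fun y hy => hb0 y hy.1 hy.2)
            (hb0 x hx hxb)
        exact (h1.union h2).mono fun y hy => (le_total y b).imp (fun h => ⟨hy.1, h⟩)
          fun h => ⟨hy, h⟩
    · exact h
  set S : Set ℝ := openI D ∩ f ⁻¹' {0}ᶜ with hSdef
  have hSD : S ⊆ openI D := inter_subset_left
  have hS : IsOpen S := (hcont.mono openI_subset_closedI).isOpen_inter_preimage isOpen_openI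
    isOpen_compl_singleton
  -- The given nonzero value may be at an endpoint; continuity and density of `(0, D)` in `[0, D]`
  -- move it inside.
  have hSne : S.Nonempty := by
    obtain ⟨x, hx, hfx⟩ := hnn.2
    have h1 : ∀ᶠ y in 𝓝[closedI D] x, f y ≠ 0 := (hcont x hx).eventually_ne hfx
    have hcl : x ∈ closure (openI D) := by
      obtain ⟨a, b, -, -, hab, hcov⟩ := exists_exhaustion H.hD
      by_cases hxD : x ∈ openI D
      · exact subset_closure hxD
      rcases hx.1.eq_or_lt with h0 | h0
      · have h2 : Ioo 0 (b 0) ⊆ openI D :=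
          Ioo_subset_openI (zero_mem_closedI H.hD) (openI_subset_closedI (hab 0).2.1)
        refine closure_mono h2 ?_
        rw [closure_Ioo (hab 0).2.1.1.ne, ← h0]
        exact ⟨le_rfl, (hab 0).2.1.1.le⟩
      · have h2 : Ioo 0 x ⊆ openI D := Ioo_subset_openI (zero_mem_closedI H.hD) hx
        refine closure_mono h2 ?_
        rw [closure_Ioo h0.ne]
        exact ⟨h0.le, le_rfl⟩
    have : (𝓝[openI D] x).NeBot := mem_closure_iff_nhdsWithin_neBot.1 hcl
    have h2 : ∀ᶠ y in 𝓝[openI D] x, f y ≠ 0 :=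
      h1.filter_mono (nhdsWithin_mono _ openI_subset_closedI)
    obtain ⟨y, hy1, hy2⟩ := (h2.and self_mem_nhdsWithin).exists
    exact ⟨y, hy2, hy1⟩
  have hfS : ∀ x, x ∈ S ↔ x ∈ openI D ∧ f x ≠ 0 := fun x => Iff.rfl
  set F := (openI D).indicator fun x => ENNReal.ofReal (f x) with hFdef
  have hF : ∀ x ∈ openI D, F x = ENNReal.ofReal (f x) := fun x hx => indicator_of_mem hx _
  have hf0 : ∀ x ∈ openI D, 0 ≤ f x := fun x hx => hnn.1 x (openI_subset_closedI hx)
  have hFm : Measurable F :=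
    measurable_indicator_ofReal measurableSet_openI (hcont.mono openI_subset_closedI)
  have hFS : ∀ x ∈ S, F x ≠ 0 := fun x hx => by
    rw [hF x hx.1]
    exact (ENNReal.ofReal_pos.2 (lt_of_le_of_ne (hf0 x hx.1) (Ne.symm hx.2))).ne'
  have hFt : ∀ x, F x ≠ ∞ := fun x =>
    ne_top_of_le_ne_top ENNReal.ofReal_ne_top (indicator_le_self' (fun _ _ => zero_le) x)
  refine H.lam_le_of_tail_bound hFm ?_ ?_ hS hSD fun x hx => ?_
  · rcases hf with ⟨-, b, hb, hb0, hbc⟩ | ⟨-, -, hfin⟩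
    · exact H.lintegral_rpow_ne_top_of_continuousOn hbc
        (fun x hx => hF x (Ioo_subset_openI (zero_mem_closedI H.hD) (openI_subset_closedI hb) hx))
        fun x hx hbx => by rw [hF x hx, hb0 x (openI_subset_closedI hx) hbx, ENNReal.ofReal_zero]
    -- From `1 ≤ C II(f)` on the support, `f ≤ C f II(f)`, so `f` inherits integrability from `f
    -- II(f)`.
    · rw [lintegral_densityMeasure H.hum]
      have h1 : ∫⁻ x in openI D, C ^ p * ((ENNReal.ofReal (f x) * opII p u v D f x) ^ p *
          ENNReal.ofReal (u x)) ≠ ∞ := by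
        rw [lintegral_const_mul' _ _ (ENNReal.rpow_ne_top_of_nonneg H.p_pos.le hCt)]
        exact ENNReal.mul_ne_top (ENNReal.rpow_ne_top_of_nonneg H.p_pos.le hCt) hfin.ne
      refine ne_top_of_le_ne_top h1 (setLIntegral_mono' measurableSet_openI fun x hx => ?_)
      rw [← mul_assoc, ← ENNReal.mul_rpow_of_nonneg _ _ H.p_pos.le, mul_comm, hF x hx]
      refine mul_le_mul_left (ENNReal.rpow_le_rpow ?_ H.p_pos.le) _
      by_cases hfx : f x = 0
      · simp [hfx]
      · have h2 := hle x ⟨openI_subset_closedI hx, hfx⟩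
        have h3 : 1 ≤ C * opII p u v D f x := by
          rwa [← one_div, ENNReal.div_le_iff_le_mul (Or.inr hCt) (Or.inr hC0)] at h2
        calc ENNReal.ofReal (f x) = ENNReal.ofReal (f x) * 1 := (mul_one _).symm
          _ ≤ ENNReal.ofReal (f x) * (C * opII p u v D f x) := by gcongr
          _ = _ := by ring
  · obtain ⟨y, hy⟩ := hSne
    rw [← setLIntegral_univ]
    refine setLIntegral_ne_zero H.hum H.hu MeasurableSet.univ hS (subset_univ _)
      ⟨y, hy, hSD hy⟩ (hFm.pow_const p) fun x hx => ?_
    rw [ne_eq, ENNReal.rpow_eq_zero_iff_of_pos H.p_pos]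
    exact hFS x hx.1
  · by_cases hfx : f x = 0
    · rw [hF x hx, hfx, ENNReal.ofReal_zero]; exact zero_le
    refine le_rpow_inv_mul H.r_pos ?_
    have h2 := hle x ⟨openI_subset_closedI hx, hfx⟩
    rw [opII_eq H.hp H.hum H.hvm (fun x hx => ⟨hf0 x hx, hF x hx⟩) hS.measurableSet hfS hx.1.le
      (hf0 x hx), ← hF x hx, inv_div_le_iff
        (ENNReal.rpow_pos (pos_iff_ne_zero.2 (hFS x ⟨hx, hfx⟩)) (hFt x)).ne'
        (ENNReal.rpow_ne_top_of_nonneg H.r_pos.le (hFt x)) hC0 hCt] at h2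
    exact h2

end Weights

/-! ### Functions with negative flux and the lower bound for the single operator -/

lemma neg_mul_abs_rpow {p w : ℝ} (hw : w < 0) : -(w * |w| ^ (p - 2)) = (-w) ^ (p - 1) := by
  rw [abs_of_neg hw, ← neg_mul]
  nth_rewrite 1 [← Real.rpow_one (-w)]
  rw [← Real.rpow_add (neg_pos.2 hw)]
  congr 1
  ring

lemma rpow_sub_one_mul_self {p : ℝ} (hp : 1 < p) (a : ℝ≥0∞) : a ^ (p - 1) * a = a ^ p := by
  nth_rewrite 2 [← ENNReal.rpow_one a]
  rw [← ENNReal.rpow_add_of_nonneg _ _ (by linarith) zero_le_one, sub_add_cancel]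

namespace Weights

variable {p : ℝ} {D : EReal} {u v : ℝ → ℝ} (H : Weights p D u v)
include H

lemma lintegral_neg_flux {f : ℝ → ℝ} {S : Set ℝ} (hSD : S ⊆ openI D)
    (hf : FluxContinuousOn p v f S) (hneg : ∀ x ∈ S, flux p v f x < 0) {x y : ℝ} (hx : x ∈ S)
    (hy : y ∈ S) (hxy : x ≤ y) (hsub : Icc x y ⊆ S) :
    ∫⁻ t in Ioc x y, ENNReal.ofReal (-flux p v f t) ∂densityMeasure D (vhat p v) =
      ENNReal.ofReal (f x - f y) := by
  have hsub' : Ioc x y ⊆ openI D := Ioc_subset_Icc_self.trans (hsub.trans hSD)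
  have hi : IntervalIntegrable (fun t => vhat p v t * flux p v f t) volume x y := by
    refine (intervalIntegrable_density H.hvi (openI_subset_closedI (hSD hx))
      (openI_subset_closedI (hSD hy))).mul_continuousOn (hf.1.mono ?_)
    rwa [uIcc_of_le hxy]
  have hpos : ∀ᵐ t ∂volume.restrict (Ioc x y), 0 < vhat p v t :=
    ae_mono (Measure.restrict_mono hsub' le_rfl) (vhat_pos H.hv)
  have e : f x - f y = ∫ t in Ioc x y, -(vhat p v t * flux p v f t) := by
    rw [integral_neg, ← intervalIntegral.integral_of_le hxy, ← hf.2 x hx y hy]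
    ring
  have hneg' : ∀ t ∈ Ioc x y, flux p v f t < 0 := fun t ht =>
    hneg t (hsub (Ioc_subset_Icc_self ht))
  rw [setLIntegral_densityMeasure (measurable_vhat H.hvm) measurableSet_Ioc, inter_eq_left.2 hsub',
    e, ofReal_integral_eq_lintegral_ofReal]
  · refine lintegral_congr_ae ?_
    filter_upwards [hpos] with t ht
    rw [← ENNReal.ofReal_mul ht.le, mul_neg]
  · exact ((intervalIntegrable_iff_integrableOn_Ioc_of_le hxy).1 hi).neg
  · filter_upwards [hpos, ae_restrict_mem measurableSet_Ioc] with t h1 h2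
    have := hneg' t h2
    simp only [Pi.zero_apply]
    nlinarith

/-- A function vanishing at `b` is the integral of its negative flux up to `b`. -/
lemma tail_neg_flux {f : ℝ → ℝ} {a b : ℝ} (ha : a ∈ closedI D) (hb : b ∈ closedI D)
    (hfc : ContinuousOn f (Icc a b)) (hfb : f b = 0) (hf : FluxContinuousOn p v f (Ioo a b))
    (hneg : ∀ x ∈ Ioo a b, flux p v f x < 0) {x : ℝ} (hx : x ∈ Ioo a b) :
    tail (densityMeasure D (vhat p v))
      ((Ioo a b).indicator fun s => ENNReal.ofReal (-flux p v f s)) x = ENNReal.ofReal (f x) := by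
  set ν := densityMeasure D (vhat p v)
  -- The increment formula is available only inside the open interval; the endpoint `b` is reached
  -- by monotone convergence and continuity of `f`.
  obtain ⟨y, hym, hyx, hyt⟩ := exists_seq_strictMono_tendsto' hx.2
  have hyI : ∀ n, y n ∈ Ioo a b := fun n => ⟨hx.1.trans (hyx n).1, (hyx n).2⟩
  have e1 : tail ν ((Ioo a b).indicator fun s => ENNReal.ofReal (-flux p v f s)) x =
      ∫⁻ t in ⋃ n, Ioc x (y n), ENNReal.ofReal (-flux p v f t) ∂ν := by
    rw [tail, setLIntegral_indicator measurableSet_Ioo]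
    congr 2
    ext t
    simp only [mem_inter_iff, mem_Ioo, mem_Ioi, mem_iUnion, mem_Ioc]
    constructor
    · rintro ⟨⟨_, h2⟩, h3⟩
      obtain ⟨n, hn⟩ := (hyt.eventually (lt_mem_nhds h2)).exists
      exact ⟨n, h3, hn.le⟩
    · rintro ⟨n, h1, h2⟩
      exact ⟨⟨hx.1.trans h1, h2.trans_lt (hyx n).2⟩, h1⟩
  have hmono : Monotone fun n => Ioc x (y n) := fun m n h => Ioc_subset_Ioc_right (hym.monotone h)
  rw [e1, setLIntegral_iUnion_of_directed _ hmono.directed_le]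
  have e2 : ∀ n, ∫⁻ t in Ioc x (y n), ENNReal.ofReal (-flux p v f t) ∂ν =
      ENNReal.ofReal (f x - f (y n)) := fun n =>
    H.lintegral_neg_flux (Ioo_subset_openI ha hb) hf hneg hx (hyI n) (hyx n).1.le
      fun t ht => ⟨hx.1.trans_le ht.1, ht.2.trans_lt (hyx n).2⟩
  have h1 : Tendsto (fun n => ∫⁻ t in Ioc x (y n), ENNReal.ofReal (-flux p v f t) ∂ν) atTop
      (𝓝 (⨆ n, ∫⁻ t in Ioc x (y n), ENNReal.ofReal (-flux p v f t) ∂ν)) :=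
    tendsto_atTop_iSup fun m n h => lintegral_mono_set (hmono h)
  have h2 : Tendsto (fun n => f (y n)) atTop (𝓝 0) := by
    rw [← hfb]
    have hab : a ≤ b := (hx.1.trans hx.2).le
    refine (hfc b ⟨hab, le_rfl⟩).tendsto.comp (tendsto_nhdsWithin_iff.2 ⟨hyt, ?_⟩)
    exact .of_forall fun n => Ioo_subset_Icc_self (hyI n)
  have h3 := ENNReal.tendsto_ofReal ((tendsto_const_nhds (x := f x)).sub h2)
  simp only [e2] at h1 ⊢
  rw [sub_zero] at h3
  exact tendsto_nhds_unique h1 h3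

lemma tail_neg_flux_ne_zero {f : ℝ → ℝ} {a b : ℝ} (ha : a ∈ closedI D) (hb : b ∈ closedI D)
    (hf : ContinuousOn (flux p v f) (Ioo a b)) (hneg : ∀ x ∈ Ioo a b, flux p v f x < 0) {x : ℝ}
    (hxb : x < b) (hab : a < b) :
    tail (densityMeasure D (vhat p v))
      ((Ioo a b).indicator fun s => ENNReal.ofReal (-flux p v f s)) x ≠ 0 := by
  rw [tail, setLIntegral_indicator measurableSet_Ioo]
  have hm : max x a < b := max_lt hxb hab
  have hsub : Ioo (max x a) b ⊆ Ioo a b := Ioo_subset_Ioo_left (le_max_right _ _)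
  have hmid : (max x a + b) / 2 ∈ Ioo (max x a) b := ⟨by linarith, by linarith⟩
  rw [← setLIntegral_congr_fun (measurableSet_Ioo.inter measurableSet_Ioi)
    (f := (Ioo a b).indicator fun s => ENNReal.ofReal (-flux p v f s))
    fun t ht => indicator_of_mem ht.1 _]
  refine setLIntegral_ne_zero (measurable_vhat H.hvm) (vhat_pos H.hv)
    (measurableSet_Ioo.inter measurableSet_Ioi) (isOpen_Ioo (a := max x a) (b := b))
    (fun t ht => ⟨hsub ht, (le_max_left x a).trans_lt ht.1⟩)
    ⟨_, hmid, Ioo_subset_openI ha hb (hsub hmid)⟩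
    (measurable_indicator_ofReal measurableSet_Ioo hf.neg) fun t ht => ?_
  rw [indicator_of_mem (hsub ht.1)]
  exact (ENNReal.ofReal_pos.2 (neg_pos.2 (hneg t (hsub ht.1)))).ne'

lemma pos_of_flux_neg {f : ℝ → ℝ} {a b : ℝ} (ha : a ∈ closedI D) (hb : b ∈ closedI D)
    (hfc : ContinuousOn f (Icc a b)) (hfb : f b = 0) (hf : FluxContinuousOn p v f (Ioo a b))
    (hneg : ∀ x ∈ Ioo a b, flux p v f x < 0) {x : ℝ} (hx : x ∈ Ioo a b) : 0 < f x := by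
  rw [← ENNReal.ofReal_pos, ← H.tail_neg_flux ha hb hfc hfb hf hneg hx, pos_iff_ne_zero]
  exact H.tail_neg_flux_ne_zero ha hb hf.1 hneg hx.2 (hx.1.trans hx.2)

/-- Positivity in the interior passes to the closed interval by continuity. -/
lemma nonneg_of_flux_neg {f : ℝ → ℝ} {a b : ℝ} (ha : a ∈ closedI D) (hb : b ∈ closedI D)
    (hab : a < b) (hfc : ContinuousOn f (Icc a b)) (hfb : f b = 0)
    (hf : FluxContinuousOn p v f (Ioo a b)) (hneg : ∀ x ∈ Ioo a b, flux p v f x < 0) {x : ℝ}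
    (hx : x ∈ Icc a b) : 0 ≤ f x := by
  have h1 : Icc a b ⊆ closure (Ioo a b) := by rw [closure_Ioo hab.ne]
  have h2 : MapsTo f (Ioo a b) (Ici 0) := fun y hy =>
    (H.pos_of_flux_neg ha hb hfc hfb hf hneg hy).le
  have h3 := h2.closure_of_continuousOn (by rwa [closure_Ioo hab.ne])
  rw [isClosed_Ici.closure_eq] at h3
  exact h3 (h1 hx)

lemma FItilde_subset_FIItilde : FItilde p v D ⊆ FIItilde D := by
  rintro f ⟨a, ha, b, hb, hab, hfc, hf, hneg, hconst, hoff⟩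
  have ha' := openI_subset_closedI ha
  have hb' := openI_subset_closedI hb
  have hfb : f b = 0 := hoff b hb' le_rfl
  refine ⟨⟨fun x hx => ?_, (a + b) / 2, ?_, ?_⟩, b, hb, hoff, ?_⟩
  · rcases lt_or_ge x b with hxb | hxb
    · rw [hconst x hx hxb]
      exact H.nonneg_of_flux_neg ha' hb' hab hfc hfb hf hneg ⟨le_max_right _ _, max_le hxb.le hab.le⟩
    · rw [hoff x hx hxb]
  · exact Icc_subset_closedI ha' hb' ⟨by linarith, by linarith⟩
  · exact (H.pos_of_flux_neg ha' hb' hfc hfb hf hneg ⟨by linarith, by linarith⟩).ne'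
  · have h1 : ContinuousOn (fun x => f (max x a)) (Icc 0 b) :=
      hfc.comp (by fun_prop) fun x hx => ⟨le_max_right _ _, max_le hx.2 hab.le⟩
    refine h1.congr fun x hx => ?_
    rcases hx.2.eq_or_lt with rfl | h
    · exact congrArg f (max_eq_left hab.le).symm
    · exact hconst x ⟨hx.1, (EReal.coe_le_coe_iff.2 hx.2).trans hb'.2⟩ h

/-- Testing with `f` itself: if `I(f)⁻¹ ≤ C`, the negated flux `w` satisfies `w ^ (p-1) ≤ C mass f`,
so `λ_p ∫ f ^ p dμ ≤ ∫ w ^ p dν ≤ C ∫ mass f · w dν = C ∫ f ^ p dμ`, the last step by Tonelli. -/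
lemma lam_le_iInf_FItilde' :
    lam p u v D ≤ ⨅ f ∈ FItilde' p v D, ⨆ x ∈ openI D, (opI p u v f x)⁻¹ := by
  refine le_iInf₂ fun f hf => ?_
  obtain ⟨b, hb, hoff, hfc, hneg, hf⟩ := hf
  refine le_of_forall_gt fun C' hC' => ?_
  obtain ⟨C, hC, hCC'⟩ := exists_between hC'
  refine lt_of_le_of_lt ?_ hCC'
  have hC0 : C ≠ 0 := (bot_le.trans_lt hC).ne'
  have hCt : C ≠ ∞ := (hCC'.trans_le le_top).ne
  have h0 := zero_mem_closedI H.hD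
  have hb' := openI_subset_closedI hb
  have hfb : f b = 0 := hoff b hb' le_rfl
  have hJD : Ioo 0 b ⊆ openI D := Ioo_subset_openI h0 hb'
  set μ := densityMeasure D u
  set ν := densityMeasure D (vhat p v)
  set w := (Ioo 0 b).indicator fun s => ENNReal.ofReal (-flux p v f s)
  have hwm : Measurable w := measurable_indicator_ofReal measurableSet_Ioo hf.1.neg
  set F := tail ν w with hFdef
  have hFm : Measurable F := measurable_tail
  have hF : ∀ x ∈ Ioo 0 b, F x = ENNReal.ofReal (f x) := fun x hx =>
    H.tail_neg_flux h0 hb' hfc hfb hf hneg hx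
  have hfpos : ∀ x ∈ Ioo 0 b, 0 < f x := fun x hx => H.pos_of_flux_neg h0 hb' hfc hfb hf hneg hx
  have hFoff : ∀ x, b ≤ x → F x = 0 := fun x hx => by
    refine (setLIntegral_congr_fun measurableSet_Ioi fun s hs => ?_).trans lintegral_zero
    exact indicator_of_notMem (fun h => lt_asymm h.2 (hx.trans_lt hs)) _
  have hFp : ∫⁻ x, F x ^ p ∂μ ≠ ∞ :=
    H.lintegral_rpow_ne_top_of_continuousOn hfc hF fun x _ hx => hFoff x hx
  have hFp0 : ∫⁻ x, F x ^ p ∂μ ≠ 0 := by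
    have hmid : b / 2 ∈ Ioo 0 b := ⟨by linarith [hb.1], by linarith [hb.1]⟩
    rw [← setLIntegral_univ]
    refine setLIntegral_ne_zero H.hum H.hu MeasurableSet.univ (isOpen_Ioo (a := 0) (b := b))
      (subset_univ _) ⟨_, hmid, hJD hmid⟩ (hFm.pow_const p) fun x hx => ?_
    rw [ne_eq, ENNReal.rpow_eq_zero_iff_of_pos H.p_pos, hF x hx.1]
    exact (ENNReal.ofReal_pos.2 (hfpos x hx.1)).ne'
  have hw : ∀ s, w s ^ (p - 1) * w s ≤ C * (mass μ (p - 1) F s * w s) := by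
    intro s
    by_cases hs : s ∈ Ioo 0 b
    · rw [← mul_assoc]
      refine mul_le_mul_left ?_ _
      have hs' := openI_subset_closedI (hJD hs)
      have h1 : (opI p u v f s)⁻¹ ≤ C :=
        (le_iSup₂ (f := fun x _ => (opI p u v f x)⁻¹) s (hJD hs)).trans hC.le
      have h2 : massInt p u f s = mass μ (p - 1) F s := massInt_eq H.hum H.hp.le hs'
        fun x hx => ⟨(hfpos x ⟨hx.1, hx.2.trans hs.2⟩).le, hF x ⟨hx.1, hx.2.trans hs.2⟩⟩
      have h3 : 0 < -flux p v f s := neg_pos.2 (hneg s hs)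
      rw [opI, neg_mul_abs_rpow (hneg s hs), h2, inv_div_le_iff
        (ENNReal.ofReal_pos.2 (Real.rpow_pos_of_pos h3 _)).ne' ENNReal.ofReal_ne_top hC0 hCt] at h1
      rwa [show w s = _ from indicator_of_mem hs _,
        ENNReal.ofReal_rpow_of_nonneg h3.le H.r_pos.le]
    · rw [show w s = 0 from indicator_of_notMem hs _]; simp
  have key : lam p u v D * ∫⁻ x, F x ^ p ∂μ ≤ C * ∫⁻ x, F x ^ p ∂μ := by
    calc lam p u v D * ∫⁻ x, F x ^ p ∂μ ≤ ∫⁻ s, w s ^ p ∂ν :=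
          H.poincare_of_continuousOn isOpen_Ioo hJD hf.1.neg fun x hx => (neg_pos.2 (hneg x hx)).le
      _ = ∫⁻ s, w s ^ (p - 1) * w s ∂ν := lintegral_congr fun s =>
          (rpow_sub_one_mul_self H.hp _).symm
      _ ≤ ∫⁻ s, C * (mass μ (p - 1) F s * w s) ∂ν := lintegral_mono hw
      _ = C * ∫⁻ x, F x ^ (p - 1) * tail ν w x ∂μ := by
          rw [lintegral_mul_tail (hFm.pow_const _) hwm]
          exact lintegral_const_mul _ (measurable_mass.mul hwm)
      _ = C * ∫⁻ x, F x ^ p ∂μ := by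
          simp only [← hFdef, rpow_sub_one_mul_self H.hp]
  exact (ENNReal.mul_le_mul_iff_left hFp0 hFp).1 key

end Weights

/-! ### Sharpness of the infima -/

lemma tail_ofReal_eq_zero {ν : Measure ℝ} {W : ℝ → ℝ} {a b x : ℝ} (hW : ∀ x ∉ Ioo a b, W x = 0) (hx : b ≤ x) :
    tail ν (fun s => ENNReal.ofReal (W s)) x = 0 := by
  refine (setLIntegral_congr_fun measurableSet_Ioi fun s hs => ?_).trans lintegral_zero
  rw [hW s fun h => lt_asymm h.2 (hx.trans_lt hs), ENNReal.ofReal_zero]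

lemma tail_ofReal_eq_max {ν : Measure ℝ} {W : ℝ → ℝ} {a b : ℝ} (hW : ∀ x ∉ Ioo a b, W x = 0) (x : ℝ) :
    tail ν (fun s => ENNReal.ofReal (W s)) x =
      tail ν (fun s => ENNReal.ofReal (W s)) (max x a) := by
  rw [tail, tail, ← lintegral_indicator measurableSet_Ioi, ← lintegral_indicator measurableSet_Ioi]
  refine lintegral_congr fun s => ?_
  by_cases hs : s ∈ Ioo a b
  · by_cases hx : x < s
    · rw [indicator_of_mem (show s ∈ Ioi x from hx),
        indicator_of_mem (show s ∈ Ioi (max x a) from max_lt hx hs.1)]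
    · rw [indicator_of_notMem (show s ∉ Ioi x from hx),
        indicator_of_notMem (show s ∉ Ioi (max x a) from fun h => hx ((le_max_left x a).trans_lt h))]
  · have h0 : ENNReal.ofReal (W s) = 0 := by rw [hW s hs, ENNReal.ofReal_zero]
    simp only [indicator_apply, h0, ite_self]

/-- A two-sided limit, if it exists, equals the limit from the right, which is `0`; otherwise the
flux is `0` by convention. This covers the corner at the end of the support. -/
lemma flux_eq_zero_of_right {p : ℝ} {v f : ℝ → ℝ} {x : ℝ} (hf : ∀ y, x ≤ y → f y = 0) :
    flux p v f x = 0 := by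
  rw [flux]
  split_ifs with h
  · have h1 := h.choose_spec.mono_left (nhdsGT_le_nhdsNE x)
    refine tendsto_nhds_unique h1 (tendsto_const_nhds.congr' ?_)
    filter_upwards [self_mem_nhdsWithin] with y hy
    rw [hf y (le_of_lt hy), hf x le_rfl, sub_zero, zero_div]
  · rfl

namespace Weights

variable {p : ℝ} {D : EReal} {u v : ℝ → ℝ} (H : Weights p D u v)
include H

/-- `W` is `(c · mass g) ^ (1/(p-1))` cut off to `(a, b)`, with `g` from `exists_subsolution`. Its
tail is the test function, and the bound on `mass g` becomes a pointwise bound of the flux by the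
mass of that tail. -/
lemma exists_tail_subsolution {a b : ℝ} (ha : a ∈ closedI D) (hb : b ∈ openI D) (hab : a < b)
    {c C : ℝ≥0∞} (hcC : c < C) {w : ℝ → ℝ≥0∞} (hw : Measurable w)
    (hwc : ∫⁻ s, w s ^ p ∂(densityMeasure D (vhat p v)).restrict (Ioo a b) <
      c * ∫⁻ x, tail ((densityMeasure D (vhat p v)).restrict (Ioo a b)) w x ^ p
        ∂densityMeasure D u) :
    ∃ W : ℝ → ℝ, Measurable W ∧ (∀ x, 0 ≤ W x) ∧ (∀ x ∉ Ioo a b, W x = 0) ∧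
      ContinuousOn W (Ioo a b) ∧ (∀ x ∈ Ioo a b, 0 < W x) ∧
      (∀ x, tail (densityMeasure D (vhat p v)) (fun s => ENNReal.ofReal (W s)) x ≠ ∞) ∧
      ∀ s ∈ Ioo a b, ENNReal.ofReal (W s) ^ (p - 1) ≤ C * mass (densityMeasure D u) (p - 1)
        (tail (densityMeasure D (vhat p v)) fun s => ENNReal.ofReal (W s)) s := by
  have hri : 0 < (p - 1)⁻¹ := inv_pos.2 H.r_pos
  have hp1 : p - 1 + 1 = p := by ring
  have hb' := openI_subset_closedI hb
  have hJD : Ioo a b ⊆ openI D := Ioo_subset_openI ha hb'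
  set μ := densityMeasure D u
  set ν := densityMeasure D (vhat p v) with hν
  have hmid : (a + b) / 2 ∈ Ioo a b := ⟨by linarith, by linarith⟩
  have hνf : ν (Ioo a b) ≠ ∞ := ne_top_of_le_ne_top (densityMeasure_Iio_ne_top H.hvi H.hD b)
    (measure_mono fun x hx => hx.2)
  have hμs : ∀ s ∈ Ioo a b, μ (Iio s) ≠ 0 := fun s hs =>
    densityMeasure_ne_zero H.hum H.hu isOpen_Iio
      ⟨(a + s) / 2, show (a + s) / 2 < s by linarith [hs.1],
        hJD ⟨by linarith [hs.1], by linarith [hs.1, hs.2]⟩⟩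
  -- The midpoint is the reference point because `μ` must charge the half-line below it, which fails
  -- at `a` itself when `a = 0`.
  obtain ⟨g, hgm, ⟨B, hB, hgB⟩, hg1, hgC⟩ := exists_subsolution (μ := μ)
    (ν := ν.restrict (Ioo a b)) H.r_pos hmid.2
    ((ae_restrict_mem measurableSet_Ioo).mono fun s hs => hs.2)
    (by rwa [Measure.restrict_apply_univ]) (densityMeasure_Iio_ne_top H.hui H.hD b)
    ((ae_restrict_mem measurableSet_Ioo).mono fun s hs => hμs s hs)
    (fun x hx => by
      rw [Measure.restrict_apply measurableSet_Ioi]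
      have hm : max x a < b := max_lt hx hab
      refine densityMeasure_ne_zero (measurable_vhat H.hvm) (vhat_pos H.hv)
        (isOpen_Ioi.inter isOpen_Ioo) ?_
      have h1 : (max x a + b) / 2 ∈ Ioo (max x a) b := ⟨by linarith, by linarith⟩
      have h2 : (max x a + b) / 2 ∈ Ioo a b := ⟨(le_max_right x a).trans_lt h1.1, h1.2⟩
      exact ⟨_, ⟨(le_max_left x a).trans_lt h1.1, h2⟩, hJD h2⟩)
    (hμs _ hmid) hcC hw (by rwa [hp1])
  have hc0 : c ≠ 0 := by rintro rfl; simp at hwc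
  have hct : c ≠ ∞ := (hcC.trans_le le_top).ne
  have hcr : c ^ (p - 1)⁻¹ ≠ ∞ := ENNReal.rpow_ne_top_of_nonneg hri.le hct
  have hmg : ∀ s, mass μ (p - 1) g s ≠ ∞ := fun s => by
    have h1 : mass μ (p - 1) g s ≤ ∫⁻ t in Iio s, B ^ (p - 1) ∂μ :=
      lintegral_mono fun t => ENNReal.rpow_le_rpow (hgB t) H.r_pos.le
    refine ne_top_of_le_ne_top ?_ h1
    rw [setLIntegral_const]
    exact ENNReal.mul_ne_top (ENNReal.rpow_ne_top_of_nonneg H.r_pos.le hB)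
      (densityMeasure_Iio_ne_top H.hui H.hD s)
  set m : ℝ → ℝ≥0∞ := fun s => c ^ (p - 1)⁻¹ * mass μ (p - 1) g s ^ (p - 1)⁻¹ with hm
  have hmt : ∀ s, m s ≠ ∞ := fun s =>
    ENNReal.mul_ne_top hcr (ENNReal.rpow_ne_top_of_nonneg hri.le (hmg s))
  have hmc : Continuous fun s => (m s).toReal := by
    simp only [hm, ENNReal.toReal_mul, ← ENNReal.toReal_rpow]
    exact continuous_const.mul ((continuous_mass hgm hmg).rpow_const fun _ => Or.inr hri.le)
  have hm0 : ∀ s ∈ Ioo a b, m s ≠ 0 := fun s hs => by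
    refine mul_ne_zero (ENNReal.rpow_pos (pos_iff_ne_zero.2 hc0) hct).ne' ?_
    rw [ne_eq, ENNReal.rpow_eq_zero_iff_of_pos hri]
    exact H.mass_ne_zero hgm hs.1 ha.1 le_rfl (hJD hs).2.le
      fun x _ => (one_pos.trans_le (hg1 x)).ne'
  set W : ℝ → ℝ := (Ioo a b).indicator fun s => (m s).toReal with hW
  have hWon : ∀ s ∈ Ioo a b, W s = (m s).toReal := fun s hs => indicator_of_mem hs _
  have hWE : (fun s => ENNReal.ofReal (W s)) = (Ioo a b).indicator m := by
    funext s
    by_cases hs : s ∈ Ioo a b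
    · rw [hWon s hs, indicator_of_mem hs, ENNReal.ofReal_toReal (hmt s)]
    · rw [hW, indicator_of_notMem hs, indicator_of_notMem hs, ENNReal.ofReal_zero]
  have htail : tail ν (fun s => ENNReal.ofReal (W s)) = fun x => c ^ (p - 1)⁻¹ *
      tail (ν.restrict (Ioo a b)) (fun s => mass μ (p - 1) g s ^ (p - 1)⁻¹) x := by
    funext x
    rw [hWE, ← tail_restrict measurableSet_Ioo, hm, tail_const_mul _ (measurable_mass.pow_const _)]
  refine ⟨W, hmc.measurable.indicator measurableSet_Ioo,
    fun x => indicator_nonneg (fun _ _ => ENNReal.toReal_nonneg) x,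
    fun x hx => indicator_of_notMem hx _, hmc.continuousOn.congr hWon,
    fun x hx => by rw [hWon x hx]; exact ENNReal.toReal_pos (hm0 x hx) (hmt x), fun x => ?_,
    fun s hs => ?_⟩
  · rw [htail]
    refine ENNReal.mul_ne_top hcr ?_
    have h1 : tail (ν.restrict (Ioo a b)) (fun s => mass μ (p - 1) g s ^ (p - 1)⁻¹) x ≤
        ∫⁻ s in Ioo a b, mass μ (p - 1) g b ^ (p - 1)⁻¹ ∂ν := by
      refine (setLIntegral_le_lintegral _ _).trans
        (setLIntegral_mono' measurableSet_Ioo fun s hs => ?_)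
      exact ENNReal.rpow_le_rpow (mass_monotone hs.2.le) hri.le
    refine ne_top_of_le_ne_top ?_ h1
    rw [setLIntegral_const]
    exact ENNReal.mul_ne_top (ENNReal.rpow_ne_top_of_nonneg hri.le (hmg b)) hνf
  · have h1 := congrFun hWE s
    rw [htail, h1, indicator_of_mem hs, hm]
    rw [ENNReal.mul_rpow_of_nonneg _ _ H.r_pos.le, ← ENNReal.rpow_mul, ← ENNReal.rpow_mul,
      inv_mul_cancel₀ H.r_pos.ne', ENNReal.rpow_one, ENNReal.rpow_one]
    exact hgC s hs.2.le

lemma tail_ofReal_ne_zero {W : ℝ → ℝ} {a b x : ℝ} (ha : a ∈ closedI D) (hb : b ∈ closedI D)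
    (hab : a < b) (hWm : Measurable W) (hWpos : ∀ x ∈ Ioo a b, 0 < W x) (hx : x < b) :
    tail (densityMeasure D (vhat p v)) (fun s => ENNReal.ofReal (W s)) x ≠ 0 := by
  have hm : max x a < b := max_lt hx hab
  have hsub : Ioo (max x a) b ⊆ Ioo a b := Ioo_subset_Ioo_left (le_max_right _ _)
  have hmid : (max x a + b) / 2 ∈ Ioo (max x a) b := ⟨by linarith, by linarith⟩
  exact setLIntegral_ne_zero (measurable_vhat H.hvm) (vhat_pos H.hv) measurableSet_Ioi
    (isOpen_Ioo (a := max x a) (b := b)) (fun t ht => (le_max_left x a).trans_lt ht.1)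
    ⟨_, hmid, Ioo_subset_openI ha hb (hsub hmid)⟩ hWm.ennreal_ofReal
    fun t ht => (ENNReal.ofReal_pos.2 (hWpos t (hsub ht.1))).ne'

lemma iInf_FItilde_le_lam :
    ⨅ f ∈ FItilde p v D, ⨆ x ∈ suppI D f, (opII p u v D f x)⁻¹ ≤ lam p u v D := by
  refine le_of_forall_gt fun C' hC' => ?_
  obtain ⟨C, hC, hCC'⟩ := exists_between hC'
  refine lt_of_le_of_lt ?_ hCC'
  obtain ⟨c, hc, hcC⟩ := exists_between hC
  have hC0 : C ≠ 0 := (bot_le.trans_lt hC).ne'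
  have hCt : C ≠ ∞ := (hCC'.trans_le le_top).ne
  obtain ⟨a, ha, b, hb, hab, w, hwm, hw⟩ := H.exists_interval_of_lam_lt hc
  have ha' := openI_subset_closedI ha
  have hb' := openI_subset_closedI hb
  have hJD : Ioo a b ⊆ openI D := Ioo_subset_openI ha' hb'
  obtain ⟨W, hWm, hW0, hWoff, hWc, hWpos, ht, hWle⟩ :=
    H.exists_tail_subsolution ha' hb hab hcC hwm (hw a le_rfl)
  set μ := densityMeasure D u
  set ν := densityMeasure D (vhat p v) with hν
  set F := tail ν fun s => ENNReal.ofReal (W s) with hF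
  set f : ℝ → ℝ := fun x => (F x).toReal with hf
  have hfF : ∀ x, F x = ENNReal.ofReal (f x) := fun x => (ENNReal.ofReal_toReal (ht x)).symm
  have hf0 : ∀ x, 0 ≤ f x := fun x => ENNReal.toReal_nonneg
  have hcont : Continuous f := continuous_tail_ofReal hWm.ennreal_ofReal ht
  have hFoff : ∀ x, b ≤ x → F x = 0 := fun x hx => tail_ofReal_eq_zero hWoff hx
  have hFpos : ∀ x, x < b → F x ≠ 0 := fun x hx =>
    H.tail_ofReal_ne_zero ha' hb' hab hWm hWpos hx
  have hfne : ∀ x, f x ≠ 0 ↔ x < b := fun x => by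
    constructor
    · intro h
      by_contra! hx
      exact h (by simp only [hf, hFoff x hx, ENNReal.toReal_zero])
    · exact fun hx => (ENNReal.toReal_pos (hFpos x hx) (ht x)).ne'
  have hmem : f ∈ FItilde p v D := by
    refine ⟨a, ha, b, hb, hab, hcont.continuousOn,
      fluxContinuousOn_tail H.hvi H.hvm H.hv hWm hW0 ht isOpen_Ioo hJD ordConnected_Ioo hWc,
      fun x hx => ?_, fun x _ _ => ?_, fun x _ hx => ?_⟩
    · have e := flux_tail H.hvi H.hvm H.hv hWm hW0 ht (hJD hx)
        (hWc.continuousAt (isOpen_Ioo.mem_nhds hx))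
      have := hWpos x hx
      rw [hf, hF, e]
      linarith
    · exact congrArg ENNReal.toReal (tail_ofReal_eq_max hWoff x)
    · simp only [hf, hFoff x hx, ENNReal.toReal_zero]
  refine (iInf₂_le f hmem).trans (iSup₂_le fun x hx => ?_)
  have hxb : x < b := (hfne x).1 hx.2
  set S : Set ℝ := {x | x ∈ openI D ∧ x < b} with hS
  have hSm : MeasurableSet S := measurableSet_openI.inter measurableSet_Iio
  rw [opII_eq H.hp H.hum H.hvm (fun x _ => ⟨hf0 x, hfF x⟩) hSm
    (fun x => and_congr_right fun _ => (hfne x).symm) hx.1.1 (hf0 x), ← hfF, inv_div_le_iff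
      (ENNReal.rpow_pos (pos_iff_ne_zero.2 (hFpos x hxb)) (ht x)).ne'
      (ENNReal.rpow_ne_top_of_nonneg H.r_pos.le (ht x)) hC0 hCt]
  -- Integrating `W ≤ C ^ (1/(p-1)) (mass F) ^ (1/(p-1))` over `(x, b)` gives the claim; left of `a`
  -- the function `W` is zero.
  refine rpow_le_mul_rpow H.r_pos ?_
  rw [← tail_const_mul _ (measurable_mass.pow_const _), tail_restrict hSm]
  refine tail_mono (fun s => ?_) x
  by_cases hs : s ∈ Ioo a b
  · rw [indicator_of_mem (show s ∈ S from ⟨hJD hs, hs.2⟩),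
      ← ENNReal.mul_rpow_of_nonneg _ _ (inv_pos.2 H.r_pos).le]
    have := ENNReal.rpow_le_rpow (hWle s hs) (inv_pos.2 H.r_pos).le
    rwa [ENNReal.rpow_rpow_inv H.r_pos.ne'] at this
  · rw [hWoff s hs, ENNReal.ofReal_zero]; exact zero_le

lemma iInf_FItilde'_le_lam :
    ⨅ f ∈ FItilde' p v D, ⨆ x ∈ openI D, (opI p u v f x)⁻¹ ≤ lam p u v D := by
  refine le_of_forall_gt fun C' hC' => ?_
  obtain ⟨C, hC, hCC'⟩ := exists_between hC'
  refine lt_of_le_of_lt ?_ hCC'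
  obtain ⟨c, hc, hcC⟩ := exists_between hC
  have hC0 : C ≠ 0 := (bot_le.trans_lt hC).ne'
  have hCt : C ≠ ∞ := (hCC'.trans_le le_top).ne
  obtain ⟨a, ha, b, hb, -, w, hwm, hw⟩ := H.exists_interval_of_lam_lt hc
  have h0 := zero_mem_closedI H.hD
  have hb' := openI_subset_closedI hb
  have hJD : Ioo 0 b ⊆ openI D := Ioo_subset_openI h0 hb'
  obtain ⟨W, hWm, hW0, hWoff, hWc, hWpos, ht, hWle⟩ :=
    H.exists_tail_subsolution h0 hb hb.1 hcC hwm (hw 0 ha.1.le)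
  set μ := densityMeasure D u
  set ν := densityMeasure D (vhat p v) with hν
  set F := tail ν fun s => ENNReal.ofReal (W s) with hF
  set f : ℝ → ℝ := fun x => (F x).toReal with hf
  have hfF : ∀ x, F x = ENNReal.ofReal (f x) := fun x => (ENNReal.ofReal_toReal (ht x)).symm
  have hf0 : ∀ x, 0 ≤ f x := fun x => ENNReal.toReal_nonneg
  have hcont : Continuous f := continuous_tail_ofReal hWm.ennreal_ofReal ht
  have hfoff : ∀ x, b ≤ x → f x = 0 := fun x hx => by
    have h : F x = 0 := tail_ofReal_eq_zero hWoff hx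
    simp only [hf, h, ENNReal.toReal_zero]
  have hFpos : ∀ x, x < b → F x ≠ 0 := fun x hx =>
    H.tail_ofReal_ne_zero h0 hb' hb.1 hWm hWpos hx
  have hfl : ∀ x ∈ Ioo 0 b, flux p v f x = -W x := fun x hx =>
    flux_tail H.hvi H.hvm H.hv hWm hW0 ht (hJD hx) (hWc.continuousAt (isOpen_Ioo.mem_nhds hx))
  have hneg : ∀ x ∈ Ioo 0 b, flux p v f x < 0 := fun x hx => by
    rw [hfl x hx]; exact neg_neg_of_pos (hWpos x hx)
  have hmem : f ∈ FItilde' p v D :=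
    ⟨b, hb, fun x _ hx => hfoff x hx, hcont.continuousOn, hneg,
      fluxContinuousOn_tail H.hvi H.hvm H.hv hWm hW0 ht isOpen_Ioo hJD ordConnected_Ioo hWc⟩
  refine (iInf₂_le f hmem).trans (iSup₂_le fun x hx => ?_)
  have hm : massInt p u f x = mass μ (p - 1) F x :=
    massInt_eq H.hum H.hp.le (openI_subset_closedI hx) fun y _ => ⟨hf0 y, hfF y⟩
  rw [opI, hm]
  rcases lt_or_ge x b with hxb | hxb
  · have hxJ : x ∈ Ioo 0 b := ⟨hx.1, hxb⟩
    rw [neg_mul_abs_rpow (hneg x hxJ), hfl x hxJ, neg_neg, inv_div_le_iff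
      (ENNReal.ofReal_pos.2 (Real.rpow_pos_of_pos (hWpos x hxJ) _)).ne' ENNReal.ofReal_ne_top
      hC0 hCt, ← ENNReal.ofReal_rpow_of_nonneg (hW0 x) H.r_pos.le]
    exact hWle x hxJ
  -- Past `b` the denominator of `I(f)` is `0`. The mass is nonzero, so `I(f) = ∞` and its inverse
  -- is `0`; a quotient `0 / 0` would have been `0` instead.
  · rw [flux_eq_zero_of_right fun y hy => hfoff y (hxb.trans hy), zero_mul, neg_zero,
      ENNReal.ofReal_zero, ENNReal.div_zero, ENNReal.inv_top]
    · exact zero_le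
    · exact H.mass_ne_zero measurable_tail hb.1 le_rfl hxb hb'.2 fun y hy => hFpos y hy.2

end Weights

end NDCase

/-! ### The variational formulas -/

theorem proposition2p2 (p : ℝ) (hp : 1 < p) (D : EReal) (hD : 0 < D) (u v : ℝ → ℝ)
    (hum : Measurable u) (hvm : Measurable v)
    (hu : ∀ᵐ x ∂volume.restrict (NDCase.openI D), 0 < u x)
    (hv : ∀ᵐ x ∂volume.restrict (NDCase.openI D), 0 < v x)
    (hui : LocallyIntegrableOn u (NDCase.closedI D))
    (hvi : LocallyIntegrableOn (NDCase.vhat p v) (NDCase.closedI D)) :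
    NDCase.lam p u v D =
        ⨆ f ∈ NDCase.FI p v D, ⨅ x ∈ NDCase.openI D, (NDCase.opII p u v D f x)⁻¹ ∧
    NDCase.lam p u v D =
        ⨅ f ∈ NDCase.FIItilde D ∪ NDCase.FIItilde' p u v D,
          ⨆ x ∈ NDCase.suppI D f, (NDCase.opII p u v D f x)⁻¹ ∧
    NDCase.lam p u v D =
        ⨅ f ∈ NDCase.FItilde p v D,
          ⨆ x ∈ NDCase.suppI D f, (NDCase.opII p u v D f x)⁻¹ ∧
    NDCase.lam p u v D =
        ⨅ f ∈ NDCase.FItilde' p v D, ⨆ x ∈ NDCase.openI D, (NDCase.opI p u v f x)⁻¹ := by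
  have H : NDCase.Weights p D u v := ⟨hp, hD, hum, hvm, hu, hv, hui, hvi⟩
  -- As `F̃_I` is contained in `F̃_II`, one lower bound over the larger class and one upper bound
  -- over the smaller class settle both infima.
  have hle : (⨅ f ∈ NDCase.FIItilde D ∪ NDCase.FIItilde' p u v D,
      ⨆ x ∈ NDCase.suppI D f, (NDCase.opII p u v D f x)⁻¹) ≤
      ⨅ f ∈ NDCase.FItilde p v D, ⨆ x ∈ NDCase.suppI D f, (NDCase.opII p u v D f x)⁻¹ :=
    biInf_mono fun f hf => Or.inl (H.FItilde_subset_FIItilde hf)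
  exact ⟨le_antisymm H.lam_le_iSup_FI H.iSup_FI_le_lam,
    le_antisymm H.lam_le_iInf_FII (hle.trans H.iInf_FItilde_le_lam),
    le_antisymm (H.lam_le_iInf_FII.trans hle) H.iInf_FItilde_le_lam,
    le_antisymm H.lam_le_iInf_FItilde' H.iInf_FItilde'_le_lam⟩
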